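/- **Setting.** Let $(\mathcal X,\mathcal B)$ be a measurable space and $X=\{X_n\}_{n\ge1}$ an $\mathcal X$-valued random process. Let $P(x,\cdot)$, $x\in\mathcal X$, be a transition probability function from $\mathcal X$ to $\mathbb R$ (measurable in $x$), let $F_x$ be the distribution function of $P(x,\cdot)$, and assume that every $F_x$ has finite mean. Let $\{\xi_n^x\}_{x\in\mathcal X}$, $n\ge1$, be families of real random variables, mutually independent in $n$ and independent of the process $X$, such that $\xi_n^x$ has distribution function $F_x$ for all $n$ and $x$ (with the joint measurability that makes $\xi_n^{X_n}$ a random variable). Put $$S_0=0,\qquad S_n=\sum_{i=1}^n\xi_i^{X_i},\qquad M=\sup_{n\ge0}S_n,\qquad \mu(y)=\min\{n\ge1:\ S_n>y\}.$$ For a distribution function $H$ write $\overline H(y)=1-H(y)$ and let $H^s$ be the distribution with tail $\overline H^s(y)=\min\bigl(1,\int_y^\infty\overline H(t)\,dt\bigr)$. A distribution $H$ on $\mathbb R_+$ is subexponential if $\overline H(y)>0$ for all $y$ and $\overline{H^{*2}}(y)/\overline H(y)\to2$ as $y\to\infty$; a distribution on $\mathbb R$ is called subexponential if its tail is positive everywhere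 and the law of the positive part is subexponential. Assume that there are a distribution function $F$ on $\mathbb R_+$ with finite mean, a measurable function $c:\mathcal X\to\mathbb R_+$ and a constant $L<\infty$ such that $$\overline F_x(y)\sim c(x)\overline F(y)\ \text{ as } y\to\infty,\quad\text{for each } x\in\mathcal X,\qquad\qquad \overline F_x(y)\le L\,\overline F(y)\ \text{ for all } x\in\mathcal X,\ y\ge0,$$ where $\overline F_x\sim 0\cdot\overline F$ means $\overline F_x=o(\overline F)$. The process $X$ is regenerative if there are integer-valued random variables $0\le T_0<T_1<T_2<\cdots$ a.s. such that, with $\tau_0=T_0$ and $\tau_n=T_n-T_{n-1}$ for $n\ge1$, the cycles $Z_0=\{\tau_0;X_1,\dots,X_{T_0}\}$ and $Z_n=\{\tau_n;X_{T_{n-1}+1},\dots,X_{T_n}\}$, $n\ge1$, are mutually independent for $n\ge0$ and identically distributed for $n\ge1$. Write $\tau=\tau_1$ and, if $\mathbf E\tau<\infty$, let $$\pi(B)=\frac1{\mathbf E\tau}\,\mathbf E\Bigl(\sum_{i=T_0+1}^{T_1}\mathbf I(X_i\in B)\Bigr),\qquad C(B)=\int_Bc(x)\,\pi(dx),\qquad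 B\in\mathcal B.$$ **Theorem.** Assume that $X$ is regenerative with $\mathbf E\tau<\infty$, that $\int_{\mathcal X}\mathbf E|\xi_1^x|\,\pi(dx)<\infty$ and $\int_{\mathcal X}\mathbf E\xi_1^x\,\pi(dx)=-a$ for some $a>0$, and that $F^s$ is subexponential. Assume also that, for all $b>0$, $$\mathbf P(b\tau_0>y)=o(\overline F^s(y)),\qquad \mathbf P(b\tau>y)=o(\overline F(y))\qquad\text{as } y\to\infty.$$ Then $$\lim_{y\to\infty}\frac{\mathbf P(M>y,\ X_{\mu(y)}\in B)}{\overline F^s(y)}=\frac{C(B)}a\qquad\text{for all } B\in\mathcal B.$$ -/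

import Mathlib

open MeasureTheory ProbabilityTheory Filter Topology Asymptotics
open scoped ENNReal

namespace ModulatedWalk

noncomputable section

/-! ### Tails of distributions on the real line

A distribution on `ℝ` is represented by a probability measure on `ℝ`. -/

/-- The tail `H̄(y) = H((y, ∞)) = 1 - H((-∞, y])` of a distribution `H` on `ℝ`. -/
def tail (H : Measure ℝ) (y : ℝ) : ℝ := H.real (Set.Ioi y)

/-- The integrated (second) tail `H̄ˢ(y) = min (1, ∫_y^∞ H̄(t) dt)`. -/
def secondTail (H : Measure ℝ) (y : ℝ) : ℝ := min 1 (∫ t in Set.Ioi y, tail H t)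

lemma tail_nonneg (H : Measure ℝ) (y : ℝ) : 0 ≤ tail H y := measureReal_nonneg

lemma tail_antitone (H : Measure ℝ) [IsProbabilityMeasure H] : Antitone (tail H) :=
  fun _ _ h => measureReal_mono (Set.Ioi_subset_Ioi h)

lemma integrableOn_tail_of_le (H : Measure ℝ) [IsProbabilityMeasure H] {x y : ℝ} (hxy : x ≤ y)
    (h : IntegrableOn (tail H) (Set.Ioi y)) : IntegrableOn (tail H) (Set.Ioi x) := by
  rw [← Set.Ioc_union_Ioi_eq_Ioi hxy]
  refine IntegrableOn.union ?_ h
  exact ((tail_antitone H).antitoneOn _).integrableOn_isCompact isCompact_Icc |>.mono_set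
    Set.Ioc_subset_Icc_self

/-- Either `H̄` is integrable on every half-line `(y, ∞)` or on none. -/
lemma integrableOn_tail_or (H : Measure ℝ) [IsProbabilityMeasure H] :
    (∀ y, IntegrableOn (tail H) (Set.Ioi y)) ∨ (∀ y, ¬ IntegrableOn (tail H) (Set.Ioi y)) := by
  by_cases h : ∃ y, IntegrableOn (tail H) (Set.Ioi y)
  · obtain ⟨y, hy⟩ := h
    refine Or.inl fun x => ?_
    rcases le_total x y with hxy | hxy
    · exact integrableOn_tail_of_le H hxy hy
    · exact hy.mono_set (Set.Ioi_subset_Ioi hxy)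
  · exact Or.inr fun y hy => h ⟨y, hy⟩

lemma secondTail_antitone (H : Measure ℝ) [IsProbabilityMeasure H] : Antitone (secondTail H) := by
  intro x y hxy
  refine min_le_min le_rfl ?_
  rcases integrableOn_tail_or H with h | h
  · exact setIntegral_mono_set (h x) (Filter.Eventually.of_forall fun t => tail_nonneg H t)
      (Set.Ioi_subset_Ioi hxy).eventuallyLE
  · rw [integral_undef (h x), integral_undef (h y)]

lemma secondTail_rightContinuous (H : Measure ℝ) [IsProbabilityMeasure H] (x : ℝ) :
    ContinuousWithinAt (secondTail H) (Set.Ici x) x := by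
  refine Filter.Tendsto.min tendsto_const_nhds ?_
  rcases integrableOn_tail_or H with h | h
  · exact (h x).continuousWithinAt_Ici_primitive_Ioi
  · have h0 : ∀ y, ∫ t in Set.Ioi y, tail H t = 0 := fun y => integral_undef (h y)
    simp only [h0]
    exact tendsto_const_nhds

/-- The distribution function `Hˢ(y) = 1 - H̄ˢ(y)` of the second-tail distribution. -/
def secondTailCDF (H : Measure ℝ) [IsProbabilityMeasure H] : StieltjesFunction ℝ where
  toFun y := 1 - secondTail H y
  mono' := fun _ _ h => sub_le_sub_left (secondTail_antitone H h) 1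
  right_continuous' := fun x => continuousWithinAt_const.sub (secondTail_rightContinuous H x)

/-- The second-tail distribution `Hˢ` of `H`, as a measure on `ℝ`. -/
def secondTailLaw (H : Measure ℝ) [IsProbabilityMeasure H] : Measure ℝ := (secondTailCDF H).measure

/-- The distribution on `ℝ₊` with the same tail on `[0, ∞)` as `H`, i.e. the law of `max(ξ, 0)`
for `ξ` with law `H`.  It is `H` itself if `H` is a distribution on `ℝ₊`. -/
def positivePart (H : Measure ℝ) : Measure ℝ := H.map (fun t => max t 0)

/-- `H` is subexponential: `H̄(y) > 0` for all `y`, and, for `H` viewed as a distribution on `ℝ₊`,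
the tail of the convolution `H * H` is asymptotically twice the tail of `H`. -/
def IsSubexponential (H : Measure ℝ) : Prop :=
  (∀ y, 0 < tail H y) ∧
    Tendsto (fun y => tail ((positivePart H).conv (positivePart H)) y / tail (positivePart H) y)
      atTop (𝓝 2)

/-! ### Random walks modulated by a process

`X n` and `ξ n x` are indexed by `n : ℕ`, and only the indices `n ≥ 1` are used. -/

variable {Ω 𝒳 : Type*}

/-- The modulated random walk `S_n = ∑_{i=1}^n ξ_i^{X_i}`, `S_0 = 0`. -/
def walk (X : ℕ → Ω → 𝒳) (ξ : ℕ → 𝒳 → Ω → ℝ) (n : ℕ) (ω : Ω) : ℝ :=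
  ∑ i ∈ Finset.Icc 1 n, ξ i (X i ω) ω

/-- The maximum `M = sup_{n ≥ 0} S_n`, possibly `+∞`. -/
def walkSup (X : ℕ → Ω → 𝒳) (ξ : ℕ → 𝒳 → Ω → ℝ) (ω : Ω) : EReal :=
  ⨆ n : ℕ, (walk X ξ n ω : EReal)

/-- The passage time `μ(y) = min {n ≥ 1 : S_n > y}`.  Its value is irrelevant (it is `0`) if no
such `n` exists; it is only used on the event `M > y` for large `y`. -/
def passageTime (X : ℕ → Ω → 𝒳) (ξ : ℕ → 𝒳 → Ω → ℝ) (y : ℝ) (ω : Ω) : ℕ :=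
  sInf {n : ℕ | 1 ≤ n ∧ y < walk X ξ n ω}

/-- The families `{ξ_n^x}_x`, `n ≥ 1`, are mutually independent in `n` and jointly independent of
the process `X = {X_n}_{n ≥ 1}`, and each `ξ_n^x` has law `P(x, ·)`.  The randomness of the `n`-th
family is carried by a `σ`-algebra `𝓖 n`; the joint measurability in `(x, ω)` is what makes
`ξ_n^{X_n}` a random variable.  No dependence structure is imposed on `ξ_n^x` for fixed `n` and
different `x`. -/
structure IsModulatedFamily [MeasurableSpace Ω] [MeasurableSpace 𝒳] (μ : Measure Ω)
    (X : ℕ → Ω → 𝒳) (P : Kernel 𝒳 ℝ) (ξ : ℕ → 𝒳 → Ω → ℝ) : Prop where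
  exists_sigmaAlgebra : ∃ 𝓖 : ℕ → MeasurableSpace Ω,
    (∀ n, 𝓖 n ≤ ‹MeasurableSpace Ω›) ∧
    (∀ n, 1 ≤ n → Measurable[(‹MeasurableSpace 𝒳›).prod (𝓖 n)]
      (fun p : 𝒳 × Ω => ξ n p.1 p.2)) ∧
    iIndep (fun n => 𝓖 (n + 1)) μ ∧
    Indep (⨆ n, 𝓖 (n + 1)) (⨆ n, (‹MeasurableSpace 𝒳›).comap (X (n + 1))) μ
  law : ∀ n, 1 ≤ n → ∀ x, μ.map (ξ n x) = P x

/-! ### Regenerative processes -/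

/-- The cycle lengths `τ_0 = T_0` and `τ_n = T_n - T_{n-1}` for `n ≥ 1`. -/
def cycleLength (T : ℕ → Ω → ℕ) : ℕ → Ω → ℕ
  | 0, ω => T 0 ω
  | n + 1, ω => T (n + 1) ω - T n ω

/-- The time after which the `n`-th cycle starts: `0` for `n = 0` and `T_{n-1}` for `n ≥ 1`. -/
def cycleStart (T : ℕ → Ω → ℕ) : ℕ → Ω → ℕ
  | 0, _ => 0
  | n + 1, ω => T n ω

/-- The `n`-th cycle: `Z_0 = {τ_0; X_1, …, X_{T_0}}` and `Z_n = {τ_n; X_{T_{n-1}+1}, …, X_{T_n}}`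
for `n ≥ 1`, as a random element of the space `⨆_k {k} × 𝒳^k` of finite words. -/
def cycle (X : ℕ → Ω → 𝒳) (T : ℕ → Ω → ℕ) (n : ℕ) (ω : Ω) : Σ k : ℕ, (Fin k → 𝒳) :=
  ⟨cycleLength T n ω, fun i => X (cycleStart T n ω + 1 + i) ω⟩

/-- `X = {X_n}_{n ≥ 1}` is regenerative with regeneration times `0 ≤ T_0 < T_1 < ⋯`. -/
structure IsRegenerative [MeasurableSpace Ω] [MeasurableSpace 𝒳] (μ : Measure Ω)
    (X : ℕ → Ω → 𝒳) (T : ℕ → Ω → ℕ) : Prop where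
  measurable_process : ∀ n, 1 ≤ n → Measurable (X n)
  measurable_time : ∀ n, Measurable (T n)
  strictMono : ∀ᵐ ω ∂μ, StrictMono (fun n => T n ω)
  indep : iIndepFun (cycle X T) μ
  identDistrib : ∀ n, 1 ≤ n → IdentDistrib (cycle X T n) (cycle X T 1) μ μ

/-- The occupation measure of the first cycle, `B ↦ 𝐄 ∑_{i=T_0+1}^{T_1} 𝐈(X_i ∈ B)`. -/
def occupation [MeasurableSpace Ω] [MeasurableSpace 𝒳] (μ : Measure Ω)
    (X : ℕ → Ω → 𝒳) (T : ℕ → Ω → ℕ) : Measure 𝒳 :=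
  Measure.sum fun i : ℕ => (μ.restrict {ω | T 0 ω < i ∧ i ≤ T 1 ω}).map (X i)

/-- The limiting law `π(B) = (𝐄 τ)⁻¹ 𝐄 ∑_{i=T_0+1}^{T_1} 𝐈(X_i ∈ B)`, with `τ = τ_1`. -/
def regenLaw [MeasurableSpace Ω] [MeasurableSpace 𝒳] (μ : Measure Ω)
    (X : ℕ → Ω → 𝒳) (T : ℕ → Ω → ℕ) : Measure 𝒳 :=
  (∫⁻ ω, (cycleLength T 1 ω : ℝ≥0∞) ∂μ)⁻¹ • occupation μ X T

end

end ModulatedWalk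

open ModulatedWalk

/-! The mechanism is a single big jump. The walk falls by d = a·Eτ per cycle on average, so it
exceeds a high level y essentially only if one increment, in cycle j say, exceeds about y + j d.
Adding the tails over the visits to B within a cycle gives about C_B F̄(y + j d), where C_B is the
integral of c over B under the occupation measure of a cycle. Summation over j gives C_B F̄ˢ(y)/d,
which is C(B)/a times F̄ˢ(y), because the occupation measure is Eτ·π.

Asymptotics are handled as one-sided bounds (`AsympLE`). A sharp upper bound is needed only for the
whole state space: together with sharp lower bounds for B and for its complement it forces
convergence (`tendsto_of_bounds`).

Given X the increments are independent with laws F_{X_n}, so the passage probability may be computed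
from independent noise indexed by cycle and by position in the cycle
(`measure_passage_eq_lintegral`). With this indexing the cycle sums D_j and the cycle sums V_j of
positive parts form i.i.d. pairs, and the walk is dominated by the V of the initial cycle plus D_0 +
... + D_{m-1} + V_m for some m.

Upper bound. For such a perturbed walk (`maximum_bound`), crossing a line R - n e with e < d is
unlikely for large R by the strong law; the value at the first crossing has tail at most (1/e)∫P(V >
t)dt, up to a shift; and after the crossing the walk starts afresh. `renewal_bound` solves the
resulting defective renewal inequality. It remains to find the integrated tail of V. The excess of a
sum over y is at most the sum of the excesses plus a mixed term (`intTail_conv_le`), and the mixed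
term is negligible for a fixed number of summands. Long cycles need bounds linear in the number of
summands, available after a shift proportional to that number (`exists_sumBounds`, itself a
consequence of `maximum_bound`); the tail assumption on τ makes the shift harmless. Only the
integrated tail of F has to be subexponential, not F itself.

Lower bound. With probability close to one the walk stays in a corridor, below y and above -K - j d'
in cycle j + 1, where d' > d. From inside the corridor a jump above y + K + j d' is a first passage,
and first passages at different times are disjoint, so their probabilities add up
(`mul_tsum_le_firstPassage`). The corridor and the cycle lengths are dependent, but the lengths are
identically distributed and integrable, which bounds the loss uniformly over the cycles
(`exists_lintegral_corridor_compl_le`). -/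

open scoped NNReal

namespace ModulatedWalk

/-! ### Asymptotic domination -/

/-- `limsup f / h ≤ k` at infinity, stated without division. -/
def AsympLE (h f : ℝ → ℝ≥0∞) (k : ℝ≥0) : Prop :=
  ∀ ε : ℝ≥0, 0 < ε → ∀ᶠ y in atTop, f y ≤ ((k + ε : ℝ≥0) : ℝ≥0∞) * h y

section AsympLE

variable {h f g : ℝ → ℝ≥0∞} {k l : ℝ≥0}

lemma AsympLE.of_tendsto {u : ℝ≥0 → ℝ≥0} (hu : Tendsto u (𝓝[>] 0) (𝓝 k))
    (H : ∀ ε : ℝ≥0, 0 < ε → ∀ᶠ y in atTop, f y ≤ (u ε : ℝ≥0∞) * h y) : AsympLE h f k := by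
  intro ε hε
  have h1 : ∀ᶠ x in 𝓝[>] (0 : ℝ≥0), u x ≤ k + ε :=
    hu.eventually (Iic_mem_nhds (lt_add_of_pos_right k hε))
  obtain ⟨x, hx, hx0⟩ := (h1.and self_mem_nhdsWithin).exists
  filter_upwards [H x hx0] with y hy
  exact hy.trans (by gcongr)

lemma AsympLE.of_continuous {u : ℝ≥0 → ℝ≥0} (hu : Continuous u) (h0 : u 0 = k)
    (H : ∀ ε : ℝ≥0, 0 < ε → ∀ᶠ y in atTop, f y ≤ (u ε : ℝ≥0∞) * h y) : AsympLE h f k :=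
  AsympLE.of_tendsto (h0 ▸ (hu.tendsto 0).mono_left nhdsWithin_le_nhds) H

lemma AsympLE.mono (hg : AsympLE h g k) (hfg : ∀ᶠ y in atTop, f y ≤ g y) : AsympLE h f k :=
  fun ε hε => by filter_upwards [hg ε hε, hfg] with y h1 h2 using h2.trans h1

lemma AsympLE.weaken (hf : AsympLE h f k) (hkl : k ≤ l) : AsympLE h f l :=
  fun ε hε => by
    filter_upwards [hf ε hε] with y hy
    exact hy.trans (by gcongr)

/-- Admissible constants form a closed set, so an infimum of admissible constants is again
admissible. -/
lemma AsympLE.of_forall_gt (H : ∀ ε : ℝ≥0, 0 < ε → AsympLE h f (k + ε)) : AsympLE h f k :=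
  AsympLE.of_continuous (u := fun ε => k + ε + ε) (by fun_prop) (by simp)
    fun ε hε => H ε hε ε hε

lemma AsympLE.of_le (H : ∀ᶠ y in atTop, f y ≤ k * h y) : AsympLE h f k := by
  intro ε _
  filter_upwards [H] with y hy
  exact hy.trans (by gcongr; exact le_self_add)

lemma AsympLE.add (hf : AsympLE h f k) (hg : AsympLE h g l) :
    AsympLE h (fun y => f y + g y) (k + l) := by
  refine AsympLE.of_continuous (u := fun ε => (k + ε) + (l + ε)) (by fun_prop) (by simp)
    fun ε hε => ?_
  filter_upwards [hf ε hε, hg ε hε] with y h1 h2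
  push_cast at h1 h2 ⊢
  rw [add_mul _ _ (h y)]
  exact add_le_add h1 h2

lemma AsympLE.const_mul (c : ℝ≥0) (hf : AsympLE h f k) :
    AsympLE h (fun y => c * f y) (c * k) := by
  refine AsympLE.of_continuous (u := fun ε => c * (k + ε)) (by fun_prop) (by simp)
    fun ε hε => ?_
  filter_upwards [hf ε hε] with y h1
  push_cast at h1 ⊢
  rw [mul_assoc]
  gcongr

lemma AsympLE.trans (hf : AsympLE g f k) (hg : AsympLE h g l) : AsympLE h f (k * l) := by
  refine AsympLE.of_continuous (u := fun ε => (k + ε) * (l + ε)) (by fun_prop) (by simp)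
    fun ε hε => ?_
  filter_upwards [hf ε hε, hg ε hε] with y h1 h2
  push_cast at h1 h2 ⊢
  rw [mul_assoc]
  exact h1.trans (by gcongr)

lemma AsympLE.sum {ι : Type*} (s : Finset ι) {f : ι → ℝ → ℝ≥0∞} {k : ι → ℝ≥0}
    (hf : ∀ i ∈ s, AsympLE h (f i) (k i)) :
    AsympLE h (fun y => ∑ i ∈ s, f i y) (∑ i ∈ s, k i) := by
  classical
  induction s using Finset.induction_on with
  | empty => simpa using AsympLE.of_le (k := 0) (by simp)
  | insert a s ha ih =>
    simp only [Finset.sum_insert ha]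
    exact (hf a (by simp)).add (ih fun i hi => hf i (by simp [hi]))

lemma AsympLE.comp_sub (hf : AsympLE h f k) (K : ℝ) :
    AsympLE (fun y => h (y - K)) (fun y => f (y - K)) k :=
  fun ε hε => (tendsto_atTop_add_const_right atTop (-K) tendsto_id).eventually (hf ε hε)

end AsympLE

lemma exists_coe_of_ne_top {x : ℝ≥0∞} (hx : x ≠ ∞) : ∃ y : ℝ≥0, (y : ℝ≥0∞) = x :=
  ⟨x.toNNReal, ENNReal.coe_toNNReal hx⟩

/-! ### Tails of convolutions -/

lemma measurable_Ioi (H : Measure ℝ) : Measurable fun y => H (Set.Ioi y) :=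
  Antitone.measurable fun _ _ h => measure_mono (Set.Ioi_subset_Ioi h)

lemma measurable_Ioi_sub (H : Measure ℝ) (y : ℝ) : Measurable fun t => H (Set.Ioi (y - t)) :=
  (measurable_Ioi H).comp (measurable_const.sub measurable_id)

lemma antitone_Ioi (H : Measure ℝ) : Antitone fun y => H (Set.Ioi y) :=
  fun _ _ h => measure_mono (Set.Ioi_subset_Ioi h)

lemma tendsto_Ioi (H : Measure ℝ) [IsFiniteMeasure H] :
    Tendsto (fun y => H (Set.Ioi y)) atTop (𝓝 0) := by
  have := tendsto_measure_iInter_atTop (μ := H) (s := fun y : ℝ => Set.Ioi y)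
    (fun y => measurableSet_Ioi.nullMeasurableSet) (fun _ _ h => Set.Ioi_subset_Ioi h)
    ⟨0, measure_ne_top _ _⟩
  have h0 : (⋂ n : ℝ, Set.Ioi n) = ∅ := by
    ext x
    simp only [Set.mem_iInter, Set.mem_Ioi, Set.mem_empty_iff_false, iff_false, not_forall, not_lt]
    exact ⟨x, le_rfl⟩
  rwa [h0, measure_empty] at this

lemma conv_Ioi (l m : Measure ℝ) [SFinite l] [SFinite m] (y : ℝ) :
    (l.conv m) (Set.Ioi y) = ∫⁻ t, l (Set.Ioi (y - t)) ∂m := by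
  rw [Measure.conv, Measure.map_apply measurable_add measurableSet_Ioi,
    Measure.prod_apply_symm (measurable_add measurableSet_Ioi)]
  refine lintegral_congr fun t => ?_
  congr 1
  ext x
  simp [sub_lt_iff_lt_add]

lemma Ioi_of_neg {H : Measure ℝ} [IsProbabilityMeasure H] (h0 : H (Set.Iio 0) = 0) {y : ℝ}
    (hy : y < 0) : H (Set.Ioi y) = 1 := by
  rw [← prob_compl_eq_zero_iff measurableSet_Ioi, Set.compl_Ioi]
  exact measure_mono_null (fun x hx => lt_of_le_of_lt hx hy) h0

lemma lintegral_split_three (m : Measure ℝ) (f : ℝ → ℝ≥0∞) {A y : ℝ} (h : A ≤ y) :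
    ∫⁻ t, f t ∂m = (∫⁻ t in Set.Iic A, f t ∂m) + (∫⁻ t in Set.Ioc A y, f t ∂m)
      + ∫⁻ t in Set.Ioi y, f t ∂m := by
  have h1 := lintegral_add_compl (μ := m) f (measurableSet_Iic (a := y))
  have h2 := lintegral_union (μ := m) (f := f) (measurableSet_Ioc (a := A) (b := y))
    (A := Set.Iic A) (Set.disjoint_left.2 fun x hx hx' => absurd hx'.1 (not_lt.2 hx))
  rw [Set.Iic_union_Ioc_eq_Iic h] at h2
  rw [Set.compl_Iic] at h1
  rw [← h1, h2]

/-- `H` is a subexponential distribution on `ℝ₊`. -/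
structure IsSubexpTail (H : Measure ℝ) : Prop where
  nonneg : H (Set.Iio 0) = 0
  pos : ∀ y, 0 < H (Set.Ioi y)
  conv : AsympLE (fun y => H (Set.Ioi y)) (fun y => (H.conv H) (Set.Ioi y)) 2

namespace IsSubexpTail

variable {H : Measure ℝ} [IsProbabilityMeasure H]

/-- The convolution integral is cut at A and y. For 0 ≤ t ≤ A the integrand is at least its value at
0, and for t > y it equals 1 because `H` charges only the nonnegative half-line. -/
lemma conv_split (h0 : H (Set.Iio 0) = 0) {A y : ℝ} (hy : A ≤ y) :
    H (Set.Ioi y) * H (Set.Iic A) + (∫⁻ t in Set.Ioc A y, H (Set.Ioi (y - t)) ∂H)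
      + H (Set.Ioi y) ≤ (H.conv H) (Set.Ioi y) := by
  rw [conv_Ioi, lintegral_split_three H (fun t => H (Set.Ioi (y - t))) hy]
  have h1 : H (Set.Ioi y) * H (Set.Iic A) ≤ ∫⁻ t in Set.Iic A, H (Set.Ioi (y - t)) ∂H := by
    have h2 : ∫⁻ t in Set.Iic A, H (Set.Ioi (y - t)) ∂H
        = ∫⁻ t in Set.Icc 0 A, H (Set.Ioi (y - t)) ∂H := by
      refine setLIntegral_congr ?_
      refine (ae_eq_set.2 ⟨?_, ?_⟩)
      · refine measure_mono_null (fun x hx => ?_) h0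
        simp only [Set.mem_sdiff, Set.mem_Iic, Set.mem_Icc, not_and, not_le] at hx
        by_contra hx0
        exact absurd hx.1 (not_le.2 (hx.2 (not_lt.1 hx0)))
      · refine measure_mono_null (fun x hx => ?_) h0
        exact absurd hx.1.2 hx.2
    have h3 : H (Set.Iic A) = H (Set.Icc 0 A) := by
      refine measure_congr (ae_eq_set.2 ⟨?_, ?_⟩)
      · refine measure_mono_null (fun x hx => ?_) h0
        simp only [Set.mem_sdiff, Set.mem_Iic, Set.mem_Icc, not_and, not_le] at hx
        by_contra hx0
        exact absurd hx.1 (not_le.2 (hx.2 (not_lt.1 hx0)))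
      · refine measure_mono_null (fun x hx => ?_) h0
        exact absurd hx.1.2 hx.2
    rw [h2, h3, ← setLIntegral_const]
    exact setLIntegral_mono' measurableSet_Icc fun t ht =>
      measure_mono (Set.Ioi_subset_Ioi (by linarith [ht.1]))
  have h4 : ∫⁻ t in Set.Ioi y, H (Set.Ioi (y - t)) ∂H = H (Set.Ioi y) := by
    rw [setLIntegral_congr_fun (g := fun _ => 1) measurableSet_Ioi
      (fun t ht => Ioi_of_neg h0 (by simpa using ht))]
    simp
  rw [h4]
  gcongr

/-- Subexponentiality allows about 2 H̄(y) for the whole convolution, and the outer ranges already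
use up (1 + H(A)) H̄(y). What is left for the middle range is H̄(A) H̄(y), small for large A. -/
lemma middle (hH : IsSubexpTail H) (A : ℝ) :
    AsympLE (fun y => H (Set.Ioi y)) (fun y => ∫⁻ t in Set.Ioc A y, H (Set.Ioi (y - t)) ∂H)
      (H (Set.Ioi A)).toNNReal := by
  intro ε hε
  filter_upwards [hH.conv ε hε, eventually_ge_atTop A] with y hy hyA
  have h1 := (conv_split hH.nonneg hyA).trans hy
  have hf : H (Set.Ioi y) ≠ ∞ := measure_ne_top _ _
  set p := H (Set.Ioi y)
  set U := ∫⁻ t in Set.Ioc A y, H (Set.Ioi (y - t)) ∂H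
  have hpart : H (Set.Iic A) + H (Set.Ioi A) = 1 := by
    rw [← Set.compl_Iic, prob_add_prob_compl measurableSet_Iic]
  have h2 : (p * H (Set.Iic A) + p) + U ≤
      (p * H (Set.Iic A) + p) + (((H (Set.Ioi A)).toNNReal + ε : ℝ≥0) : ℝ≥0∞) * p := by
    calc (p * H (Set.Iic A) + p) + U = p * H (Set.Iic A) + U + p := by ring
      _ ≤ _ := h1
      _ = (H (Set.Iic A) + H (Set.Ioi A) + 1 + ε) * p := by
          rw [hpart]; push_cast; congr 2; norm_num
      _ = _ := by
          push_cast
          rw [ENNReal.coe_toNNReal (measure_ne_top _ _)]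
          ring
  refine (ENNReal.add_le_add_iff_left ?_).1 h2
  exact ENNReal.add_ne_top.2 ⟨ENNReal.mul_ne_top hf (measure_ne_top _ _), hf⟩

/-- Subexponential distributions are long-tailed. -/
lemma long (hH : IsSubexpTail H) (K : ℝ) :
    AsympLE (fun y => H (Set.Ioi y)) (fun y => H (Set.Ioi (y - K))) 1 := by
  wlog hK : 0 ≤ K
  · refine (this hH 0 le_rfl).mono (Eventually.of_forall fun y => ?_)
    exact measure_mono (Set.Ioi_subset_Ioi (by linarith))
  intro ε hε
  set a : ℝ≥0 := (H (Set.Ioi K)).toNNReal with ha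
  have haE : (a : ℝ≥0∞) = H (Set.Ioi K) := ENNReal.coe_toNNReal (measure_ne_top _ _)
  have ha0 : 0 < a := by
    rw [← ENNReal.coe_pos, haE]; exact hH.pos K
  -- pick `δ` with `a + δ ≤ (1 + ε) (a - δ)`
  obtain ⟨δ, hδ0, hδ⟩ : ∃ δ : ℝ≥0, 0 < δ ∧ a + δ + (1 + ε) * δ ≤ (1 + ε) * a := by
    refine ⟨ε * a / (2 + ε), by positivity, ?_⟩
    have : ε * a / (2 + ε) * (2 + ε) = ε * a := div_mul_cancel₀ _ (by positivity)
    calc a + ε * a / (2 + ε) + (1 + ε) * (ε * a / (2 + ε))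
        = a + ε * a / (2 + ε) * (2 + ε) := by ring
      _ = (1 + ε) * a := by rw [this]; ring
      _ ≤ _ := le_rfl
  have hsmall : ∀ᶠ y in atTop, H (Set.Ioi y) ≤ δ :=
    (tendsto_Ioi H).eventually (Iic_mem_nhds (by simpa using hδ0))
  filter_upwards [hH.middle K δ hδ0, eventually_ge_atTop K, hsmall] with y hy hyK hs
  -- The middle integral is at least H̄(y - K) times the mass of (K, y], which tends to `a`, while
  -- `middle` bounds it by about `a` H̄(y). Dividing by the mass gives long-tailedness.
  have hlow : H (Set.Ioi (y - K)) * H (Set.Ioc K y) ≤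
      ∫⁻ t in Set.Ioc K y, H (Set.Ioi (y - t)) ∂H := by
    rw [← setLIntegral_const]
    exact setLIntegral_mono' measurableSet_Ioc fun t ht =>
      measure_mono (Set.Ioi_subset_Ioi (by linarith [ht.1]))
  have hmass : H (Set.Ioc K y) + H (Set.Ioi y) = a := by
    rw [haE, ← Set.Ioc_union_Ioi_eq_Ioi hyK, measure_union _ measurableSet_Ioi]
    exact Set.disjoint_left.2 fun x hx hx' => absurd hx.2 (not_le.2 hx')
  have hc := hlow.trans hy
  rw [← ha] at hc
  obtain ⟨m, e1⟩ := exists_coe_of_ne_top (measure_ne_top H (Set.Ioc K y))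
  obtain ⟨p, e2⟩ := exists_coe_of_ne_top (measure_ne_top H (Set.Ioi y))
  obtain ⟨q, e3⟩ := exists_coe_of_ne_top (measure_ne_top H (Set.Ioi (y - K)))
  simp only [← e1, ← e2, ← e3] at hc hmass hs ⊢
  norm_cast at hc hmass hs ⊢
  have hm := hmass
  have hm2 : a + δ ≤ (1 + ε) * m := by
    have : (1 + ε) * a ≤ (1 + ε) * m + (1 + ε) * δ := by
      rw [← mul_add, ← hm]; gcongr
    exact le_of_add_le_add_right (hδ.trans this)
  have hm0 : 0 < m := by
    by_contra hcon
    have : m = 0 := by simpa using hcon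
    rw [this, mul_zero] at hm2
    exact absurd hm2 (not_le.2 (by positivity))
  have : q * m ≤ ((1 + ε) * p) * m := by
    calc q * m ≤ (a + δ) * p := hc
      _ ≤ ((1 + ε) * m) * p := by gcongr
      _ = _ := by ring
  exact le_of_mul_le_mul_right this hm0

end IsSubexpTail

lemma toNNReal_le_coe {x : ℝ≥0∞} {y : ℝ≥0} (h : x ≤ y) : x.toNNReal ≤ y := by
  simpa using ENNReal.toNNReal_mono ENNReal.coe_ne_top h

/-! ### Subexponential tails against finite measures with comparable tails. -/

namespace IsSubexpTail

variable {H : Measure ℝ} [IsProbabilityMeasure H]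

/-- As long as y - t stays above a fixed r, the tail of ν may be replaced by k H̄ and `middle`
applies. The remaining range t > y - r costs at most the mass of ν times H̄(y - r), and `long`
removes the shift. -/
lemma lintegral_Ioi_conv (hH : IsSubexpTail H) {ν : Measure ℝ} [IsFiniteMeasure ν] {k : ℝ≥0}
    (hν : AsympLE (fun y => H (Set.Ioi y)) (fun y => ν (Set.Ioi y)) k) (A : ℝ) :
    AsympLE (fun y => H (Set.Ioi y)) (fun y => ∫⁻ t in Set.Ioi A, ν (Set.Ioi (y - t)) ∂H)
      (k * (H (Set.Ioi A)).toNNReal + (ν Set.univ).toNNReal) := by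
  set a := (H (Set.Ioi A)).toNNReal
  set m := (ν Set.univ).toNNReal with hm
  have hmE : (m : ℝ≥0∞) = ν Set.univ := ENNReal.coe_toNNReal (measure_ne_top _ _)
  refine AsympLE.of_continuous (u := fun ε => (k + ε) * (a + ε) + m * (1 + ε)) (by fun_prop)
    (by simp) fun ε hε => ?_
  obtain ⟨A', hA'⟩ := eventually_atTop.1 (hν ε hε)
  filter_upwards [hH.middle A ε hε, hH.long (max A' 0) ε hε,
    eventually_ge_atTop (A + max A' 0)] with y h1 h2 hy
  set r := max A' 0
  have hr : 0 ≤ r := le_max_right _ _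
  have hsplit : ∫⁻ t in Set.Ioi A, ν (Set.Ioi (y - t)) ∂H
      = (∫⁻ t in Set.Ioc A (y - r), ν (Set.Ioi (y - t)) ∂H)
        + ∫⁻ t in Set.Ioi (y - r), ν (Set.Ioi (y - t)) ∂H := by
    rw [← lintegral_union measurableSet_Ioi (Set.disjoint_left.2
      fun x hx hx' => absurd hx.2 (not_le.2 hx')), Set.Ioc_union_Ioi_eq_Ioi (by linarith)]
  rw [hsplit]
  have e1 : ∫⁻ t in Set.Ioc A (y - r), ν (Set.Ioi (y - t)) ∂H
      ≤ ((k + ε : ℝ≥0) : ℝ≥0∞) * ∫⁻ t in Set.Ioc A y, H (Set.Ioi (y - t)) ∂H := by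
    rw [← lintegral_const_mul _ (measurable_Ioi_sub H y)]
    refine (setLIntegral_mono' measurableSet_Ioc fun t ht => hA' (y - t) ?_).trans
      (lintegral_mono_set (Set.Ioc_subset_Ioc_right (by linarith)))
    linarith [ht.2, le_max_left A' 0]
  have e2 : ∫⁻ t in Set.Ioi (y - r), ν (Set.Ioi (y - t)) ∂H ≤ m * H (Set.Ioi (y - r)) := by
    rw [← setLIntegral_const]
    exact setLIntegral_mono' measurableSet_Ioi fun t _ => hmE ▸ measure_mono (Set.subset_univ _)
  calc _ ≤ ((k + ε : ℝ≥0) : ℝ≥0∞) * (((a + ε : ℝ≥0) : ℝ≥0∞) * H (Set.Ioi y))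
        + m * (((1 + ε : ℝ≥0) : ℝ≥0∞) * H (Set.Ioi y)) :=
        add_le_add (e1.trans (by gcongr)) (e2.trans (by gcongr))
    _ = _ := by push_cast; ring

/-- One of the two parts has to be large: the part with law ν contributes k, the part with law `H`
contributes the total mass of ν. -/
lemma conv_finite (hH : IsSubexpTail H) {ν : Measure ℝ} [IsFiniteMeasure ν] {k : ℝ≥0}
    (hν : AsympLE (fun y => H (Set.Ioi y)) (fun y => ν (Set.Ioi y)) k) :
    AsympLE (fun y => H (Set.Ioi y)) (fun y => ∫⁻ t, H (Set.Ioi (y - t)) ∂ν)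
      (k + (ν Set.univ).toNNReal) := by
  have h1 := (hν.const_mul (H (Set.Iic 0)).toNNReal).add (hH.lintegral_Ioi_conv hν 0)
  have hpart : (H (Set.Iic 0)).toNNReal + (H (Set.Ioi 0)).toNNReal = 1 := by
    rw [← ENNReal.toNNReal_add (measure_ne_top _ _) (measure_ne_top _ _), ← Set.compl_Iic,
      prob_add_prob_compl measurableSet_Iic, ENNReal.toNNReal_one]
  refine (h1.weaken (le_of_eq ?_)).mono (Eventually.of_forall fun y => ?_)
  · calc _ = ((H (Set.Iic 0)).toNNReal + (H (Set.Ioi 0)).toNNReal) * k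
          + (ν Set.univ).toNNReal := by ring
      _ = _ := by rw [hpart, one_mul]
  · rw [← conv_Ioi, Measure.conv_comm, conv_Ioi,
      ← lintegral_add_compl _ (measurableSet_Iic (a := (0 : ℝ))), Set.compl_Iic]
    gcongr
    rw [ENNReal.coe_toNNReal (measure_ne_top _ _), mul_comm, ← setLIntegral_const]
    exact setLIntegral_mono' measurableSet_Iic fun t ht =>
      measure_mono (Set.Ioi_subset_Ioi (by linarith [Set.mem_Iic.1 ht]))

/-- Both sides are product measures of sets of pairs (s, t) with s + t > y, and t ≤ y - A then
forces s > A. -/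
lemma lintegral_Iic_le (ν : Measure ℝ) [SFinite ν] (A y : ℝ) :
    ∫⁻ t in Set.Iic (y - A), H (Set.Ioi (y - t)) ∂ν
      ≤ ∫⁻ t in Set.Ioi A, ν (Set.Ioi (y - t)) ∂H := by
  have m1 : MeasurableSet {p : ℝ × ℝ | p.2 ≤ y - A ∧ y < p.1 + p.2} :=
    (measurableSet_le measurable_snd measurable_const).inter
      (measurableSet_lt measurable_const (measurable_fst.add measurable_snd))
  have m2 : MeasurableSet {p : ℝ × ℝ | A < p.1 ∧ y < p.1 + p.2} :=
    (measurableSet_lt measurable_const measurable_fst).inter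
      (measurableSet_lt measurable_const (measurable_fst.add measurable_snd))
  have e1 : ∫⁻ t in Set.Iic (y - A), H (Set.Ioi (y - t)) ∂ν
      = (H.prod ν) {p : ℝ × ℝ | p.2 ≤ y - A ∧ y < p.1 + p.2} := by
    rw [Measure.prod_apply_symm m1, ← lintegral_indicator measurableSet_Iic]
    refine lintegral_congr fun t => ?_
    by_cases ht : t ≤ y - A
    · rw [Set.indicator_of_mem (by exact ht)]
      congr 1
      ext s
      simp [ht, sub_lt_iff_lt_add]
    · rw [Set.indicator_of_notMem (by exact ht)]
      simp [ht]
  have e2 : ∫⁻ t in Set.Ioi A, ν (Set.Ioi (y - t)) ∂H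
      = (H.prod ν) {p : ℝ × ℝ | A < p.1 ∧ y < p.1 + p.2} := by
    rw [Measure.prod_apply m2, ← lintegral_indicator measurableSet_Ioi]
    refine lintegral_congr fun t => ?_
    by_cases ht : A < t
    · rw [Set.indicator_of_mem (by exact ht)]
      congr 1
      ext s
      simp [ht, sub_lt_iff_lt_add']
    · rw [Set.indicator_of_notMem (by exact ht)]
      simp [ht]
  rw [e1, e2]
  exact measure_mono fun p hp => ⟨by linarith [hp.1, hp.2], hp.2⟩

lemma lintegral_Iic_conv (hH : IsSubexpTail H) {ν : Measure ℝ} [IsFiniteMeasure ν] {k : ℝ≥0}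
    (hν : AsympLE (fun y => H (Set.Ioi y)) (fun y => ν (Set.Ioi y)) k) (A : ℝ) :
    AsympLE (fun y => H (Set.Ioi y)) (fun y => ∫⁻ t in Set.Iic (y - A), H (Set.Ioi (y - t)) ∂ν)
      (k * (H (Set.Ioi A)).toNNReal + (ν Set.univ).toNNReal) :=
  (hH.lintegral_Ioi_conv hν A).mono (Eventually.of_forall fun y => lintegral_Iic_le ν A y)

lemma shift (hH : IsSubexpTail H) {f : ℝ → ℝ≥0∞} {k : ℝ≥0}
    (hf : AsympLE (fun y => H (Set.Ioi y)) f k) (K : ℝ) :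
    AsympLE (fun y => H (Set.Ioi y)) (fun y => f (y - K)) k := by
  simpa using (hf.comp_sub K).trans (hH.long K)

/-- An asymptotic bound can be made global. -/
lemma bound (hH : IsSubexpTail H) {f : ℝ → ℝ≥0∞} {k : ℝ≥0}
    (hf : AsympLE (fun y => H (Set.Ioi y)) f k) {M : ℝ≥0} (hM : ∀ y, f y ≤ M) :
    ∃ A : ℝ≥0, ∀ y, f y ≤ A * H (Set.Ioi y) := by
  obtain ⟨y₁, h₁⟩ := eventually_atTop.1 (hf 1 one_pos)
  obtain ⟨p, hp⟩ := exists_coe_of_ne_top (measure_ne_top H (Set.Ioi y₁))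
  have hp0 : 0 < p := by
    rw [← ENNReal.coe_pos, hp]; exact hH.pos y₁
  refine ⟨k + 1 + M / p, fun y => ?_⟩
  rcases le_total y₁ y with hy | hy
  · refine (h₁ y hy).trans ?_
    gcongr ?_ * _
    exact_mod_cast le_self_add
  · have h2 : (M : ℝ≥0∞) = ((M / p : ℝ≥0) : ℝ≥0∞) * p := by
      rw [← ENNReal.coe_mul, div_mul_cancel₀ _ hp0.ne']
    calc f y ≤ M := hM y
      _ ≤ ((M / p : ℝ≥0) : ℝ≥0∞) * H (Set.Ioi y) := by
        rw [h2, hp]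
        gcongr
      _ ≤ _ := by gcongr; exact le_add_self

/-- Tail of a defective renewal scheme: the key recursion for maxima of random walks. -/
lemma renewal_bound (hH : IsSubexpTail H) {ν : Measure ℝ} [IsFiniteMeasure ν] {k m : ℝ≥0}
    (hν : AsympLE (fun y => H (Set.Ioi y)) (fun y => ν (Set.Ioi y)) k)
    (hm : ν Set.univ ≤ m) (hm1 : m < 1) {p : ℕ → ℝ → ℝ≥0∞} (hp1 : ∀ n y, p n y ≤ 1) {R : ℝ}
    (h0 : ∀ y, R ≤ y → p 0 y ≤ ν (Set.Ioi y))
    (hrec : ∀ n y, R ≤ y → p (n + 1) y ≤ ∫⁻ t, p n (y - t) ∂ν) :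
    AsympLE (fun y => H (Set.Ioi y)) (fun y => ⨆ n, p n y) (k / (1 - m)) := by
  set h : ℝ → ℝ≥0∞ := fun y => H (Set.Ioi y) with hh
  -- the core one-step bound
  have core : ∀ (f : ℝ → ℝ≥0∞) (q : ℝ≥0) (A y : ℝ), (∀ z, f z ≤ 1) → (∀ z, A ≤ z → f z ≤ q * h z) →
      ∫⁻ t, f (y - t) ∂ν ≤ ν (Set.Ioi (y - A)) + q * ∫⁻ t in Set.Iic (y - A), h (y - t) ∂ν := by
    intro f q A y hf1 hf
    rw [← lintegral_add_compl _ (measurableSet_Ioi (a := y - A)), Set.compl_Ioi]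
    refine add_le_add ?_ ?_
    · calc _ ≤ ∫⁻ _ in Set.Ioi (y - A), 1 ∂ν := lintegral_mono fun t => hf1 _
        _ = _ := by simp
    · rw [← lintegral_const_mul _ (measurable_Ioi_sub H y)]
      exact setLIntegral_mono' measurableSet_Iic fun t ht => hf _ (by linarith [Set.mem_Iic.1 ht])
  have hmass : (ν Set.univ).toNNReal ≤ m := toNNReal_le_coe hm
  have hkA : ∀ η : ℝ≥0, 0 < η → ∃ A : ℝ, 0 ≤ A ∧ k * (H (Set.Ioi A)).toNNReal ≤ η := by
    intro η hη
    have : ∀ᶠ A in atTop, H (Set.Ioi A) ≤ ((η / (k + 1) : ℝ≥0) : ℝ≥0∞) :=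
      (tendsto_Ioi H).eventually (Iic_mem_nhds (by simpa using (by positivity)))
    obtain ⟨A, hA, hA0⟩ := (this.and (eventually_ge_atTop 0)).exists
    refine ⟨A, hA0, ?_⟩
    calc k * (H (Set.Ioi A)).toNNReal ≤ (k + 1) * (η / (k + 1)) := by
          gcongr
          · exact le_self_add
          · exact toNNReal_le_coe hA
      _ = η := mul_div_cancel₀ _ (by positivity)
  have hI : ∀ η : ℝ≥0, 0 < η → ∃ A : ℝ, 0 ≤ A ∧
      AsympLE h (fun y => ∫⁻ t in Set.Iic (y - A), h (y - t) ∂ν) (η + m) := by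
    intro η hη
    obtain ⟨A, hA0, hA⟩ := hkA η hη
    exact ⟨A, hA0, (hH.lintegral_Iic_conv hν A).weaken (add_le_add hA hmass)⟩
  set P : ℝ → ℝ≥0∞ := fun y => ⨆ n, p n y with hP
  have hP1 : ∀ y, P y ≤ 1 := fun y => iSup_le fun n => hp1 n y
  have hstep : ∀ (q : ℝ≥0) (A y : ℝ), 0 ≤ A → R ≤ y → (∀ z, A ≤ z → P z ≤ q * h z) →
      P y ≤ ν (Set.Ioi (y - A)) + q * ∫⁻ t in Set.Iic (y - A), h (y - t) ∂ν := by
    intro q A y hA hy hq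
    refine iSup_le fun n => ?_
    cases n with
    | zero =>
      refine (h0 y hy).trans (le_add_right (measure_mono (Set.Ioi_subset_Ioi (by linarith))))
    | succ n =>
      exact (hrec n y hy).trans (core (p n) q A y (hp1 n)
        fun z hz => (le_iSup (fun n => p n z) n).trans (hq z hz))
  -- a global bound
  obtain ⟨Q, hQ⟩ : ∃ Q : ℝ≥0, ∀ y, P y ≤ Q * h y := by
    -- The defect 1 - m is spent in quarters: two absorb the errors in the convolution integral, two
    -- absorb the inhomogeneous term k + 1. The first term of the constant `Q` below makes the claim
    -- trivial for y ≤ `y₁`, the second closes the induction, so the bound is uniform in n.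
    set s : ℝ≥0 := (1 - m) / 4 with hs
    have h1m : 0 < 1 - m := tsub_pos_of_lt hm1
    have hs0 : 0 < s := by positivity
    have hs4 : m + s + s + s + s = 1 := by
      have : s + s + s + s = 1 - m := by
        rw [hs]; rw [← NNReal.coe_inj]; push_cast; ring
      rw [add_assoc, add_assoc, add_assoc, ← add_assoc s s, ← add_assoc (s + s), this]
      exact add_tsub_cancel_of_le hm1.le
    obtain ⟨A, hA0, hA⟩ := hI s hs0
    obtain ⟨y₁, hy₁⟩ := eventually_atTop.1 (((hA s hs0).and (hH.shift hν A 1 one_pos)).and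
      (eventually_ge_atTop R))
    obtain ⟨r, hr⟩ := exists_coe_of_ne_top (measure_ne_top H (Set.Ioi y₁))
    have hr0 : 0 < r := by rw [← ENNReal.coe_pos, hr]; exact hH.pos y₁
    set Q : ℝ≥0 := 1 / r + (k + 1) / (s + s) with hQ
    have hsmall : ∀ y, y ≤ y₁ → (1 : ℝ≥0∞) ≤ Q * h y := by
      intro y hy
      calc (1 : ℝ≥0∞) = ((1 / r : ℝ≥0) : ℝ≥0∞) * r := by
            rw [← ENNReal.coe_mul, div_mul_cancel₀ _ hr0.ne', ENNReal.coe_one]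
        _ ≤ Q * h y := by
            rw [hr]
            gcongr
            · exact le_self_add
            · exact antitone_Ioi H hy
    have hQ2 : (k + 1) + Q * (s + m + s) ≤ Q := by
      have : k + 1 ≤ Q * (s + s) := by
        calc k + 1 = (k + 1) / (s + s) * (s + s) := (div_mul_cancel₀ _ (by positivity)).symm
          _ ≤ _ := by gcongr; exact le_add_self
      calc (k + 1) + Q * (s + m + s) ≤ Q * (s + s) + Q * (s + m + s) := by gcongr
        _ = Q * (m + s + s + s + s) := by ring
        _ = Q := by rw [hs4, mul_one]
    have hind : ∀ n y, p n y ≤ Q * h y := by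
      intro n
      induction n with
      | zero =>
        intro y
        rcases le_total y y₁ with hy | hy
        · exact (hp1 0 y).trans (hsmall y hy)
        · obtain ⟨⟨_, b⟩, c⟩ := hy₁ y hy
          refine (h0 y c).trans ((measure_mono (Set.Ioi_subset_Ioi (by linarith))).trans
            (b.trans ?_))
          gcongr
          exact le_self_add.trans hQ2
      | succ n ih =>
        intro y
        rcases le_total y y₁ with hy | hy
        · exact (hp1 _ y).trans (hsmall y hy)
        · obtain ⟨⟨a, b⟩, c⟩ := hy₁ y hy
          calc p (n + 1) y ≤ _ := hrec n y c
            _ ≤ _ := core (p n) Q A y (hp1 n) fun z _ => ih z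
            _ ≤ ((k + 1 : ℝ≥0) : ℝ≥0∞) * h y + Q * (((s + m + s : ℝ≥0) : ℝ≥0∞) * h y) := by
                gcongr
            _ = (((k + 1) + Q * (s + m + s) : ℝ≥0) : ℝ≥0∞) * h y := by push_cast; ring
            _ ≤ Q * h y := by gcongr
    exact ⟨Q, fun y => iSup_le fun n => hind n y⟩
  -- improvement of the constant
  have improve : ∀ q : ℝ≥0, AsympLE h P q → AsympLE h P (k + q * m) := by
    intro q hq
    refine AsympLE.of_continuous (u := fun η => (k + η) + (q + η) * (η + m + η)) (by fun_prop)
      (by simp) fun η hη => ?_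
    obtain ⟨A₀, hA₀⟩ := eventually_atTop.1 (hq η hη)
    obtain ⟨A₁, hA₁0, hA₁⟩ := hkA η hη
    set A := max A₀ A₁
    have hA : AsympLE h (fun y => ∫⁻ t in Set.Iic (y - A), h (y - t) ∂ν) (η + m) := by
      refine (hH.lintegral_Iic_conv hν A).weaken (add_le_add (le_trans ?_ hA₁) hmass)
      gcongr
      · exact measure_ne_top _ _
      · exact le_max_right _ _
    filter_upwards [hA η hη, hH.shift hν A η hη, eventually_ge_atTop R] with y a b c
    calc P y ≤ _ := hstep (q + η) A y (hA₁0.trans (le_max_right _ _)) c fun z hz => hA₀ z ((le_max_left _ _).trans hz)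
      _ ≤ ((k + η : ℝ≥0) : ℝ≥0∞) * h y
          + ((q + η : ℝ≥0) : ℝ≥0∞) * (((η + m + η : ℝ≥0) : ℝ≥0∞) * h y) := by gcongr
      _ = _ := by push_cast; ring
  -- the least constant
  set S : Set ℝ≥0 := {q | AsympLE h P q} with hS
  have hSne : S.Nonempty := ⟨Q, AsympLE.of_le (Eventually.of_forall hQ)⟩
  have hmin : sInf S ∈ S := by
    refine AsympLE.of_forall_gt fun ε hε => ?_
    obtain ⟨q, hq, hlt⟩ := exists_lt_of_csInf_lt hSne (lt_add_of_pos_right (sInf S) hε)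
    exact AsympLE.weaken hq hlt.le
  -- The least constant is attained and finite by the global bound. It cannot be improved, so q ≤ k
  -- + q m, which solves to k / (1 - m).
  have hfix : sInf S ≤ k + sInf S * m := csInf_le (OrderBot.bddBelow _) (improve _ hmin)
  refine AsympLE.weaken hmin ?_
  rw [le_div_iff₀ (tsub_pos_of_lt hm1), mul_tsub, mul_one]
  exact tsub_le_iff_right.2 hfix

end IsSubexpTail

lemma AsympLE.of_eventually {h f : ℝ → ℝ≥0∞} {k : ℝ≥0} {u : ℝ≥0 → ℝ≥0}
    (hu : Tendsto u (𝓝[>] 0) (𝓝 k)) (H : ∀ᶠ x in 𝓝[>] 0, AsympLE h f (u x)) :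
    AsympLE h f k := by
  refine AsympLE.of_forall_gt fun ε hε => ?_
  obtain ⟨x, hx, hx'⟩ := ((hu.eventually (Iic_mem_nhds (lt_add_of_pos_right k hε))).and H).exists
  exact hx'.weaken hx

/-! ### Comparison of sums and integrals -/

section SumIntegral

lemma lintegral_Ioi_eq_tsum (g : ℝ → ℝ≥0∞) {d : ℝ≥0} (hd : 0 < d) (z : ℝ) :
    ∫⁻ t in Set.Ioi z, g t
      = ∑' r : ℕ, ∫⁻ t in Set.Ioc (z + r * d) (z + (r + 1 : ℕ) * d), g t := by
  have hmono : Monotone fun r : ℕ => z + r * (d : ℝ) := fun a b hab => by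
    have : (a : ℝ) ≤ b := by exact_mod_cast hab
    have := mul_le_mul_of_nonneg_right this d.2
    simpa using this
  have h1 := iUnion_Ioc_map_succ_eq_Ioi (f := fun r : ℕ => z + r * (d : ℝ))
    (fun a => hmono bot_le) ?_
  · have h2 := hmono.pairwise_disjoint_on_Ioc_succ
    simp only [Nat.succ_eq_succ, Nat.bot_eq_zero, Nat.cast_zero, zero_mul, add_zero] at h1 h2
    rw [← h1, lintegral_iUnion (fun _ => measurableSet_Ioc) h2]
  · rintro ⟨B, hB⟩
    obtain ⟨n, hn⟩ := exists_nat_gt ((B - z) / d)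
    have := hB ⟨n, rfl⟩
    rw [div_lt_iff₀ (by exact_mod_cast hd)] at hn
    simp only at this
    linarith

lemma volume_Ioc_step (r : ℕ) (z : ℝ) (d : ℝ≥0) :
    volume (Set.Ioc (z + r * (d : ℝ)) (z + (r + 1 : ℕ) * d)) = d := by
  rw [Real.volume_Ioc, show z + ((r + 1 : ℕ) : ℝ) * (d : ℝ) - (z + r * d) = d by push_cast; ring]
  exact ENNReal.ofReal_coe_nnreal

/-- The lower Riemann sum of a decreasing function. With the upper sum below, it exchanges sums over
cycles for integrated tails at the cost of one step `d`. -/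
lemma mul_tsum_le_lintegral {g : ℝ → ℝ≥0∞} (hg : Antitone g) {d : ℝ≥0} (hd : 0 < d) (z : ℝ) :
    d * ∑' r : ℕ, g (z + (r + 1 : ℕ) * d) ≤ ∫⁻ t in Set.Ioi z, g t := by
  rw [lintegral_Ioi_eq_tsum g hd z, ← ENNReal.tsum_mul_left]
  refine ENNReal.tsum_le_tsum fun r => ?_
  rw [mul_comm, ← volume_Ioc_step r z d, ← setLIntegral_const]
  exact setLIntegral_mono' measurableSet_Ioc fun t ht => hg ht.2

lemma lintegral_le_mul_tsum {g : ℝ → ℝ≥0∞} (hg : Antitone g) {d : ℝ≥0} (hd : 0 < d) (z : ℝ) :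
    ∫⁻ t in Set.Ioi z, g t ≤ d * ∑' r : ℕ, g (z + r * d) := by
  rw [lintegral_Ioi_eq_tsum g hd z, ← ENNReal.tsum_mul_left]
  refine ENNReal.tsum_le_tsum fun r => ?_
  rw [mul_comm (d : ℝ≥0∞), ← volume_Ioc_step r z d, ← setLIntegral_const]
  exact setLIntegral_mono' measurableSet_Ioc fun t ht => hg ht.1.le

end SumIntegral

/-! ### Strong law and linear boundaries -/

section Strong

variable {Ω : Type*} [MeasurableSpace Ω] {μ : Measure Ω}

/-- By the strong law the averages of U converge to a mean below c. The term Y_n / n vanishes in the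
limit, as a difference of consecutive averages of Y. -/
lemma ae_bddAbove_linear {U Y : ℕ → Ω → ℝ}
    (hU : Pairwise fun i j => IndepFun (U i) (U j) μ) (hY : Pairwise fun i j => IndepFun (Y i) (Y j) μ)
    (hUid : ∀ n, IdentDistrib (U n) (U 0) μ μ) (hYid : ∀ n, IdentDistrib (Y n) (Y 0) μ μ)
    (hUi : Integrable (U 0) μ) (hYi : Integrable (Y 0) μ) {c : ℝ} (hc : ∫ ω, U 0 ω ∂μ < c) :
    ∀ᵐ ω ∂μ, BddAbove (Set.range fun n : ℕ => ∑ i ∈ Finset.range n, U i ω + Y n ω - n * c) := by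
  filter_upwards [strong_law_ae_real U hUi hU hUid, strong_law_ae_real Y hYi hY hYid] with ω h1 h2
  have h3 : Tendsto (fun n : ℕ => ((n + 1 : ℕ) : ℝ) / n) atTop (𝓝 1) := by
    have : Tendsto (fun n : ℕ => 1 + 1 / (n : ℝ)) atTop (𝓝 (1 + 0)) :=
      tendsto_const_nhds.add tendsto_one_div_atTop_nhds_zero_nat
    rw [add_zero] at this
    refine this.congr' ?_
    filter_upwards [eventually_gt_atTop 0] with n hn
    have : (n : ℝ) ≠ 0 := by exact_mod_cast hn.ne'
    field_simp
    push_cast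
    ring
  have h4 := ((h2.comp (tendsto_add_atTop_nat 1)).mul h3).sub h2
  have h5 : Tendsto (fun n : ℕ => (∑ i ∈ Finset.range n, U i ω + Y n ω) / n) atTop
      (𝓝 (∫ ω, U 0 ω ∂μ)) := by
    have := h1.add h4
    rw [mul_one, sub_self, add_zero] at this
    refine this.congr' ?_
    filter_upwards [eventually_gt_atTop 0] with n hn
    have hn0 : (n : ℝ) ≠ 0 := by exact_mod_cast hn.ne'
    have hn1 : ((n + 1 : ℕ) : ℝ) ≠ 0 := by positivity
    simp only [Function.comp]
    rw [div_mul_div_cancel₀ hn1, Finset.sum_range_succ]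
    field_simp
    ring
  have h6 : ∀ᶠ n : ℕ in atTop, ∑ i ∈ Finset.range n, U i ω + Y n ω - n * c ≤ 0 := by
    filter_upwards [h5.eventually (gt_mem_nhds hc), eventually_gt_atTop 0] with n hn hn0
    have hn1 : (0 : ℝ) < n := by exact_mod_cast hn0
    rw [div_lt_iff₀ hn1] at hn
    linarith
  exact IsBoundedUnder.bddAbove_range ⟨0, by simpa using h6⟩

lemma exists_measure_le [IsFiniteMeasure μ] {f : ℕ → Ω → ℝ} (hf : ∀ n, Measurable (f n))
    (hb : ∀ᵐ ω ∂μ, BddAbove (Set.range fun n => f n ω)) {δ : ℝ≥0} (hδ : 0 < δ) :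
    ∃ R : ℝ, ∀ y, R ≤ y → μ {ω | ∃ n, y < f n ω} ≤ δ := by
  have hm : ∀ y : ℝ, MeasurableSet {ω | ∃ n, y < f n ω} := fun y => by
    rw [Set.ofPred_exists]
    exact MeasurableSet.iUnion fun n => measurableSet_lt measurable_const (hf n)
  have hanti : Antitone fun y : ℝ => {ω | ∃ n, y < f n ω} :=
    fun a b hab ω ⟨n, hn⟩ => ⟨n, hab.trans_lt hn⟩
  have h := tendsto_measure_iInter_atTop (μ := μ) (fun y => (hm y).nullMeasurableSet) hanti
    ⟨0, measure_ne_top _ _⟩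
  have h0 : μ (⋂ y : ℝ, {ω | ∃ n, y < f n ω}) = 0 := by
    refine measure_mono_null ?_ hb
    intro ω hω hbdd
    obtain ⟨B, hB⟩ := hbdd
    obtain ⟨n, hn⟩ := Set.mem_iInter.1 hω B
    exact absurd (hB ⟨n, rfl⟩) (not_le.2 hn)
  rw [h0] at h
  exact eventually_atTop.1 (h.eventually (Iic_mem_nhds (by simpa using hδ)))

end Strong

/-! ### The maximum of a perturbed random walk -/

section PerturbedWalk

/-- The perturbed partial sum `∑_{i < n} d_i + v_n` of a sequence of pairs. -/
def perturbedSum (n : ℕ) (w : ℕ → ℝ × ℝ) : ℝ := ∑ i ∈ Finset.range n, (w i).1 + (w n).2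

lemma measurable_perturbedSum (n : ℕ) : Measurable (perturbedSum n) := by
  unfold perturbedSum
  fun_prop

lemma perturbedSum_congr {n : ℕ} {w w' : ℕ → ℝ × ℝ} (h : ∀ i ≤ n, w i = w' i) :
    perturbedSum n w = perturbedSum n w' := by
  unfold perturbedSum
  rw [h n le_rfl]
  congr 1
  exact Finset.sum_congr rfl fun i hi => by rw [h i (Finset.mem_range.1 hi).le]

lemma perturbedSum_add (r i : ℕ) (w : ℕ → ℝ × ℝ) :
    perturbedSum (r + 1 + i) w
      = ∑ j ∈ Finset.range (r + 1), (w j).1 + perturbedSum i (fun j => w (r + 1 + j)) := by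
  unfold perturbedSum
  rw [Finset.sum_range_add, add_assoc]

variable {Ω : Type*} [MeasurableSpace Ω] {μ : Measure Ω}
  {W : ℕ → Ω → ℝ × ℝ}

lemma map_shift_eq (hWm : ∀ n, Measurable (W n)) (hind : iIndepFun W μ)
    (hid : ∀ n, IdentDistrib (W n) (W 0) μ μ) (r : ℕ) :
    μ.map (fun ω i => W (r + i) ω) = μ.map (fun ω i => W i ω) := by
  rw [iIndepFun.map_fun_eq_infinitePi_map hWm hind,
    iIndepFun.map_fun_eq_infinitePi_map (fun i => hWm (r + i))
      (hind.precomp (g := fun i => r + i) (add_right_injective r))]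
  congr 1
  funext i
  rw [(hid (r + i)).map_eq, (hid i).map_eq]

/-- A sequence truncated to the indices in a finite set. -/
def truncSeq (s : Finset ℕ) (w : ℕ → ℝ × ℝ) (i : ℕ) : ℝ × ℝ := if i ∈ s then w i else 0

/-- Truncation keeps past and future in one sequence space, so functionals of whole sequences apply
to both. -/
lemma indepFun_truncSeq (hWm : ∀ n, Measurable (W n)) (hind : iIndepFun W μ) {s t : Finset ℕ}
    (hst : Disjoint s t) :
    IndepFun (fun ω => truncSeq s (fun i => W i ω)) (fun ω => truncSeq t (fun i => W i ω)) μ := by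
  have key : ∀ s : Finset ℕ, Measurable fun (u : s → ℝ × ℝ) (i : ℕ) =>
      if h : i ∈ s then u ⟨i, h⟩ else 0 := fun s => by
    refine measurable_pi_lambda _ fun i => ?_
    by_cases h : i ∈ s
    · simpa [h] using measurable_pi_apply _
    · simp [h]
  have h := (hind.indepFun_finset s t hst hWm).comp (key s) (key t)
  convert h using 1
  · ext ω i : 2
    by_cases h : i ∈ s <;> simp [truncSeq, h]
  · ext ω i : 2
    by_cases h : i ∈ t <;> simp [truncSeq, h]

/-- The restart after index r: `E` sees only the coordinates up to r, and the shifted sequence is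
independent of them with the original law. The finite horizon n confines the future to finitely many
coordinates. -/
lemma measure_past_future [IsProbabilityMeasure μ] (hWm : ∀ n, Measurable (W n)) (hind : iIndepFun W μ)
    (hid : ∀ n, IdentDistrib (W n) (W 0) μ μ) (r n : ℕ) {E : Set (ℕ → ℝ × ℝ)}
    (hE : MeasurableSet E) (hEr : ∀ w w', (∀ i ≤ r, w i = w' i) → (w ∈ E ↔ w' ∈ E)) (y : ℝ) :
    μ {ω | (fun i => W i ω) ∈ E ∧ ∃ i ≤ n, y - perturbedSum r (fun i => W i ω)
          < perturbedSum i (fun i => W (r + 1 + i) ω)}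
      = ∫⁻ ω in {ω | (fun i => W i ω) ∈ E},
          μ {ω' | ∃ i ≤ n, y - perturbedSum r (fun i => W i ω)
            < perturbedSum i (fun i => W i ω')} ∂μ := by
  have hWs : Measurable fun ω i => W i ω := measurable_pi_lambda _ hWm
  set s := Finset.range (r + 1)
  set t := Finset.Ico (r + 1) (r + 1 + n + 1)
  have hst : Disjoint s t := by
    rw [Finset.disjoint_left]
    intro i hi hi'
    simp only [s, t, Finset.mem_range, Finset.mem_Ico] at hi hi'
    omega
  have hind2 := indepFun_truncSeq hWm hind hst
  have hts : ∀ s : Finset ℕ, Measurable (truncSeq s) := fun s => by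
    refine measurable_pi_lambda _ fun i => ?_
    unfold truncSeq
    by_cases h : i ∈ s
    · simpa [h] using measurable_pi_apply _
    · simp [h]
  have hTm : ∀ s : Finset ℕ, Measurable fun ω => truncSeq s (fun i => W i ω) :=
    fun s => (hts s).comp hWs
  have hmap := (indepFun_iff_map_prod_eq_prod_map_map (hTm s).aemeasurable
    (hTm t).aemeasurable).1 hind2
  -- the event in terms of past and future
  set G : Set ((ℕ → ℝ × ℝ) × (ℕ → ℝ × ℝ)) := {p | p.1 ∈ E ∧ ∃ i ≤ n,
    y - perturbedSum r p.1 < perturbedSum i (fun i => p.2 (r + 1 + i))}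
  have hGm : MeasurableSet G := by
    refine (measurable_fst hE).inter ?_
    have : {p : (ℕ → ℝ × ℝ) × (ℕ → ℝ × ℝ) | ∃ i ≤ n,
        y - perturbedSum r p.1 < perturbedSum i (fun i => p.2 (r + 1 + i))}
        = ⋃ i ∈ Finset.range (n + 1), {p | y - perturbedSum r p.1
          < perturbedSum i (fun i => p.2 (r + 1 + i))} := by
      ext p; simp
    change MeasurableSet {p : (ℕ → ℝ × ℝ) × (ℕ → ℝ × ℝ) | ∃ i ≤ n,
        y - perturbedSum r p.1 < perturbedSum i (fun i => p.2 (r + 1 + i))}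
    rw [this]
    refine Finset.measurableSet_biUnion _ fun i _ => measurableSet_lt ?_ ?_
    · exact measurable_const.sub ((measurable_perturbedSum r).comp measurable_fst)
    · exact (measurable_perturbedSum i).comp (by fun_prop)
  have hpast : ∀ w, ∀ i ≤ r, truncSeq s w i = w i := fun w i hi => by
    simp [truncSeq, s, hi]
  have hfut : ∀ w, ∀ i ≤ n, truncSeq t w (r + 1 + i) = w (r + 1 + i) := fun w i hi => by
    have : r + 1 + i ∈ t := by simp only [t, Finset.mem_Ico]; omega
    simp [truncSeq, this]
  have hEs : ∀ w, truncSeq s w ∈ E ↔ w ∈ E := fun w => hEr _ _ (hpast w)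
  have hAs : ∀ w, perturbedSum r (truncSeq s w) = perturbedSum r w := fun w =>
    perturbedSum_congr (hpast w)
  have hAt : ∀ w, ∀ i ≤ n, perturbedSum i (fun i => truncSeq t w (r + 1 + i))
      = perturbedSum i (fun i => w (r + 1 + i)) := fun w i hi =>
    perturbedSum_congr fun j hj => hfut w j (hj.trans hi)
  have hfutm : ∀ x : ℝ, MeasurableSet {w : ℕ → ℝ × ℝ | ∃ i ≤ n, x < perturbedSum i w} := by
    intro x
    have : {w : ℕ → ℝ × ℝ | ∃ i ≤ n, x < perturbedSum i w}
        = ⋃ i ∈ Finset.range (n + 1), {w | x < perturbedSum i w} := by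
      ext p; simp
    rw [this]
    exact Finset.measurableSet_biUnion _ fun i _ =>
      measurableSet_lt measurable_const (measurable_perturbedSum i)
  have hfuture : ∀ x : ℝ, μ {ω | ∃ i ≤ n, x < perturbedSum i (fun i => W (r + 1 + i) ω)}
      = μ {ω | ∃ i ≤ n, x < perturbedSum i (fun i => W i ω)} := by
    intro x
    have h := map_shift_eq hWm hind hid (r + 1)
    have h1 : (μ.map (fun ω i => W (r + 1 + i) ω)) {w | ∃ i ≤ n, x < perturbedSum i w}
        = (μ.map (fun ω i => W i ω)) {w | ∃ i ≤ n, x < perturbedSum i w} := by rw [h]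
    rwa [Measure.map_apply (measurable_pi_lambda _ fun i => hWm _) (hfutm x),
      Measure.map_apply hWs (hfutm x)] at h1
  calc _ = μ {ω | (truncSeq s (fun i => W i ω), truncSeq t (fun i => W i ω)) ∈ G} := by
        congr 1
        ext ω
        simp only [G, Set.mem_ofPred_eq, hEs, hAs]
        refine and_congr_right fun _ => exists_congr fun i => and_congr_right fun hi => ?_
        rw [hAt _ i hi]
    _ = (μ.map fun ω => (truncSeq s (fun i => W i ω), truncSeq t (fun i => W i ω))) G := by
        rw [Measure.map_apply ((hTm s).prodMk (hTm t)) hGm]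
        rfl
    _ = ∫⁻ p, (μ.map fun ω => truncSeq t (fun i => W i ω)) (Prod.mk p ⁻¹' G)
          ∂(μ.map fun ω => truncSeq s (fun i => W i ω)) := by
        rw [hmap, Measure.prod_apply hGm]
    _ = ∫⁻ ω, (μ.map fun ω => truncSeq t (fun i => W i ω))
          (Prod.mk (truncSeq s (fun i => W i ω)) ⁻¹' G) ∂μ := by
        rw [lintegral_map (measurable_measure_prodMk_left hGm) (hTm s)]
    _ = ∫⁻ ω, {ω | (fun i => W i ω) ∈ E}.indicator (fun ω =>
          μ {ω' | ∃ i ≤ n, y - perturbedSum r (fun i => W i ω)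
            < perturbedSum i (fun i => W i ω')}) ω ∂μ := by
        refine lintegral_congr fun ω => ?_
        rw [Measure.map_apply (hTm t) (measurable_prodMk_left hGm)]
        by_cases hω : (fun i => W i ω) ∈ E
        · rw [Set.indicator_of_mem (by exact hω), ← hfuture]
          congr 1
          ext ω'
          simp only [G, Set.mem_preimage, Set.mem_ofPred_eq, hEs, hAs, hω, true_and]
          refine exists_congr fun i => and_congr_right fun hi => ?_
          rw [hAt _ i hi]
        · rw [Set.indicator_of_notMem (by exact hω)]
          convert measure_empty (μ := μ)
          ext ω'
          simp only [G, Set.mem_preimage, Set.mem_ofPred_eq, hEs, hω, false_and,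
            Set.mem_empty_iff_false]
    _ = _ := lintegral_indicator (hWs hE) _

end PerturbedWalk

/-! ### First crossing of a descending line, and the maximum. -/

section MaximumBound

variable {Ω : Type*} [MeasurableSpace Ω] {μ : Measure Ω} {W : ℕ → Ω → ℝ × ℝ}

/-- Sequences whose perturbed partial sums first cross the line `R - n d` at time `r`. -/
def firstCrossing (R d : ℝ) (r : ℕ) : Set (ℕ → ℝ × ℝ) :=
  {w | R - r * d < perturbedSum r w ∧ ∀ j < r, perturbedSum j w ≤ R - j * d}

lemma measurableSet_firstCrossing (R d : ℝ) (r : ℕ) : MeasurableSet (firstCrossing R d r) := by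
  have : firstCrossing R d r = {w | R - r * d < perturbedSum r w} ∩
      ⋂ j ∈ Finset.range r, {w | perturbedSum j w ≤ R - j * d} := by
    ext w; simp [firstCrossing]
  rw [this]
  exact (measurableSet_lt measurable_const (measurable_perturbedSum r)).inter
    (Finset.measurableSet_biInter _ fun j _ =>
      measurableSet_le (measurable_perturbedSum j) measurable_const)

lemma firstCrossing_congr (R d : ℝ) (r : ℕ) (w w' : ℕ → ℝ × ℝ) (h : ∀ i ≤ r, w i = w' i) :
    w ∈ firstCrossing R d r ↔ w' ∈ firstCrossing R d r := by
  have : ∀ j ≤ r, perturbedSum j w = perturbedSum j w' := fun j hj =>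
    perturbedSum_congr fun i hi => h i (hi.trans hj)
  simp only [firstCrossing, Set.mem_ofPred_eq, this r le_rfl]
  refine and_congr_right fun _ => forall_congr' fun j => imp_congr_right fun hj => ?_
  rw [this j hj.le]

lemma disjoint_firstCrossing (R d : ℝ) :
    Pairwise (Function.onFun Disjoint (firstCrossing R d)) := by
  intro r s hrs
  refine Set.disjoint_left.2 fun w hw hw' => ?_
  rcases lt_or_gt_of_ne hrs with h | h
  · exact absurd (hw'.2 r h) (not_le.2 hw.1)
  · exact absurd (hw.2 s h) (not_le.2 hw'.1)

/-- The law of the perturbed partial sum at the first crossing of the line, with the mass of the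
event that the line is never crossed removed. -/
noncomputable def crossingLaw (μ : Measure Ω) (W : ℕ → Ω → ℝ × ℝ) (R d : ℝ) : Measure ℝ :=
  Measure.sum fun r : ℕ =>
    (μ.restrict {ω | (fun i => W i ω) ∈ firstCrossing R d r}).map
      fun ω => perturbedSum r (fun i => W i ω)

variable (hWm : ∀ n, Measurable (W n))
include hWm

lemma measurable_seq : Measurable fun ω i => W i ω := measurable_pi_lambda _ hWm

lemma measurable_perturbedSum_seq (r : ℕ) :
    Measurable fun ω => perturbedSum r (fun i => W i ω) :=
  (measurable_perturbedSum r).comp (measurable_seq hWm)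

lemma crossingLaw_apply (R d : ℝ) {S : Set ℝ} (hS : MeasurableSet S) :
    crossingLaw μ W R d S = ∑' r, μ {ω | perturbedSum r (fun i => W i ω) ∈ S ∧
      (fun i => W i ω) ∈ firstCrossing R d r} := by
  rw [crossingLaw, Measure.sum_apply _ hS]
  refine tsum_congr fun r => ?_
  rw [Measure.map_apply (measurable_perturbedSum_seq hWm r) hS,
    Measure.restrict_apply (measurable_perturbedSum_seq hWm r hS)]
  rfl

lemma crossingLaw_univ (R d : ℝ) : crossingLaw μ W R d Set.univ
    ≤ μ {ω | ∃ n : ℕ, R - n * d < perturbedSum n (fun i => W i ω)} := by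
  rw [crossingLaw_apply hWm R d MeasurableSet.univ, ← measure_iUnion]
  · refine measure_mono fun ω hω => ?_
    obtain ⟨r, hr⟩ := Set.mem_iUnion.1 hω
    exact ⟨r, hr.2.1⟩
  · intro r s hrs
    refine Set.disjoint_left.2 fun ω h h' => ?_
    exact Set.disjoint_left.1 (disjoint_firstCrossing R d hrs) h.2 h'.2
  · intro r
    simp only [Set.mem_univ, true_and]
    exact measurable_seq hWm (measurableSet_firstCrossing R d r)

/-- Suppose the first crossing occurs at r ≥ 1. The perturbed sum at r - 1 is at most R - (r - 1) d
and, as D ≤ V, it dominates the sum of the first r increments D. A value above y at time r thus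
needs V_r > y - R + (r - 1) d, and the sum of these tails is a lower Riemann sum. The case r = 0
only needs V_0 > y. -/
lemma crossingLaw_Ioi (hid : ∀ n, IdentDistrib (W n) (W 0) μ μ)
    (hDV : ∀ n ω, (W n ω).1 ≤ (W n ω).2) (R y : ℝ) (hR : 0 ≤ R) {d : ℝ≥0} (hd : 0 < d) :
    d * crossingLaw μ W R d (Set.Ioi y)
      ≤ ∫⁻ t in Set.Ioi (y - R - d - d), μ {ω | t < (W 0 ω).2} := by
  have hanti : Antitone fun t : ℝ => μ {ω | t < (W 0 ω).2} :=
    fun a b hab => measure_mono fun ω hω => lt_of_le_of_lt hab hω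
  refine le_trans ?_ (mul_tsum_le_lintegral hanti hd _)
  rw [crossingLaw_apply hWm R d measurableSet_Ioi]
  refine mul_le_mul' le_rfl (ENNReal.tsum_le_tsum fun r => ?_)
  have hident : μ {ω | y - R - d - d + (r + 1 : ℕ) * d < (W 0 ω).2}
      = μ {ω | y - R - d - d + (r + 1 : ℕ) * d < (W r ω).2} :=
    ((hid r).measure_mem_eq (s := {p : ℝ × ℝ | y - R - d - d + (r + 1 : ℕ) * d < p.2})
      (measurableSet_lt measurable_const measurable_snd)).symm
  rw [hident]
  refine measure_mono fun ω hω => ?_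
  obtain ⟨h1, -, h2⟩ := hω
  have hd0 : (0 : ℝ) < d := by exact_mod_cast hd
  simp only [Set.mem_Ioi, perturbedSum] at h1
  simp only [Set.mem_ofPred_eq]
  cases r with
  | zero =>
    simp only [Finset.range_zero, Finset.sum_empty, zero_add] at h1
    push_cast
    linarith
  | succ r =>
    have h3 := h2 r (Nat.lt_succ_self r)
    rw [Finset.sum_range_succ] at h1
    simp only [perturbedSum] at h3
    have := hDV r ω
    push_cast
    linarith

/-- A path above y ≥ R has crossed the line. As D ≤ V, restarting from the perturbed sum at the
crossing only raises the path. If y is exceeded at the crossing itself, the restarted path has to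
beat a negative number, which V ≥ 0 guarantees at index 0. -/
lemma renewal_step [IsProbabilityMeasure μ] (hind : iIndepFun W μ)
    (hid : ∀ n, IdentDistrib (W n) (W 0) μ μ) (hDV : ∀ n ω, (W n ω).1 ≤ (W n ω).2)
    (hV : ∀ n ω, 0 ≤ (W n ω).2) {R d y : ℝ} (hd : 0 ≤ d) (hy : R ≤ y) (n : ℕ) :
    μ {ω | ∃ i ≤ n + 1, y < perturbedSum i (fun i => W i ω)}
      ≤ ∫⁻ t, μ {ω | ∃ i ≤ n, y - t < perturbedSum i (fun i => W i ω)} ∂(crossingLaw μ W R d) := by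
  have hmeas : Measurable fun t => μ {ω | ∃ i ≤ n, y - t < perturbedSum i (fun i => W i ω)} :=
    Monotone.measurable fun a b hab => measure_mono fun ω ⟨i, hi, hi'⟩ => ⟨i, hi, by linarith⟩
  rw [crossingLaw, lintegral_sum_measure]
  have hterm : ∀ r, ∫⁻ t, μ {ω | ∃ i ≤ n, y - t < perturbedSum i (fun i => W i ω)}
      ∂((μ.restrict {ω | (fun i => W i ω) ∈ firstCrossing R d r}).map
        fun ω => perturbedSum r (fun i => W i ω))
      = μ {ω | (fun i => W i ω) ∈ firstCrossing R d r ∧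
          ∃ i ≤ n, y - perturbedSum r (fun i => W i ω)
            < perturbedSum i (fun i => W (r + 1 + i) ω)} := by
    intro r
    rw [lintegral_map hmeas (measurable_perturbedSum_seq hWm r),
      measure_past_future hWm hind hid r n (measurableSet_firstCrossing R d r)
        (firstCrossing_congr R d r) y]
  simp only [hterm]
  refine le_trans (measure_mono ?_) (measure_iUnion_le _)
  rintro ω ⟨j, hj, hjy⟩
  have hex : ∃ r : ℕ, R - r * d < perturbedSum r (fun i => W i ω) := by
    refine ⟨j, ?_⟩
    have : (0 : ℝ) ≤ j * d := by positivity
    linarith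
  classical
  set r := Nat.find hex with hr
  have hfc : (fun i => W i ω) ∈ firstCrossing R d r :=
    ⟨Nat.find_spec hex, fun i hi => not_lt.1 (Nat.find_min hex hi)⟩
  have hrj : r ≤ j := by
    refine Nat.find_min' hex ?_
    have : (0 : ℝ) ≤ j * d := by positivity
    linarith
  refine Set.mem_iUnion.2 ⟨r, hfc, ?_⟩
  rcases hrj.eq_or_lt with h | h
  · refine ⟨0, Nat.zero_le _, ?_⟩
    have := hV (r + 1) ω
    simp only [perturbedSum, Finset.range_zero, Finset.sum_empty, zero_add, add_zero]
    rw [← h] at hjy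
    simp only [perturbedSum] at hjy
    linarith
  · obtain ⟨i, rfl⟩ : ∃ i, j = r + 1 + i := ⟨j - (r + 1), by omega⟩
    refine ⟨i, by omega, ?_⟩
    rw [perturbedSum_add, Finset.sum_range_succ] at hjy
    have := hDV r ω
    have h3 : perturbedSum r (fun i => W i ω)
      = ∑ j ∈ Finset.range r, (W j ω).1 + (W r ω).2 := rfl
    linarith

/-- Upper bound for the tail of the maximum of a perturbed random walk with negative drift whose
perturbations have a subexponential integrated tail. -/
theorem maximum_bound [IsProbabilityMeasure μ] {H : Measure ℝ} [IsProbabilityMeasure H]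
    (hH : IsSubexpTail H) (hind : iIndepFun W μ)
    (hid : ∀ n, IdentDistrib (W n) (W 0) μ μ) (hDV : ∀ n ω, (W n ω).1 ≤ (W n ω).2)
    (hV : ∀ n ω, 0 ≤ (W n ω).2) (hDi : Integrable (fun ω => (W 0 ω).1) μ)
    (hVi : Integrable (fun ω => (W 0 ω).2) μ) {d : ℝ≥0} (hd : 0 < d)
    (hmean : ∫ ω, (W 0 ω).1 ∂μ = -d) {K : ℝ≥0}
    (hK : AsympLE (fun y => H (Set.Ioi y)) (fun y => ∫⁻ t in Set.Ioi y, μ {ω | t < (W 0 ω).2}) K) :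
    AsympLE (fun y => H (Set.Ioi y))
      (fun y => μ {ω | ∃ n, y < perturbedSum n (fun i => W i ω)}) (K / d) := by
  have hfst : ∀ n, Measurable fun ω => (W n ω).1 := fun n => measurable_fst.comp (hWm n)
  have hsnd : ∀ n, Measurable fun ω => (W n ω).2 := fun n => measurable_snd.comp (hWm n)
  -- The line descends at the rate d - x, more slowly than the walk, so for `R` large it is crossed
  -- with probability at most x. The factor 1/(d - x) comes from the tail of the crossing law, the
  -- factor 1/(1 - x) from the renewal bound; both errors vanish as x tends to 0.
  have step : ∀ x : ℝ≥0, 0 < x → x < d → x < 1 → AsympLE (fun y => H (Set.Ioi y))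
      (fun y => μ {ω | ∃ n, y < perturbedSum n (fun i => W i ω)}) (K / (d - x) / (1 - x)) := by
    intro x hx0 hxd hx1
    set e : ℝ≥0 := d - x with he
    have he0 : 0 < e := tsub_pos_of_lt hxd
    have heR : (e : ℝ) = d - x := NNReal.coe_sub hxd.le
    have hbdd := ae_bddAbove_linear (μ := μ) (U := fun n ω => (W n ω).1)
      (Y := fun n ω => (W n ω).2)
      (fun i j hij => (hind.indepFun hij).comp measurable_fst measurable_fst)
      (fun i j hij => (hind.indepFun hij).comp measurable_snd measurable_snd)
      (fun n => (hid n).comp measurable_fst) (fun n => (hid n).comp measurable_snd)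
      hDi hVi (c := -e) (by
        rw [hmean, heR]
        have : (0 : ℝ) < x := by exact_mod_cast hx0
        linarith)
    obtain ⟨R₀, hR₀⟩ := exists_measure_le (f := fun n ω =>
      ∑ i ∈ Finset.range n, (W i ω).1 + (W n ω).2 - n * (-(e : ℝ)))
      (fun n => ((Finset.measurable_sum _ fun i _ => hfst i).add (hsnd n)).sub measurable_const)
      hbdd hx0
    set R := max R₀ 0
    have hR0 : 0 ≤ R := le_max_right _ _
    have hmass : crossingLaw μ W R e Set.univ ≤ x := by
      refine (crossingLaw_univ hWm R e).trans (le_trans (measure_mono ?_) (hR₀ R (le_max_left _ _)))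
      rintro ω ⟨n, hn⟩
      refine ⟨n, ?_⟩
      simp only [perturbedSum] at hn
      linarith
    have : IsFiniteMeasure (crossingLaw μ W R e) := ⟨hmass.trans_lt ENNReal.coe_lt_top⟩
    have htail : AsympLE (fun y => H (Set.Ioi y)) (fun y => crossingLaw μ W R e (Set.Ioi y))
        (K / e) := by
      have h1 := (hH.shift hK (R + e + e)).const_mul e⁻¹
      refine (h1.weaken (by rw [div_eq_inv_mul])).mono (Eventually.of_forall fun y => ?_)
      have h2 := crossingLaw_Ioi (μ := μ) hWm hid hDV R y hR0 he0
      rw [show y - (R + e + e) = y - R - e - e by ring]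
      calc crossingLaw μ W R e (Set.Ioi y)
          = (e⁻¹ : ℝ≥0) * (e * crossingLaw μ W R e (Set.Ioi y)) := by
            rw [← mul_assoc, ← ENNReal.coe_mul, inv_mul_cancel₀ he0.ne', ENNReal.coe_one, one_mul]
        _ ≤ _ := by gcongr
    have hren := hH.renewal_bound htail hmass hx1
      (p := fun n y => μ {ω | ∃ i ≤ n, y < perturbedSum i (fun i => W i ω)})
      (fun n y => prob_le_one) (R := R) ?_ ?_
    · refine hren.mono (Eventually.of_forall fun y => ?_)
      have hU : {ω | ∃ n, y < perturbedSum n (fun i => W i ω)}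
          = ⋃ n : ℕ, {ω | ∃ i ≤ n, y < perturbedSum i (fun i => W i ω)} := by
        ext ω
        simp only [Set.mem_ofPred_eq, Set.mem_iUnion]
        exact ⟨fun ⟨n, hn⟩ => ⟨n, n, le_rfl, hn⟩, fun ⟨_, i, _, hi⟩ => ⟨i, hi⟩⟩
      rw [hU, Monotone.measure_iUnion]
      exact fun a b hab ω ⟨i, hi, h⟩ => ⟨i, hi.trans hab, h⟩
    · intro y hy
      rw [crossingLaw_apply hWm R e measurableSet_Ioi]
      refine le_trans (measure_mono ?_) (ENNReal.le_tsum 0)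
      rintro ω ⟨i, hi, h⟩
      obtain rfl : i = 0 := by omega
      refine ⟨h, ?_, fun j hj => absurd hj (Nat.not_lt_zero j)⟩
      simp only [Nat.cast_zero, zero_mul, sub_zero]
      linarith
    · exact fun n y hy => renewal_step hWm hind hid hDV hV e.2 hy n
  refine AsympLE.of_eventually (u := fun x => K / (d - x) / (1 - x)) ?_ ?_
  · have h1 : Tendsto (fun x : ℝ≥0 => K / (d - x) / (1 - x)) (𝓝 0)
        (𝓝 (K / (d - 0) / (1 - 0))) := by
      have hc : ∀ c : ℝ≥0, Tendsto (fun x : ℝ≥0 => c - x) (𝓝 0) (𝓝 (c - 0)) := fun c =>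
        (Continuous.tendsto (by fun_prop) 0)
      refine Tendsto.div (Tendsto.div tendsto_const_nhds (hc d) ?_) (hc 1) ?_
      · simpa using hd.ne'
      · simp
    simp only [tsub_zero, div_one] at h1
    exact h1.mono_left nhdsWithin_le_nhds
  · filter_upwards [self_mem_nhdsWithin, mem_nhdsWithin_of_mem_nhds (Iio_mem_nhds hd),
      mem_nhdsWithin_of_mem_nhds (Iio_mem_nhds one_pos)] with x h1 h2 h3
    exact step x h1 h2 h3

end MaximumBound

/-! ### Integrated tails and tails of sums of independent variables -/

/-- The integrated tail `∫_y^∞ λ(t, ∞) dt`. -/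
noncomputable def intTail (l : Measure ℝ) (y : ℝ) : ℝ≥0∞ := ∫⁻ t in Set.Ioi y, l (Set.Ioi t)

/-- The mixed term `∫_0^y λ(t, ∞) κ(y - t, ∞) dt` in the integrated tail of a convolution. -/
noncomputable def mixedTail (l κ : Measure ℝ) (y : ℝ) : ℝ≥0∞ :=
  ∫⁻ t in Set.Ioo 0 y, l (Set.Ioi t) * κ (Set.Ioi (y - t))

/-- Stochastic domination on the level of tails. -/
def TailLE (l κ : Measure ℝ) : Prop := ∀ y, l (Set.Ioi y) ≤ κ (Set.Ioi y)

/-- The law of a sum of `n` independent variables with laws `m 0, …, m (n - 1)`. -/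
noncomputable def convSeq (m : ℕ → Measure ℝ) : ℕ → Measure ℝ
  | 0 => Measure.dirac 0
  | n + 1 => (convSeq m n).conv (m n)

instance (m : ℕ → Measure ℝ) [∀ n, IsProbabilityMeasure (m n)] (n : ℕ) :
    IsProbabilityMeasure (convSeq m n) := by
  induction n with
  | zero => unfold convSeq; infer_instance
  | succ n ih => unfold convSeq; infer_instance

lemma TailLE.conv {l l' κ κ' : Measure ℝ} [SFinite l] [SFinite l'] [SFinite κ] [SFinite κ']
    (h : TailLE l l') (h' : TailLE κ κ') : TailLE (l.conv κ) (l'.conv κ') := by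
  intro y
  calc (l.conv κ) (Set.Ioi y) ≤ (l'.conv κ) (Set.Ioi y) := by
        rw [conv_Ioi, conv_Ioi]; exact lintegral_mono fun t => h _
    _ ≤ (l'.conv κ') (Set.Ioi y) := by
        rw [Measure.conv_comm l' κ, Measure.conv_comm l' κ', conv_Ioi, conv_Ioi]
        exact lintegral_mono fun t => h' _

lemma TailLE.convSeq {m m' : ℕ → Measure ℝ} [∀ n, IsProbabilityMeasure (m n)]
    [∀ n, IsProbabilityMeasure (m' n)] (n : ℕ) (h : ∀ i < n, TailLE (m i) (m' i)) :
    TailLE (convSeq m n) (convSeq m' n) := by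
  induction n with
  | zero => exact fun y => le_rfl
  | succ n ih =>
    exact TailLE.conv (ih fun i hi => h i (hi.trans n.lt_succ_self)) (h n n.lt_succ_self)

lemma TailLE.intTail {l κ : Measure ℝ} (h : TailLE l κ) (y : ℝ) : intTail l y ≤ intTail κ y :=
  lintegral_mono fun t => h t

lemma TailLE.mixedTail {l l' κ κ' : Measure ℝ} (h : TailLE l l') (h' : TailLE κ κ') (y : ℝ) :
    mixedTail l κ y ≤ mixedTail l' κ' y :=
  lintegral_mono fun t => mul_le_mul' (h t) (h' _)

lemma intTail_antitone (l : Measure ℝ) : Antitone (intTail l) :=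
  fun _ _ h => lintegral_mono_set (Set.Ioi_subset_Ioi h)

lemma intTail_eq (l : Measure ℝ) [SFinite l] (y : ℝ) :
    intTail l y = ∫⁻ x, ENNReal.ofReal (x - y) ∂l := by
  have hm : MeasurableSet {p : ℝ × ℝ | p.1 < p.2} := measurableSet_lt measurable_fst measurable_snd
  have h1 := Measure.prod_apply (μ := volume.restrict (Set.Ioi y)) (ν := l) hm
  have h2 := Measure.prod_apply_symm (μ := volume.restrict (Set.Ioi y)) (ν := l) hm
  have e1 : intTail l y = ∫⁻ t in Set.Ioi y, l (Prod.mk t ⁻¹' {p : ℝ × ℝ | p.1 < p.2}) := rfl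
  rw [e1, ← h1, h2]
  refine lintegral_congr fun x => ?_
  rw [Measure.restrict_apply (measurable_prodMk_right hm), ← Real.volume_Ioo]
  congr 1
  ext t
  simp [and_comm]

/-- What the excess of z + w over y has beyond the separate excesses is at most min(z, y) - max(0, y
- w), the length of an interval of levels t in (0, y) with t < z and y - t < w. -/
lemma add_sub_le_ofReal (z w y : ℝ) :
    ENNReal.ofReal (z + w - y) ≤ ENNReal.ofReal (z - y) + ENNReal.ofReal (w - y)
      + (volume.restrict (Set.Ioo 0 y)) {t | t < z ∧ y - t < w} := by
  rw [Measure.restrict_apply (by measurability)]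
  have hsub : Set.Ioo (max 0 (y - w)) (min z y) ⊆ {t | t < z ∧ y - t < w} ∩ Set.Ioo 0 y := by
    rintro t ⟨h1, h2⟩
    have := max_lt_iff.1 h1
    have := lt_min_iff.1 h2
    exact ⟨⟨by tauto, by linarith⟩, by tauto, by tauto⟩
  refine le_trans ?_ (add_le_add_right (measure_mono hsub) _)
  rw [Real.volume_Ioo]
  have h1 : z + w - y ≤ max (z - y) 0 + max (w - y) 0 + (min z y - max 0 (y - w)) := by
    rcases le_total z y with h | h <;> rcases le_total w y with h' | h' <;>
      simp [h, h'] <;> linarith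
  refine (ENNReal.ofReal_le_ofReal h1).trans (ENNReal.ofReal_add_le.trans ?_)
  gcongr
  refine ENNReal.ofReal_add_le.trans ?_
  simp

/-- The inequality for excesses is integrated against the product law; by Fubini the length term
becomes the mixed tail. This gives additivity of integrated tails without any subexponentiality of
the laws themselves. -/
lemma intTail_conv_le (l κ : Measure ℝ) [IsProbabilityMeasure l] [IsProbabilityMeasure κ]
    (y : ℝ) : intTail (l.conv κ) y ≤ intTail l y + intTail κ y + mixedTail l κ y := by
  have hm : MeasurableSet {q : ℝ × ℝ × ℝ | q.1 < q.2.1 ∧ y - q.1 < q.2.2} :=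
    (measurableSet_lt measurable_fst (measurable_fst.comp measurable_snd)).inter
      (measurableSet_lt (measurable_const.sub measurable_fst)
        (measurable_snd.comp measurable_snd))
  have h1 := Measure.prod_apply (μ := volume.restrict (Set.Ioo 0 y)) (ν := l.prod κ) hm
  have h2 := Measure.prod_apply_symm (μ := volume.restrict (Set.Ioo 0 y)) (ν := l.prod κ) hm
  have e3 : mixedTail l κ y = ∫⁻ p, (volume.restrict (Set.Ioo 0 y))
      {t | t < p.1 ∧ y - t < p.2} ∂(l.prod κ) := by
    refine Eq.trans ?_ (h1.symm.trans h2)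
    refine lintegral_congr fun t => ?_
    rw [← Measure.prod_prod]
    rfl
  have e1 : intTail l y = ∫⁻ p, ENNReal.ofReal (p.1 - y) ∂(l.prod κ) := by
    rw [intTail_eq, lintegral_prod _ (by fun_prop)]
    simp
  have e2 : intTail κ y = ∫⁻ p, ENNReal.ofReal (p.2 - y) ∂(l.prod κ) := by
    rw [intTail_eq, lintegral_prod _ (by fun_prop)]
    simp
  rw [e1, e2, e3, intTail_eq, Measure.conv, lintegral_map (by fun_prop) measurable_add,
    ← lintegral_add_left (by fun_prop), ← lintegral_add_left (by fun_prop)]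
  exact lintegral_mono fun p => add_sub_le_ofReal p.1 p.2 y

/-- Writing the tail of `l` as an integral over s > t and exchanging the integrals leaves ∫κ(y - t,
∞)dt over 0 < t < min(s, y), which is at most the integrated tail of κ at max(y - s, 0). -/
lemma mixedTail_le {H l κ : Measure ℝ} [IsProbabilityMeasure l] {B : ℝ≥0}
    (hκ : ∀ z, 0 ≤ z → intTail κ z ≤ B * H (Set.Ioi z)) (y : ℝ) :
    mixedTail l κ y ≤ B * ∫⁻ s, H (Set.Ioi (y - s)) ∂l := by
  have hκm := measurable_Ioi κ
  have e1 : mixedTail l κ y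
      = ∫⁻ s, (∫⁻ t in Set.Ioo 0 y,
          (Set.Iio s).indicator (fun t => κ (Set.Ioi (y - t))) t) ∂l := by
    rw [mixedTail, lintegral_lintegral_swap]
    · refine setLIntegral_congr_fun measurableSet_Ioo fun t _ => ?_
      change l (Set.Ioi t) * κ (Set.Ioi (y - t)) = ∫⁻ s, (Set.Iio s).indicator
        (fun t => κ (Set.Ioi (y - t))) t ∂l
      have : (fun s => (Set.Iio s).indicator (fun t => κ (Set.Ioi (y - t))) t)
          = (Set.Ioi t).indicator fun _ => κ (Set.Ioi (y - t)) := by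
        ext s; simp [Set.indicator]
      rw [this, lintegral_indicator measurableSet_Ioi, setLIntegral_const, mul_comm]
    · refine Measurable.aemeasurable ?_
      have : Function.uncurry (fun s t => (Set.Iio s).indicator (fun t => κ (Set.Ioi (y - t))) t)
          = {p : ℝ × ℝ | p.2 < p.1}.indicator fun p => κ (Set.Ioi (y - p.2)) := by
        ext ⟨s, t⟩; simp [Set.indicator]
      rw [this]
      exact ((measurable_Ioi_sub κ y).comp measurable_snd).indicator
        (measurableSet_lt measurable_snd measurable_fst)
  rw [e1, ← lintegral_const_mul _ (measurable_Ioi_sub H y)]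
  have e2 : ∀ s, ∫⁻ t in Set.Ioo 0 y, (Set.Iio s).indicator (fun t => κ (Set.Ioi (y - t))) t
      ≤ B * H (Set.Ioi (y - s)) := fun s => by
    have e3 : ∫⁻ t in Set.Ioo 0 y, (Set.Iio s).indicator (fun t => κ (Set.Ioi (y - t))) t
        ≤ intTail κ (max (y - s) 0) := by
      rw [intTail, ← lintegral_indicator measurableSet_Ioo, ← lintegral_indicator measurableSet_Ioi,
        ← lintegral_sub_left_eq_self (fun u => (Set.Ioi (max (y - s) 0)).indicator
          (fun t => κ (Set.Ioi t)) u) y]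
      refine lintegral_mono fun t => ?_
      by_cases ht : t ∈ Set.Ioo 0 y
      · rw [Set.indicator_of_mem ht]
        by_cases hs : t < s
        · rw [Set.indicator_of_mem (by exact hs), Set.indicator_of_mem]
          exact max_lt (by linarith) (by linarith [ht.2] : (0 : ℝ) < y - t)
        · rw [Set.indicator_of_notMem (by exact hs)]; exact zero_le
      · rw [Set.indicator_of_notMem ht]; exact zero_le
    refine e3.trans ((hκ _ (le_max_right _ _)).trans ?_)
    gcongr
    exact le_max_left _ _
  exact lintegral_mono e2

/-- Where y - t ≥ A the function f is replaced by k H̄ and `conv_finite` applies. Where t > y - A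
the bound f ≤ 1 leaves the tail of ν, with constant l. -/
lemma AsympLE.lintegral_sub {H : Measure ℝ} [IsProbabilityMeasure H] (hH : IsSubexpTail H)
    {f : ℝ → ℝ≥0∞} (hf1 : ∀ y, f y ≤ 1) {k l : ℝ≥0}
    (hf : AsympLE (fun y => H (Set.Ioi y)) f k) {ν : Measure ℝ} [IsFiniteMeasure ν]
    (hν : AsympLE (fun y => H (Set.Ioi y)) (fun y => ν (Set.Ioi y)) l) :
    AsympLE (fun y => H (Set.Ioi y)) (fun y => ∫⁻ t, f (y - t) ∂ν)
      (k * (l + (ν Set.univ).toNNReal) + l) := by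
  set m := (ν Set.univ).toNNReal
  refine AsympLE.of_continuous (u := fun ε => (k + ε) * (l + m + ε) + (l + ε)) (by fun_prop)
    (by simp) fun ε hε => ?_
  obtain ⟨A, hA⟩ := eventually_atTop.1 (hf ε hε)
  filter_upwards [hH.conv_finite hν ε hε, hH.shift hν A ε hε] with y h1 h2
  calc ∫⁻ t, f (y - t) ∂ν
      ≤ ∫⁻ t, (((k + ε : ℝ≥0) : ℝ≥0∞) * H (Set.Ioi (y - t))
          + (Set.Ioi (y - A)).indicator (fun _ => 1) t) ∂ν := by
        refine lintegral_mono fun t => ?_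
        by_cases ht : A ≤ y - t
        · exact (hA _ ht).trans le_self_add
        · rw [Set.indicator_of_mem (by simp only [Set.mem_Ioi]; linarith)]
          exact (hf1 _).trans le_add_self
    _ = ((k + ε : ℝ≥0) : ℝ≥0∞) * ∫⁻ t, H (Set.Ioi (y - t)) ∂ν + ν (Set.Ioi (y - A)) := by
        rw [lintegral_add_right _ (measurable_const.indicator measurableSet_Ioi),
          lintegral_const_mul _ (measurable_Ioi_sub H y), lintegral_indicator measurableSet_Ioi]
        simp
    _ ≤ ((k + ε : ℝ≥0) : ℝ≥0∞) * (((l + m + ε : ℝ≥0) : ℝ≥0∞) * H (Set.Ioi y))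
          + ((l + ε : ℝ≥0) : ℝ≥0∞) * H (Set.Ioi y) := by gcongr
    _ = _ := by push_cast; ring

lemma AsympLE.convSeq_zero {H : Measure ℝ} [IsProbabilityMeasure H] (hH : IsSubexpTail H)
    {m : ℕ → Measure ℝ} [∀ n, IsProbabilityMeasure (m n)]
    (hm : ∀ n, AsympLE (fun y => H (Set.Ioi y)) (fun y => (m n) (Set.Ioi y)) 0) (n : ℕ) :
    AsympLE (fun y => H (Set.Ioi y)) (fun y => (convSeq m n) (Set.Ioi y)) 0 := by
  induction n with
  | zero =>
    refine AsympLE.of_le ?_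
    filter_upwards [eventually_ge_atTop 0] with y hy
    simp [convSeq, hy]
  | succ n ih =>
    have := AsympLE.lintegral_sub hH (fun y => prob_le_one) ih (hm n)
    simp only [zero_mul, add_zero] at this
    simpa only [convSeq, conv_Ioi] using this

/-- For t below a constant the factor κ(y - t, ∞) is o(H̄). Above it the tail of `l` is at most ε
H̄, and ε times the mixed tail of `H` and κ is of order ε times the tail of `H` convolved with
itself. -/
lemma AsympLE.mixedTail_zero {H : Measure ℝ} [IsProbabilityMeasure H] (hH : IsSubexpTail H)
    {l κ : Measure ℝ} [IsProbabilityMeasure l] {B : ℝ≥0}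
    (hκ : ∀ z, 0 ≤ z → intTail κ z ≤ B * H (Set.Ioi z))
    (hl0 : AsympLE (fun y => H (Set.Ioi y)) (fun y => l (Set.Ioi y)) 0)
    (hκ0 : AsympLE (fun y => H (Set.Ioi y)) (fun y => κ (Set.Ioi y)) 0) :
    AsympLE (fun y => H (Set.Ioi y)) (mixedTail l κ) 0 := by
  refine AsympLE.of_continuous (u := fun ε => ε + ε * (B * (2 + ε))) (by fun_prop)
    (by simp) fun ε hε => ?_
  obtain ⟨A, hA⟩ := eventually_atTop.1 (hl0 ε hε)
  set A' : ℝ≥0 := A.toNNReal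
  have hAA' : A ≤ A' := Real.le_coe_toNNReal A
  have h3 := ((hH.shift hκ0 A').const_mul A')
  rw [mul_zero] at h3
  filter_upwards [h3 ε hε, hH.conv ε hε] with y h1 h2
  calc mixedTail l κ y
      ≤ ∫⁻ t in Set.Ioo 0 y, ((Set.Ioo 0 (A' : ℝ)).indicator (fun _ => κ (Set.Ioi (y - A'))) t
          + ε * (H (Set.Ioi t) * κ (Set.Ioi (y - t)))) := by
        refine setLIntegral_mono' measurableSet_Ioo fun t ht => ?_
        by_cases htA : t < A'
        · rw [Set.indicator_of_mem (show t ∈ Set.Ioo 0 (A' : ℝ) from ⟨ht.1, htA⟩)]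
          refine le_add_right ?_
          calc l (Set.Ioi t) * κ (Set.Ioi (y - t)) ≤ 1 * κ (Set.Ioi (y - A')) :=
                mul_le_mul' prob_le_one (measure_mono (Set.Ioi_subset_Ioi (by linarith)))
            _ = _ := one_mul _
        · refine le_add_left ?_
          rw [← mul_assoc]
          gcongr
          simpa using hA t (by linarith)
    _ ≤ A' * κ (Set.Ioi (y - A')) + ε * mixedTail H κ y := by
        rw [lintegral_add_left (measurable_const.indicator measurableSet_Ioo), mixedTail,
          lintegral_const_mul]
        · gcongr
          refine (setLIntegral_le_lintegral _ _).trans ?_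
          rw [lintegral_indicator measurableSet_Ioo, setLIntegral_const, Real.volume_Ioo, sub_zero,
            ENNReal.ofReal_coe_nnreal, mul_comm]
        · exact (measurable_Ioi H).mul (measurable_Ioi_sub κ y)
    _ ≤ ((0 + ε : ℝ≥0) : ℝ≥0∞) * H (Set.Ioi y)
          + ε * (B * (((2 + ε : ℝ≥0) : ℝ≥0∞) * H (Set.Ioi y))) := by
        gcongr
        refine (mixedTail_le hκ y).trans ?_
        rw [← conv_Ioi]
        gcongr
    _ = _ := by push_cast; ring

/-- Main terms keep the actual laws and mixed terms the dominating ones. With a common dominating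
law the error depends only on the number of summands. -/
lemma intTail_convSeq_le {m m' : ℕ → Measure ℝ} [∀ n, IsProbabilityMeasure (m n)]
    [∀ n, IsProbabilityMeasure (m' n)] {y : ℝ} (hy : 0 ≤ y) (n : ℕ)
    (h : ∀ i < n, TailLE (m i) (m' i)) :
    intTail (convSeq m n) y ≤ ∑ i ∈ Finset.range n, intTail (m i) y
      + ∑ i ∈ Finset.range n, mixedTail (convSeq m' i) (m' i) y := by
  induction n with
  | zero => 
    simp only [Finset.range_zero, Finset.sum_empty, add_zero, nonpos_iff_eq_zero]
    rw [convSeq, intTail_eq]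
    simp [hy]
  | succ n ih =>
    rw [Finset.sum_range_succ, Finset.sum_range_succ, convSeq]
    have h1 := intTail_conv_le (convSeq m n) (m n) y
    have h2 := ih fun i hi => h i (hi.trans n.lt_succ_self)
    have h3 : mixedTail (convSeq m n) (m n) y ≤ mixedTail (convSeq m' n) (m' n) y :=
      TailLE.mixedTail (TailLE.convSeq n fun i hi => h i (hi.trans n.lt_succ_self))
        (h n n.lt_succ_self) y
    calc _ ≤ _ := h1
      _ ≤ (∑ i ∈ Finset.range n, intTail (m i) y
          + ∑ i ∈ Finset.range n, mixedTail (convSeq m' i) (m' i) y) + intTail (m n) y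
          + mixedTail (convSeq m' n) (m' n) y := by gcongr
      _ = _ := by ring

lemma map_sum_eq_convSeq {Ω : Type*} [MeasurableSpace Ω] {μ : Measure Ω} [IsProbabilityMeasure μ]
    {Y : ℕ → Ω → ℝ} (hY : ∀ n, Measurable (Y n)) (hind : iIndepFun Y μ) (n : ℕ) :
    μ.map (fun ω => ∑ i ∈ Finset.range n, Y i ω) = convSeq (fun i => μ.map (Y i)) n := by
  induction n with
  | zero => simp [convSeq, Measure.map_const]
  | succ n ih =>
    rw [convSeq, ← ih]
    have h := (hind.indepFun_sum_range_succ hY n)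
    have h2 := h.map_add_eq_map_conv_map (by fun_prop) (hY n)
    convert h2 using 2
    · ext ω; simp [Finset.sum_range_succ]
    · congr 1
      exact funext fun ω => (Finset.sum_apply ω (Finset.range n) Y).symm

/-! ### A dominating law -/

/-- The law on `[B, ∞)` with tail `L F(y, ∞)` for `y ≥ B`. -/
noncomputable def domLaw (F : Measure ℝ) (L : ℝ≥0) (B : ℝ) : Measure ℝ :=
  (L : ℝ≥0∞) • F.restrict (Set.Ioi B) + (1 - L * F (Set.Ioi B)) • Measure.dirac B

section DomLaw

variable {F : Measure ℝ} {L : ℝ≥0} {B : ℝ}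

lemma isProbabilityMeasure_domLaw (hB : L * F (Set.Ioi B) ≤ 1) :
    IsProbabilityMeasure (domLaw F L B) := by
  constructor
  simp only [domLaw, Measure.coe_add, Measure.coe_smul, Pi.add_apply, Pi.smul_apply, smul_eq_mul,
    Measure.restrict_apply_univ, measure_univ, mul_one]
  exact add_tsub_cancel_of_le hB

lemma domLaw_Ioi {y : ℝ} (hy : B ≤ y) : domLaw F L B (Set.Ioi y) = L * F (Set.Ioi y) := by
  simp only [domLaw, Measure.coe_add, Measure.coe_smul, Pi.add_apply, Pi.smul_apply, smul_eq_mul]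
  rw [Measure.restrict_apply measurableSet_Ioi, Measure.dirac_apply' _ measurableSet_Ioi,
    Set.indicator_of_notMem (by simpa using hy), mul_zero, add_zero,
    Set.inter_eq_left.2 (Set.Ioi_subset_Ioi hy)]

lemma domLaw_Ioi_of_lt (hB : L * F (Set.Ioi B) ≤ 1) {y : ℝ} (hy : y < B) :
    domLaw F L B (Set.Ioi y) = 1 := by
  simp only [domLaw, Measure.coe_add, Measure.coe_smul, Pi.add_apply, Pi.smul_apply, smul_eq_mul]
  rw [Measure.restrict_apply measurableSet_Ioi, Measure.dirac_apply' _ measurableSet_Ioi,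
    Set.indicator_of_mem (by simpa using hy), Pi.one_apply, mul_one,
    Set.inter_eq_right.2 (Set.Ioi_subset_Ioi hy.le)]
  exact add_tsub_cancel_of_le hB

lemma tailLE_domLaw (hB0 : 0 ≤ B) (hB : L * F (Set.Ioi B) ≤ 1) {κ : Measure ℝ}
    [IsProbabilityMeasure κ] (hκ : ∀ y, 0 ≤ y → κ (Set.Ioi y) ≤ L * F (Set.Ioi y)) :
    TailLE κ (domLaw F L B) := by
  intro y
  rcases lt_or_ge y B with h | h
  · rw [domLaw_Ioi_of_lt hB h]; exact prob_le_one
  · rw [domLaw_Ioi h]; exact hκ y (hB0.trans h)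

lemma intTail_domLaw {y : ℝ} (hy : B ≤ y) : intTail (domLaw F L B) y = L * intTail F y := by
  rw [intTail, intTail, ← lintegral_const_mul _ (measurable_Ioi F)]
  exact setLIntegral_congr_fun measurableSet_Ioi fun t ht => domLaw_Ioi (hy.trans (le_of_lt ht))

lemma intTail_domLaw_zero (hB0 : 0 ≤ B) (hB : L * F (Set.Ioi B) ≤ 1) (hF : intTail F 0 ≠ ∞) :
    intTail (domLaw F L B) 0 ≠ ∞ := by
  have := isProbabilityMeasure_domLaw hB
  have h1 : intTail (domLaw F L B) 0
      = (∫⁻ t in Set.Ioc 0 B, domLaw F L B (Set.Ioi t)) + intTail (domLaw F L B) B := by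
    rw [intTail, intTail, ← lintegral_union measurableSet_Ioi (Set.disjoint_left.2
      fun x hx hx' => absurd hx.2 (not_le.2 hx')), Set.Ioc_union_Ioi_eq_Ioi hB0]
  rw [h1, intTail_domLaw le_rfl]
  refine ENNReal.add_ne_top.2 ⟨?_, ENNReal.mul_ne_top ENNReal.coe_ne_top
    (ne_top_of_le_ne_top hF (intTail_antitone F hB0))⟩
  refine ne_top_of_le_ne_top ?_ (lintegral_mono (g := fun _ => 1) fun t => prob_le_one)
  simp

end DomLaw

/-! ### Bounds for sums, linear in the number of summands. -/

section Bounds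

variable {H : Measure ℝ} [IsProbabilityMeasure H]

/-- By monotonicity F̄(y) is at most the integral of F̄ over (y - 1, y], a difference of two values
of the integrated tail, which is negligible because `H` is long-tailed. -/
lemma AsympLE.tail_zero (hH : IsSubexpTail H) {F : Measure ℝ} [IsProbabilityMeasure F]
    (hFH : ∀ᶠ y in atTop, intTail F y = H (Set.Ioi y)) :
    AsympLE (fun y => H (Set.Ioi y)) (fun y => F (Set.Ioi y)) 0 := by
  intro ε hε
  filter_upwards [hFH, (tendsto_atTop_add_const_right atTop (-1 : ℝ) tendsto_id).eventually hFH,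
    hH.long 1 ε hε] with y h1 h2 h3
  simp only [id, ← sub_eq_add_neg] at h2
  have h4 : F (Set.Ioi y) + intTail F y ≤ intTail F (y - 1) := by
    have : intTail F (y - 1) = (∫⁻ t in Set.Ioc (y - 1) y, F (Set.Ioi t)) + intTail F y := by
      rw [intTail, intTail, ← lintegral_union measurableSet_Ioi (Set.disjoint_left.2
        fun x hx hx' => absurd hx.2 (not_le.2 hx')), Set.Ioc_union_Ioi_eq_Ioi (by linarith)]
    rw [this]
    gcongr
    calc F (Set.Ioi y) = ∫⁻ _ in Set.Ioc (y - 1) y, F (Set.Ioi y) := by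
          rw [setLIntegral_const, Real.volume_Ioc]; simp
      _ ≤ _ := setLIntegral_mono' measurableSet_Ioc fun t ht =>
          measure_mono (Set.Ioi_subset_Ioi ht.2)
  rw [h1, h2] at h4
  have h5 := h4.trans h3
  push_cast at h5 ⊢
  rw [add_mul, one_mul, add_comm (H (Set.Ioi y))] at h5
  rw [zero_add]
  exact (ENNReal.add_le_add_iff_right (measure_ne_top _ _)).1 h5

/-- Bounds for sums of independent variables with tails below `L F̄`, linear in the number of
summands, up to a shift of the argument that is also linear in this number. -/
structure SumBounds (H : Measure ℝ) (θ : Measure ℝ) (b A : ℝ≥0) : Prop where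
  pos : 0 < b
  tail : ∀ n y, (convSeq (fun _ => θ) n) (Set.Ioi (y + n * b)) ≤ A * H (Set.Ioi y)
  intTail : ∀ (n : ℕ) (y : ℝ), 0 ≤ y →
    intTail (convSeq (fun _ => θ) n) (y + n * b) ≤ n * A * H (Set.Ioi y)
  tail_zero : ∀ n, AsympLE (fun y => H (Set.Ioi y)) (fun y => (convSeq (fun _ => θ) n) (Set.Ioi y)) 0
  mixed_zero : ∀ n, AsympLE (fun y => H (Set.Ioi y))
    (fun y => ∑ i ∈ Finset.range n, mixedTail (convSeq (fun _ => θ) i) θ y) 0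

/-- With `b` the mean of the positive part plus 1, positive parts minus `b` form a walk of drift -1.
A sum of n terms above y + n b lifts its perturbed maximum above y, whose tail does not involve n.
-/
lemma tail_convSeq_bound (hH : IsSubexpTail H) {θ : Measure ℝ} [IsProbabilityMeasure θ]
    {K : ℝ≥0} (hθ : AsympLE (fun y => H (Set.Ioi y)) (intTail θ) K) (hθ0 : intTail θ 0 ≠ ∞) :
    ∃ b A : ℝ≥0, 0 < b ∧
      ∀ n y, (convSeq (fun _ => θ) n) (Set.Ioi (y + n * b)) ≤ A * H (Set.Ioi y) := by
  have hint : Integrable (fun x : ℝ => max x 0) θ := by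
    refine ⟨by fun_prop, ?_⟩
    rw [HasFiniteIntegral]
    refine lt_of_le_of_lt (le_of_eq ?_) (lt_top_iff_ne_top.2 hθ0)
    rw [intTail_eq]
    refine lintegral_congr fun x => ?_
    rw [Real.enorm_of_nonneg (le_max_right _ _)]
    simp
  set m : ℝ := ∫ x, max x 0 ∂θ with hm
  have hm0 : 0 ≤ m := integral_nonneg fun x => le_max_right _ _
  set b : ℝ≥0 := ⟨m + 1, by linarith⟩ with hb
  have hbm : (b : ℝ) = m + 1 := rfl
  set μ := Measure.infinitePi (fun _ : ℕ => θ) with hμ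
  set g : ℝ → ℝ × ℝ := fun x => (max x 0 - b, max x 0) with hg
  have hgm : Measurable g := by fun_prop
  have hev : ∀ n, IdentDistrib (fun ω : ℕ → ℝ => ω n) (fun x : ℝ => x) μ θ := fun n =>
    ⟨(measurable_pi_apply n).aemeasurable, measurable_id.aemeasurable, by
      rw [hμ, Measure.infinitePi_map_eval (fun _ : ℕ => θ) n]
      exact Measure.map_id'.symm⟩
  have hmax := maximum_bound (μ := μ) (W := fun n ω => g (ω n)) (fun n => by fun_prop) hH
    (iIndepFun_infinitePi (X := fun _ => g) fun _ => hgm)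
    (fun n => ((hev n).comp hgm).trans ((hev 0).comp hgm).symm)
    (fun n ω => by simp only [hg]; linarith [b.2]) (fun n ω => le_max_right _ _)
    (((hev 0).comp (u := fun x => max x 0 - (b : ℝ)) (by fun_prop)).integrable_iff.2
      (hint.sub (integrable_const _)))
    (((hev 0).comp (u := fun x => max x 0) (by fun_prop)).integrable_iff.2 hint)
    (d := 1) one_pos (by
      refine ((hev 0).comp (u := fun x => max x 0 - (b : ℝ)) (by fun_prop)).integral_eq.trans ?_
      simp only [Function.comp_def]
      rw [integral_sub hint (integrable_const _), integral_const, hbm]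
      simp [hm]) (K := K) (by
      refine hθ.mono ?_
      filter_upwards [eventually_ge_atTop 0] with y hy
      refine setLIntegral_mono' measurableSet_Ioi fun t ht => le_of_eq ?_
      have h := (hev 0).measure_mem_eq (s := Set.Ioi t) measurableSet_Ioi
      have ht0 : 0 ≤ t := hy.trans (le_of_lt ht)
      refine Eq.trans ?_ h
      congr 1
      ext ω
      simp [hg, ht0.not_gt])
  obtain ⟨A, hA⟩ := hH.bound hmax (M := 1) (fun y => by exact_mod_cast prob_le_one)
  -- The extra 1 is for the empty sum at y < 0, where both tails equal 1.
  refine ⟨b, A + 1, by rw [← NNReal.coe_pos, hbm]; linarith, fun n y => ?_⟩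
  cases n with
  | zero =>
    rcases lt_or_ge y 0 with h | h
    · rw [Ioi_of_neg hH.nonneg h, mul_one]
      refine prob_le_one.trans ?_
      push_cast
      exact le_add_self
    · simp [convSeq, h]
  | succ n =>
    have hY := map_sum_eq_convSeq (μ := μ) (Y := fun i (ω : ℕ → ℝ) => ω i) (fun i => by fun_prop)
      (iIndepFun_infinitePi (X := fun _ x => x) fun _ => measurable_id) (n + 1)
    have hl : (fun i : ℕ => μ.map fun ω : ℕ → ℝ => ω i) = fun _ => θ :=
      funext fun i => Measure.infinitePi_map_eval (fun _ : ℕ => θ) i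
    rw [hl] at hY
    rw [← hY, Measure.map_apply (by fun_prop) measurableSet_Ioi]
    refine le_trans (measure_mono ?_) ((hA y).trans ?_)
    · intro ω hω
      refine ⟨n, ?_⟩
      simp only [Set.mem_preimage, Set.mem_Ioi] at hω
      simp only [perturbedSum, hg]
      rw [Finset.sum_sub_distrib, Finset.sum_const, Finset.card_range, nsmul_eq_mul]
      have h1 : ∑ i ∈ Finset.range (n + 1), ω i ≤ ∑ i ∈ Finset.range (n + 1), max (ω i) 0 :=
        Finset.sum_le_sum fun i _ => le_max_left _ _
      rw [Finset.sum_range_succ (fun i => max (ω i) 0)] at h1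
      push_cast at hω
      have := b.2
      simp only [NNReal.val_eq_coe] at this
      linarith
    · gcongr
      exact le_self_add

/-- One law θ dominates every law with tail at most L F̄ on the half-line, so the bounds for its
convolution powers are uniform over all words of states. -/
theorem exists_sumBounds (hH : IsSubexpTail H) {F : Measure ℝ} [IsProbabilityMeasure F]
    (hFH : ∀ᶠ y in atTop, ModulatedWalk.intTail F y = H (Set.Ioi y))
    (hF0 : ModulatedWalk.intTail F 0 ≠ ∞) (L : ℝ≥0) :
    ∃ θ : Measure ℝ, IsProbabilityMeasure θ ∧
      (∀ κ : Measure ℝ, IsProbabilityMeasure κ →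
        (∀ y, 0 ≤ y → κ (Set.Ioi y) ≤ L * F (Set.Ioi y)) → TailLE κ θ) ∧
      ∃ b A : ℝ≥0, SumBounds H θ b A := by
  obtain ⟨B, hB, hB0⟩ : ∃ B : ℝ, L * F (Set.Ioi B) ≤ 1 ∧ 0 ≤ B := by
    have h1 : Tendsto (fun y => (L : ℝ≥0∞) * F (Set.Ioi y)) atTop (𝓝 (L * 0)) :=
      ENNReal.Tendsto.const_mul (tendsto_Ioi F) (Or.inr ENNReal.coe_ne_top)
    rw [mul_zero] at h1
    exact ((h1.eventually (Iic_mem_nhds one_pos)).and (eventually_ge_atTop 0)).exists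
  set θ := domLaw F L B with hθ
  have hprob : IsProbabilityMeasure θ := isProbabilityMeasure_domLaw hB
  have hI0 : ModulatedWalk.intTail θ 0 ≠ ∞ := intTail_domLaw_zero hB0 hB hF0
  have hI : AsympLE (fun y => H (Set.Ioi y)) (ModulatedWalk.intTail θ) L := by
    refine AsympLE.of_le ?_
    filter_upwards [hFH, eventually_ge_atTop B] with y h1 h2
    rw [hθ, intTail_domLaw h2, h1]
  have hT : AsympLE (fun y => H (Set.Ioi y)) (fun y => θ (Set.Ioi y)) 0 := by
    have h1 := (AsympLE.tail_zero hH hFH).const_mul L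
    rw [mul_zero] at h1
    refine h1.mono ?_
    filter_upwards [eventually_ge_atTop B] with y hy
    rw [hθ, domLaw_Ioi hy]
  obtain ⟨A₂, hA₂⟩ : ∃ A₂ : ℝ≥0, ∀ z, 0 ≤ z → ModulatedWalk.intTail θ z ≤ A₂ * H (Set.Ioi z) := by
    obtain ⟨M, hM⟩ := exists_coe_of_ne_top hI0
    obtain ⟨A, hA⟩ := hH.bound (f := fun y => ModulatedWalk.intTail θ (max y 0)) (k := L)
      (hI.mono (Eventually.of_forall fun y => intTail_antitone θ (le_max_left _ _))) (M := M)
      (fun y => hM ▸ intTail_antitone θ (le_max_right _ _))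
    exact ⟨A, fun z hz => by simpa [hz] using hA z⟩
  obtain ⟨A₃, hA₃⟩ := hH.bound hH.conv (M := 1) fun y => by exact_mod_cast prob_le_one
  obtain ⟨b, A, hbpos, hA⟩ := tail_convSeq_bound hH hI hI0
  have htz : ∀ n, AsympLE (fun y => H (Set.Ioi y))
      (fun y => (convSeq (fun _ => θ) n) (Set.Ioi y)) 0 :=
    AsympLE.convSeq_zero hH fun _ => hT
  -- One more summand adds to the integrated tail at most A₂ for the new law and A₂·A·A₃ for the
  -- mixed term, each times H̄(y).
  refine ⟨θ, hprob, fun κ _ hκ => tailLE_domLaw hB0 hB hκ, b, A + (A₂ + A₂ * (A * A₃)),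
    ⟨hbpos, fun n y => (hA n y).trans ?_, fun n => ?_, htz, fun n => ?_⟩⟩
  · gcongr
    exact le_self_add
  · induction n with
    | zero =>
      intro y hy
      have : ModulatedWalk.intTail (convSeq (fun _ => θ) 0) (y + (0 : ℕ) * b) = 0 := by
        rw [convSeq, intTail_eq]
        simp [hy]
      rw [this]
      exact zero_le
    | succ n ih =>
      intro y hy
      set y' : ℝ := y + (n + 1 : ℕ) * b with hy'
      have hb0 : (0 : ℝ) ≤ b := b.2
      have hy1 : y + n * b ≤ y' := by rw [hy']; push_cast; linarith
      have hyy' : y ≤ y' := by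
        have : (0 : ℝ) ≤ n * b := by positivity
        linarith
      have e1 : mixedTail (convSeq (fun _ => θ) n) θ y' ≤ A₂ * (A * (A₃ * H (Set.Ioi y))) := by
        refine (mixedTail_le hA₂ y').trans ?_
        gcongr
        rw [← conv_Ioi, Measure.conv_comm, conv_Ioi]
        have h1 : ∀ t, (convSeq (fun _ => θ) n) (Set.Ioi (y' - t)) ≤ A * H (Set.Ioi (y - t)) := by
          intro t
          refine (measure_mono (Set.Ioi_subset_Ioi ?_)).trans (hA n (y - t))
          linarith
        refine (lintegral_mono h1).trans ?_
        rw [lintegral_const_mul _ (measurable_Ioi_sub H y), ← conv_Ioi]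
        gcongr
        exact hA₃ y
      have e2 : ModulatedWalk.intTail θ y' ≤ A₂ * H (Set.Ioi y) :=
        (intTail_antitone θ hyy').trans (hA₂ y hy)
      have e3 := (intTail_antitone (convSeq (fun _ => θ) n) hy1).trans (ih y hy)
      calc _ ≤ _ := intTail_conv_le (convSeq (fun _ => θ) n) θ y'
        _ ≤ n * ((A + (A₂ + A₂ * (A * A₃)) : ℝ≥0) : ℝ≥0∞) * H (Set.Ioi y) + A₂ * H (Set.Ioi y)
            + A₂ * (A * (A₃ * H (Set.Ioi y))) := by gcongr
        _ ≤ n * ((A + (A₂ + A₂ * (A * A₃)) : ℝ≥0) : ℝ≥0∞) * H (Set.Ioi y)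
            + (A * H (Set.Ioi y) + (A₂ * H (Set.Ioi y) + A₂ * (A * (A₃ * H (Set.Ioi y))))) := by
            rw [add_assoc]
            exact add_le_add le_rfl le_add_self
        _ = _ := by push_cast; ring
  · have := AsympLE.sum (Finset.range n) (h := fun y => H (Set.Ioi y))
      (f := fun i y => mixedTail (convSeq (fun _ => θ) i) θ y) (k := fun _ => 0)
      fun i _ => AsympLE.mixedTail_zero hH hA₂ (htz i) hT
    simpa using this

end Bounds

/-! ### Finite words and noise -/

section Words

variable {Ω 𝒳 : Type*} [MeasurableSpace Ω] [MeasurableSpace 𝒳]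

/-- The `i`-th letter of a finite word, with a default value beyond the end. -/
def letter (x₀ : 𝒳) (i : ℕ) (z : Σ k : ℕ, (Fin k → 𝒳)) : 𝒳 :=
  if h : i < z.1 then z.2 ⟨i, h⟩ else x₀

lemma measurable_of_sigma {γ : Type*} [MeasurableSpace γ] {f : (Σ k : ℕ, (Fin k → 𝒳)) → γ}
    (hf : ∀ k, Measurable fun x : Fin k → 𝒳 => f ⟨k, x⟩) : Measurable f := by
  intro s hs
  exact MeasurableSpace.measurableSet_iInf.2 fun k => hf k hs

lemma measurable_wordLength : Measurable fun z : Σ k : ℕ, (Fin k → 𝒳) => z.1 :=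
  measurable_of_sigma fun _ => measurable_const

lemma measurable_letter (x₀ : 𝒳) (i : ℕ) : Measurable (letter x₀ i) := by
  refine measurable_of_sigma fun k => ?_
  by_cases h : i < k
  · simpa [letter, h] using measurable_pi_apply (⟨i, h⟩ : Fin k)
  · simp [letter, h]

/-- The sum of `φ (q x_i u_i)` over the letters `x_i` of a word. -/
def blockSum (q : 𝒳 → Ω → ℝ) (x₀ : 𝒳) (φ : ℝ → ℝ) (z : Σ k : ℕ, (Fin k → 𝒳)) (u : ℕ → Ω) : ℝ :=
  ∑ i ∈ Finset.range z.1, φ (q (letter x₀ i z) (u i))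

lemma measurable_sum_range {α : Type*} [MeasurableSpace α] {M : Type*} [AddCommMonoid M]
    [MeasurableSpace M] [MeasurableAdd₂ M] {N : α → ℕ} (hN : Measurable N) {f : ℕ → α → M}
    (hf : ∀ i, Measurable (f i)) : Measurable fun a => ∑ i ∈ Finset.range (N a), f i a := by
  have : Measurable fun p : ℕ × α => ∑ i ∈ Finset.range p.1, f i p.2 :=
    measurable_from_prod_countable_right fun n =>
      Finset.measurable_sum (Finset.range n) fun i _ => hf i
  exact this.comp (hN.prodMk measurable_id)

lemma measurable_blockSum {q : 𝒳 → Ω → ℝ} (hq : Measurable fun p : 𝒳 × Ω => q p.1 p.2) (x₀ : 𝒳)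
    {φ : ℝ → ℝ} (hφ : Measurable φ) :
    Measurable fun p : (Σ k : ℕ, (Fin k → 𝒳)) × (ℕ → Ω) => blockSum q x₀ φ p.1 p.2 := by
  unfold blockSum
  refine measurable_sum_range (measurable_wordLength.comp measurable_fst) fun i => ?_
  exact hφ.comp (hq.comp (((measurable_letter x₀ i).comp measurable_fst).prodMk
    ((measurable_pi_apply i).comp measurable_snd)))

/-- The law of a doubly indexed array of independent copies of a noise variable. -/
noncomputable def noiseLaw (μ : Measure Ω) : Measure (ℕ → ℕ → Ω) :=
  Measure.infinitePi fun _ => Measure.infinitePi fun _ => μ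

variable {μ : Measure Ω} [IsProbabilityMeasure μ]

instance : IsProbabilityMeasure (noiseLaw μ) := by
  unfold noiseLaw; infer_instance

lemma noiseLaw_map_row (j : ℕ) :
    (noiseLaw μ).map (fun u => u j) = Measure.infinitePi fun _ : ℕ => μ :=
  Measure.infinitePi_map_eval (fun _ : ℕ => Measure.infinitePi fun _ : ℕ => μ) j

lemma noiseLaw_map_entry (j i : ℕ) : (noiseLaw μ).map (fun u => u j i) = μ := by
  have h1 := noiseLaw_map_row (μ := μ) j
  have h2 := Measure.infinitePi_map_eval (fun _ : ℕ => μ) i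
  rw [← h1, Measure.map_map (by fun_prop) (by fun_prop)] at h2
  exact h2

lemma iIndepFun_noise : iIndepFun (fun (p : ℕ × ℕ) (u : ℕ → ℕ → Ω) => u p.1 p.2) (noiseLaw μ) :=
  iIndepFun_uncurry_infinitePi' (X := fun _ _ (x : Ω) => x) (fun _ _ => μ)
    fun _ _ => measurable_id

/-- The pairs formed by independent words and independent rows of noise are independent. -/
lemma iIndepFun_pair {Z : ℕ → Ω → Σ k : ℕ, (Fin k → 𝒳)} (hZm : ∀ n, Measurable (Z n))
    (hZ : iIndepFun Z μ) :
    iIndepFun (fun j (p : Ω × (ℕ → ℕ → Ω)) => (Z j p.1, p.2 j)) (μ.prod (noiseLaw μ)) := by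
  have hm : ∀ j, Measurable fun p : Ω × (ℕ → ℕ → Ω) => (Z j p.1, p.2 j) := fun j =>
    ((hZm j).comp measurable_fst).prodMk ((measurable_pi_apply j).comp measurable_snd)
  rw [iIndepFun_iff_measure_inter_preimage_eq_mul]
  intro S t ht
  set ρ : Measure (ℕ → Ω) := Measure.infinitePi fun _ => μ
  have hg : ∀ j ∈ S, Measurable fun z => ρ (Prod.mk z ⁻¹' t j) := fun j hj =>
    measurable_measure_prodMk_left (ht j hj)
  have hone : ∀ j ∈ S, (μ.prod (noiseLaw μ)) ((fun p => (Z j p.1, p.2 j)) ⁻¹' t j)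
      = ∫⁻ ω, ρ (Prod.mk (Z j ω) ⁻¹' t j) ∂μ := by
    intro j hj
    rw [Measure.prod_apply (hm j (ht j hj))]
    refine lintegral_congr fun ω => ?_
    have h1 := noiseLaw_map_row (μ := μ) j
    rw [show ρ = (noiseLaw μ).map (fun u => u j) from h1.symm,
      Measure.map_apply (by fun_prop) (measurable_prodMk_left (ht j hj))]
    rfl
  rw [Finset.prod_congr rfl hone, Measure.prod_apply
    (Finset.measurableSet_biInter _ fun j hj => hm j (ht j hj))]
  have hrow : ∀ ω, noiseLaw μ (Prod.mk ω ⁻¹' ⋂ j ∈ S, (fun p : Ω × (ℕ → ℕ → Ω) =>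
      (Z j p.1, p.2 j)) ⁻¹' t j) = ∏ j ∈ S, ρ (Prod.mk (Z j ω) ⁻¹' t j) := by
    intro ω
    have : (Prod.mk ω ⁻¹' ⋂ j ∈ S, (fun p : Ω × (ℕ → ℕ → Ω) => (Z j p.1, p.2 j)) ⁻¹' t j)
        = Set.pi S fun j => Prod.mk (Z j ω) ⁻¹' t j := by
      ext u
      simp [Set.mem_pi]
    rw [this]
    exact Measure.infinitePi_pi _ fun j hj => measurable_prodMk_left (ht j hj)
  simp only [hrow]
  have hind : iIndepFun (fun (j : S) ω => ρ (Prod.mk (Z j ω) ⁻¹' t j)) μ := by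
    have h1 := hZ.precomp (g := fun j : S => (j : ℕ)) Subtype.val_injective
    exact h1.comp (fun (j : S) z => ρ (Prod.mk z ⁻¹' t j)) fun j => hg j j.2
  have h2 := lintegral_prod_eq_prod_lintegral_of_indepFun Finset.univ _ hind
    (fun j => (hg j j.2).comp (hZm j))
  simp only [Finset.univ_eq_attach] at h2
  rw [← Finset.prod_attach S fun j => ∫⁻ ω, ρ (Prod.mk (Z j ω) ⁻¹' t j) ∂μ, ← h2]
  refine lintegral_congr fun ω => ?_
  rw [← Finset.prod_attach S]

lemma map_pair (Z : Ω → Σ k : ℕ, (Fin k → 𝒳)) (hZm : Measurable Z) (j : ℕ) :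
    (μ.prod (noiseLaw μ)).map (fun p => (Z p.1, p.2 j))
      = (μ.map Z).prod (Measure.infinitePi fun _ : ℕ => μ) := by
  rw [← noiseLaw_map_row (μ := μ) j, Measure.map_prod_map _ _ hZm (by fun_prop)]
  rfl

end Words

/-! ### Concatenation of cycles -/

section Concatenation

/-- The time after which the `j`-th cycle starts. -/
def startTime (T : ℕ → ℕ) : ℕ → ℕ
  | 0 => 0
  | j + 1 => T j

/-- The index of the cycle containing time `n`. -/
noncomputable def cycleIndex (T : ℕ → ℕ) (n : ℕ) : ℕ := sInf {j | n ≤ T j}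

variable {T : ℕ → ℕ} (hT : StrictMono T)
include hT

lemma startTime_le (j : ℕ) : startTime T j ≤ T j := by
  cases j with
  | zero => exact Nat.zero_le _
  | succ j => exact (hT (Nat.lt_succ_self j)).le

lemma cycleIndex_eq {j i : ℕ} (h : startTime T j + 1 + i ≤ T j) :
    cycleIndex T (startTime T j + 1 + i) = j := by
  unfold cycleIndex
  refine le_antisymm (Nat.sInf_le h) (le_csInf ⟨j, h⟩ fun l hl => ?_)
  by_contra hlt
  cases j with
  | zero => omega
  | succ j =>
    have h1 : T l ≤ T j := hT.monotone (by omega)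
    simp only [startTime, Set.mem_ofPred_eq] at hl
    omega

lemma exists_position {n : ℕ} (hn : 1 ≤ n) :
    ∃ i, n = startTime T (cycleIndex T n) + 1 + i ∧ n ≤ T (cycleIndex T n) := by
  have hne : {j | n ≤ T j}.Nonempty := ⟨n, hT.id_le n⟩
  have hmem : n ≤ T (cycleIndex T n) := Nat.sInf_mem hne
  have hstart : startTime T (cycleIndex T n) < n := by
    rcases h : cycleIndex T n with _ | j
    · exact hn
    · have : j ∉ {j | n ≤ T j} := Nat.notMem_of_lt_sInf (by
        change j < cycleIndex T n; omega)
      simpa [startTime] using this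
  exact ⟨n - (startTime T (cycleIndex T n) + 1), by omega, hmem⟩

omit hT in
/-- The sequence obtained by concatenating the cycles of an array. -/
noncomputable def concat (T : ℕ → ℕ) (g : ℕ → ℕ → ℝ) (n : ℕ) : ℝ :=
  g (cycleIndex T n) (n - (startTime T (cycleIndex T n) + 1))

lemma concat_apply (g : ℕ → ℕ → ℝ) {j i : ℕ} (h : startTime T j + 1 + i ≤ T j) :
    concat T g (startTime T j + 1 + i) = g j i := by
  rw [concat, cycleIndex_eq hT h, Nat.add_sub_cancel_left]

lemma sum_concat (g : ℕ → ℕ → ℝ) (j p : ℕ) (hp : startTime T j + p ≤ T j) :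
    ∑ n ∈ Finset.range (startTime T j + p), concat T g (n + 1)
      = ∑ l ∈ Finset.range j, ∑ i ∈ Finset.range (T l - startTime T l), g l i
        + ∑ i ∈ Finset.range p, g j i := by
  induction j generalizing p with
  | zero =>
    rw [Finset.range_zero, Finset.sum_empty, zero_add]
    simp only [startTime, zero_add] at hp ⊢
    refine Finset.sum_congr rfl fun n hn => ?_
    have := concat_apply hT g (j := 0) (i := n) (by
      simp only [startTime]; have := Finset.mem_range.1 hn; omega)
    simp only [startTime, zero_add] at this
    rw [add_comm n 1, this]
  | succ j ih =>
    induction p with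
    | zero =>
      have h1 := startTime_le hT j
      have h2 := ih (T j - startTime T j) (by omega)
      rw [Nat.add_sub_of_le h1] at h2
      rw [Finset.sum_range_succ, Finset.range_zero, Finset.sum_empty, add_zero, add_zero, ← h2]
      rfl
    | succ p ihp =>
      rw [← add_assoc, Finset.sum_range_succ, ihp (by omega), Finset.sum_range_succ (g (j + 1)),
        add_right_comm _ p 1, concat_apply hT g (by omega), add_assoc]

end Concatenation

/-! ### Passage over a level, given the modulating process -/

/-- Sequences whose partial sums exceed the level `y` for the first time after an index in `N`. -/
def firstPassage (N : Set ℕ) (y : ℝ) : Set (ℕ → ℝ) :=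
  {s | ∃ n ∈ N, y < ∑ i ∈ Finset.range (n + 1), s i ∧ ∀ k ≤ n, ∑ i ∈ Finset.range k, s i ≤ y}

lemma measurableSet_firstPassage_of {α : Type*} [MeasurableSpace α] {N : α → Set ℕ}
    (hN : ∀ n, MeasurableSet {a | n ∈ N a}) {s : α → ℕ → ℝ} (hs : ∀ n, Measurable fun a => s a n)
    (y : ℝ) : MeasurableSet {a | s a ∈ firstPassage (N a) y} := by
  have h : ∀ k, Measurable fun a => ∑ i ∈ Finset.range k, s a i := fun k =>
    Finset.measurable_sum (Finset.range k) fun i _ => hs i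
  have : {a | s a ∈ firstPassage (N a) y} = ⋃ n, ({a | n ∈ N a} ∩
      ({a | y < ∑ i ∈ Finset.range (n + 1), s a i} ∩
        ⋂ k, ⋂ (_ : k ≤ n), {a | ∑ i ∈ Finset.range k, s a i ≤ y})) := by
    ext a
    simp [firstPassage]
  rw [this]
  refine MeasurableSet.iUnion fun n => (hN n).inter ((measurableSet_lt measurable_const
    (h _)).inter (MeasurableSet.iInter fun k => MeasurableSet.iInter fun _ =>
    measurableSet_le (h k) measurable_const))

lemma measurableSet_firstPassage (N : Set ℕ) (y : ℝ) : MeasurableSet (firstPassage N y) :=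
  measurableSet_firstPassage_of (N := fun _ => N) (fun _ => MeasurableSet.const _)
    (s := fun s => s) (fun n => measurable_pi_apply n) y

lemma measure_indepFun_eq_lintegral {Ω α β : Type*} [MeasurableSpace Ω] [MeasurableSpace α]
    [MeasurableSpace β] {μ : Measure Ω} [IsProbabilityMeasure μ] {f : Ω → α} {g : Ω → β}
    (hf : Measurable f) (hg : Measurable g) (h : IndepFun f g μ) {E : Set (α × β)}
    (hE : MeasurableSet E) :
    μ {ω | (f ω, g ω) ∈ E} = ∫⁻ ω, μ {ω' | (f ω, g ω') ∈ E} ∂μ := by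
  have h1 := (indepFun_iff_map_prod_eq_prod_map_map hf.aemeasurable hg.aemeasurable).1 h
  have : μ {ω | (f ω, g ω) ∈ E} = (μ.map fun ω => (f ω, g ω)) E := by
    rw [Measure.map_apply (hf.prodMk hg) hE]; rfl
  rw [this, h1, Measure.prod_apply hE, lintegral_map (measurable_measure_prodMk_left hE) hf]
  refine lintegral_congr fun ω => ?_
  rw [Measure.map_apply hg (measurable_prodMk_left hE)]
  rfl

section Transfer

variable {Ω 𝒳 : Type*} {X : ℕ → Ω → 𝒳} {T : ℕ → Ω → ℕ} {ξ : ℕ → 𝒳 → Ω → ℝ}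

lemma walk_eq (n : ℕ) (ω : Ω) :
    walk X ξ n ω = ∑ i ∈ Finset.range n, ξ (i + 1) (X (i + 1) ω) ω := by
  rw [walk, Finset.range_eq_Ico, Finset.sum_Ico_add' (fun i => ξ i (X i ω) ω) 0 n 1]
  congr 1

/-- Index n of the sequence is time n + 1 of the walk. For y ≥ 0 the term S_0 = 0 never exceeds the
level, so on this event the passage time does not take its default value. -/
lemma passage_event_iff {y : ℝ} (hy : 0 ≤ y) (B : Set 𝒳) (ω : Ω) :
    ((y : EReal) < walkSup X ξ ω ∧ X (passageTime X ξ y ω) ω ∈ B) ↔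
      (fun n => ξ (n + 1) (X (n + 1) ω) ω) ∈ firstPassage {n | X (n + 1) ω ∈ B} y := by
  constructor
  · rintro ⟨h1, h2⟩
    obtain ⟨n, hn⟩ := lt_iSup_iff.1 h1
    have hn' : y < walk X ξ n ω := EReal.coe_lt_coe_iff.1 hn
    have hn1 : 1 ≤ n := by
      rcases Nat.eq_zero_or_pos n with rfl | h
      · simp [walk] at hn'; linarith
      · exact h
    have hne : {n : ℕ | 1 ≤ n ∧ y < walk X ξ n ω}.Nonempty := ⟨n, hn1, hn'⟩
    obtain ⟨hp1, hp2⟩ := Nat.sInf_mem hne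
    have hmin : ∀ k < passageTime X ξ y ω, ¬ (1 ≤ k ∧ y < walk X ξ k ω) :=
      fun k hk => Nat.notMem_of_lt_sInf hk
    obtain ⟨p, hp⟩ : ∃ p, passageTime X ξ y ω = p + 1 := ⟨_, (Nat.sub_add_cancel hp1).symm⟩
    refine ⟨p, by rw [hp] at h2; exact h2, ?_, fun k hk => ?_⟩
    · have : y < walk X ξ (passageTime X ξ y ω) ω := hp2
      rwa [hp, walk_eq] at this
    · rcases Nat.eq_zero_or_pos k with rfl | h
      · simpa using hy
      · have := hmin k (by omega)
        rw [walk_eq] at this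
        push Not at this
        exact this h
  · rintro ⟨n, hnB, hn, hk⟩
    have hpt : passageTime X ξ y ω = n + 1 := by
      refine le_antisymm (Nat.sInf_le ⟨by omega, by rw [walk_eq]; exact hn⟩)
        (le_csInf ⟨n + 1, by omega, by rw [walk_eq]; exact hn⟩ fun k hk' => ?_)
      by_contra hlt
      have h1 := hk k (by omega)
      have h2 := hk'.2
      rw [walk_eq] at h2
      linarith
    refine ⟨lt_iSup_iff.2 ⟨n + 1, EReal.coe_lt_coe_iff.2 (by rw [walk_eq]; exact hn)⟩, ?_⟩
    rw [hpt]; exact hnB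

variable [mΩ : MeasurableSpace Ω] [MeasurableSpace 𝒳] {μ : Measure Ω} {P : Kernel 𝒳 ℝ}

lemma IsModulatedFamily.measurable (hξ : IsModulatedFamily μ X P ξ) {n : ℕ} (hn : 1 ≤ n) :
    Measurable fun p : 𝒳 × Ω => ξ n p.1 p.2 := by
  obtain ⟨𝓖, h1, h2, -, -⟩ := hξ.exists_sigmaAlgebra
  exact (h2 n hn).mono (sup_le_sup_left (MeasurableSpace.comap_mono (h1 n)) _) le_rfl

variable [IsProbabilityMeasure μ]

lemma IsModulatedFamily.map_eq_infinitePi (hξ : IsModulatedFamily μ X P ξ) (x : ℕ → 𝒳) :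
    μ.map (fun ω n => ξ (n + 1) (x n) ω) = Measure.infinitePi fun n => P (x n) := by
  obtain ⟨𝓖, h1, h2, h3, -⟩ := hξ.exists_sigmaAlgebra
  have hm : ∀ n, Measurable[𝓖 (n + 1)] fun ω => ξ (n + 1) (x n) ω := fun n =>
    @Measurable.comp Ω (𝒳 × Ω) ℝ (𝓖 (n + 1)) ((‹MeasurableSpace 𝒳›).prod (𝓖 (n + 1))) _
      (fun p => ξ (n + 1) p.1 p.2) (Prod.mk (x n)) (h2 (n + 1) (by omega)) (@measurable_prodMk_left _ _ _ (𝓖 (n + 1)) (x n))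
  have hind : iIndepFun (fun n ω => ξ (n + 1) (x n) ω) μ := by
    rw [iIndepFun_iff_iIndep]
    exact iIndep_of_iIndep_of_le h3 fun n => (hm n).comap_le
  rw [(iIndepFun_iff_map_fun_eq_infinitePi_map fun n => (hm n).mono (h1 _) le_rfl).1 hind]
  congr 1
  ext1 n
  exact hξ.law (n + 1) (by omega) (x n)

lemma IsModulatedFamily.measure_passage (hξ : IsModulatedFamily μ X P ξ)
    (hX : ∀ n, 1 ≤ n → Measurable (X n)) {y : ℝ} (hy : 0 ≤ y) {B : Set 𝒳}
    (hB : MeasurableSet B) :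
    μ {ω | (y : EReal) < walkSup X ξ ω ∧ X (passageTime X ξ y ω) ω ∈ B}
      = ∫⁻ ω, (Measure.infinitePi fun n => P (X (n + 1) ω))
          (firstPassage {n | X (n + 1) ω ∈ B} y) ∂μ := by
  obtain ⟨𝓖, h1, h2, -, h4⟩ := hξ.exists_sigmaAlgebra
  have hf : Measurable fun ω n => X (n + 1) ω :=
    measurable_pi_lambda _ fun n => hX (n + 1) (by omega)
  have hfib : ∀ ω, (Measure.infinitePi fun n => P (X (n + 1) ω))
      (firstPassage {n | X (n + 1) ω ∈ B} y) = μ {ω' | (fun n => ξ (n + 1) (X (n + 1) ω) ω')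
        ∈ firstPassage {n | X (n + 1) ω ∈ B} y} := fun ω => by
    have hm : Measurable fun ω' n => ξ (n + 1) (X (n + 1) ω) ω' := measurable_pi_lambda _ fun n =>
      (hξ.measurable (n := n + 1) (by omega)).comp measurable_prodMk_left
    rw [← hξ.map_eq_infinitePi, Measure.map_apply hm (measurableSet_firstPassage _ _)]
    rfl
  -- The identity of Ω, taken as a random element of (Ω, `m2`), carries the whole noise and is
  -- independent of X; Fubini then conditions on the path of X.
  set m2 : MeasurableSpace Ω := ⨆ n, 𝓖 (n + 1) with hm2
  have hle : m2 ≤ mΩ := iSup_le fun n => h1 _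
  have hg : Measurable[mΩ, m2] (id : Ω → Ω) := measurable_id'' hle
  have hind : @IndepFun Ω (ℕ → 𝒳) Ω mΩ _ m2 (fun ω n => X (n + 1) ω) id μ := by
    rw [IndepFun_iff_Indep]
    refine indep_of_indep_of_le_left (indep_of_indep_of_le_right h4.symm ?_) ?_
    · rw [MeasurableSpace.comap_id]
    · rw [MeasurableSpace.pi, MeasurableSpace.comap_iSup]
      refine iSup_mono fun n => ?_
      rw [MeasurableSpace.comap_comp]
      rfl
  have hEm : MeasurableSet[(MeasurableSpace.pi (X := fun _ : ℕ => 𝒳)).prod m2]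
      {p : (ℕ → 𝒳) × Ω | (fun n => ξ (n + 1) (p.1 n) p.2) ∈ firstPassage {n | p.1 n ∈ B} y} := by
    let : MeasurableSpace ((ℕ → 𝒳) × Ω) := (MeasurableSpace.pi (X := fun _ : ℕ => 𝒳)).prod m2
    refine measurableSet_firstPassage_of (N := fun p : (ℕ → 𝒳) × Ω => {n | p.1 n ∈ B})
      (s := fun p n => ξ (n + 1) (p.1 n) p.2) (fun n => ?_) (fun n => ?_) y
    · exact (measurable_pi_apply n).comp (@measurable_fst _ _ _ m2) hB
    · have h5 : @Measurable _ _ ((MeasurableSpace.pi (X := fun _ : ℕ => 𝒳)).prod m2)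
          ((‹MeasurableSpace 𝒳›).prod m2) fun p : (ℕ → 𝒳) × Ω => (p.1 n, p.2) :=
        Measurable.prodMk (f := fun p : (ℕ → 𝒳) × Ω => p.1 n) (g := fun p => p.2)
          ((measurable_pi_apply n).comp (@measurable_fst _ _ _ m2)) (@measurable_snd _ _ _ m2)
      have h6 : @Measurable _ _ ((‹MeasurableSpace 𝒳›).prod m2) _
          fun p : 𝒳 × Ω => ξ (n + 1) p.1 p.2 :=
        (h2 (n + 1) (by omega)).mono (sup_le_sup_left (MeasurableSpace.comap_mono
          (le_iSup (fun n => 𝓖 (n + 1)) n)) _) le_rfl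
      exact h6.comp h5
  have key := @measure_indepFun_eq_lintegral Ω (ℕ → 𝒳) Ω mΩ _ m2 μ _ _ _ hf hg hind _ hEm
  have hset : {ω | (y : EReal) < walkSup X ξ ω ∧ X (passageTime X ξ y ω) ω ∈ B}
      = {ω | ((fun n => X (n + 1) ω), id ω) ∈ {p : (ℕ → 𝒳) × Ω |
        (fun n => ξ (n + 1) (p.1 n) p.2) ∈ firstPassage {n | p.1 n ∈ B} y}} := by
    ext ω
    exact passage_event_iff hy B ω
  rw [hset, key]
  exact lintegral_congr fun ω => (hfib ω).symm

end Transfer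

/-! ### The increments rebuilt from the cycles and independent noise -/

section Rebuild

variable {Ω 𝒳 : Type*} {X : ℕ → Ω → 𝒳} {T : ℕ → Ω → ℕ} {q : 𝒳 → Ω → ℝ} {x₀ : 𝒳}

lemma cycleStart_eq (j : ℕ) (ω : Ω) : cycleStart T j ω = startTime (fun n => T n ω) j := by
  cases j <;> rfl

lemma cycleLength_eq (j : ℕ) (ω : Ω) :
    cycleLength T j ω = T j ω - startTime (fun n => T n ω) j := by
  cases j <;> rfl

lemma letter_cycle {j i : ℕ} {ω : Ω} (hi : i < cycleLength T j ω) :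
    letter x₀ i (cycle X T j ω) = X (startTime (fun n => T n ω) j + 1 + i) ω := by
  unfold letter cycle
  rw [dif_pos hi, ← cycleStart_eq]

/-- The increments of the walk, rebuilt from the cycles of `X` and an array of noise. -/
noncomputable def increments (X : ℕ → Ω → 𝒳) (T : ℕ → Ω → ℕ) (q : 𝒳 → Ω → ℝ) (x₀ : 𝒳) (ω : Ω)
    (u : ℕ → ℕ → Ω) (n : ℕ) : ℝ :=
  concat (fun n => T n ω) (fun j i => q (letter x₀ i (cycle X T j ω)) (u j i)) (n + 1)

lemma increments_eq {ω : Ω} (hT : StrictMono fun n => T n ω) (n : ℕ) (u : ℕ → ℕ → Ω) :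
    increments X T q x₀ ω u n = q (X (n + 1) ω) (u (cycleIndex (fun n => T n ω) (n + 1))
      (n + 1 - (startTime (fun n => T n ω) (cycleIndex (fun n => T n ω) (n + 1)) + 1))) := by
  obtain ⟨i, hi, hle⟩ := exists_position hT (n := n + 1) (by omega)
  unfold increments concat
  beta_reduce
  rw [letter_cycle (by rw [cycleLength_eq]; omega)]
  congr 2
  omega

variable [MeasurableSpace Ω] [MeasurableSpace 𝒳] {μ : Measure Ω} {P : Kernel 𝒳 ℝ}

lemma measurable_cycleLength (hT : ∀ n, Measurable (T n)) (j : ℕ) :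
    Measurable (cycleLength T j) := by
  cases j with
  | zero => exact hT 0
  | succ j => exact (hT (j + 1)).sub (hT j)

lemma measurable_cycleStart (hT : ∀ n, Measurable (T n)) (j : ℕ) :
    Measurable (cycleStart T j) := by
  cases j with
  | zero => exact measurable_const
  | succ j => exact hT j

lemma measurable_cycle (hX : ∀ n, 1 ≤ n → Measurable (X n)) (hT : ∀ n, Measurable (T n)) (j : ℕ) :
    Measurable (cycle X T j) := by
  intro s hs
  have : cycle X T j ⁻¹' s = ⋃ k, ⋃ m, ({ω | cycleLength T j ω = k} ∩
      ({ω | cycleStart T j ω = m} ∩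
        {ω | (⟨k, fun i : Fin k => X (m + 1 + i) ω⟩ : Σ k : ℕ, (Fin k → 𝒳)) ∈ s})) := by
    ext ω
    simp only [Set.mem_preimage, Set.mem_iUnion, Set.mem_inter_iff, Set.mem_ofPred_eq]
    constructor
    · intro h
      exact ⟨_, _, rfl, rfl, h⟩
    · rintro ⟨k, m, rfl, rfl, h⟩
      exact h
  rw [this]
  refine MeasurableSet.iUnion fun k => MeasurableSet.iUnion fun m => ?_
  refine (measurable_cycleLength hT j (measurableSet_singleton k)).inter
    ((measurable_cycleStart hT j (measurableSet_singleton m)).inter ?_)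
  have h1 : MeasurableSet {x : Fin k → 𝒳 | (⟨k, x⟩ : Σ k : ℕ, (Fin k → 𝒳)) ∈ s} :=
    MeasurableSpace.measurableSet_iInf.1 hs k
  exact (measurable_pi_lambda (fun ω (i : Fin k) => X (m + 1 + i) ω)
    fun i => hX _ (by omega)) h1

lemma measurable_increments (hq : Measurable fun p : 𝒳 × Ω => q p.1 p.2) (ω : Ω) :
    Measurable (increments X T q x₀ ω) := by
  refine measurable_pi_lambda _ fun n => ?_
  unfold increments concat
  exact hq.comp (measurable_const.prodMk ((measurable_pi_apply _).comp (measurable_pi_apply _)))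

variable [IsProbabilityMeasure μ]

/-- Distinct times lie at distinct (cycle, position) pairs, so along a fixed path of X the rebuilt
increments use each noise entry at most once and remain independent. -/
lemma map_increments (hq : Measurable fun p : 𝒳 × Ω => q p.1 p.2) (hlaw : ∀ x, μ.map (q x) = P x)
    {ω : Ω} (hT : StrictMono fun n => T n ω) :
    (noiseLaw μ).map (increments X T q x₀ ω) = Measure.infinitePi fun n => P (X (n + 1) ω) := by
  set J : ℕ → ℕ := fun n => cycleIndex (fun n => T n ω) (n + 1)
  set I : ℕ → ℕ := fun n => n + 1 - (startTime (fun n => T n ω) (J n) + 1)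
  have heq : increments X T q x₀ ω = fun u n => q (X (n + 1) ω) (u (J n) (I n)) := by
    ext u n
    exact increments_eq hT n u
  have hinj : Function.Injective fun n => (J n, I n) := by
    intro n m h
    obtain ⟨i, hi, -⟩ := exists_position hT (n := n + 1) (by omega)
    obtain ⟨i', hi', -⟩ := exists_position hT (n := m + 1) (by omega)
    simp only [Prod.mk.injEq] at h
    obtain ⟨h1, h2⟩ := h
    simp only [I, J] at h1 h2
    rw [← h1] at hi' h2
    omega
  have hm : ∀ n, Measurable (q (X (n + 1) ω)) := fun n => hq.comp measurable_prodMk_left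
  have hm' : ∀ n, Measurable fun u : ℕ → ℕ → Ω => q (X (n + 1) ω) (u (J n) (I n)) := fun n =>
    (hm n).comp ((measurable_pi_apply _).comp (measurable_pi_apply _))
  have hind : iIndepFun (fun n (u : ℕ → ℕ → Ω) => q (X (n + 1) ω) (u (J n) (I n)))
      (noiseLaw μ) :=
    (iIndepFun_noise (μ := μ).precomp hinj).comp (fun n => q (X (n + 1) ω)) hm
  rw [heq, (iIndepFun_iff_map_fun_eq_infinitePi_map hm').1 hind]
  congr 1
  ext1 n
  have := noiseLaw_map_entry (μ := μ) (J n) (I n)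
  rw [← hlaw, ← this, Measure.map_map (hm n) (by fun_prop)]
  · rw [this]
    rfl

/-- The probability of the passage event, as the mean of conditional probabilities given `X`. -/
lemma measure_passage_eq_lintegral {ξ : ℕ → 𝒳 → Ω → ℝ} (hX : IsRegenerative μ X T)
    (hξ : IsModulatedFamily μ X P ξ) (x₀ : 𝒳) {y : ℝ} (hy : 0 ≤ y) {B : Set 𝒳}
    (hB : MeasurableSet B) :
    μ {ω | (y : EReal) < walkSup X ξ ω ∧ X (passageTime X ξ y ω) ω ∈ B}
      = ∫⁻ ω, noiseLaw μ {u | increments X T (ξ 1) x₀ ω u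
          ∈ firstPassage {n | X (n + 1) ω ∈ B} y} ∂μ := by
  rw [hξ.measure_passage hX.measurable_process hy hB]
  refine lintegral_congr_ae ?_
  filter_upwards [hX.strictMono] with ω hω
  rw [← map_increments (x₀ := x₀) (hξ.measurable le_rfl) (hξ.law 1 le_rfl) hω,
    Measure.map_apply (measurable_increments (hξ.measurable le_rfl) ω)
      (measurableSet_firstPassage _ _)]
  rfl

end Rebuild

/-! ### Occupation measure and cycle sums -/

section Occupation

variable {Ω 𝒳 : Type*}

/-- The sum of a nonnegative function over the letters of a word. -/
noncomputable def wordSum (x₀ : 𝒳) (h : 𝒳 → ℝ≥0∞) (z : Σ k : ℕ, (Fin k → 𝒳)) : ℝ≥0∞ :=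
  ∑ i ∈ Finset.range z.1, h (letter x₀ i z)

/-- The sum of `φ (q x_i u_i)` over the letters `x_i` of a word, with values in `[0, ∞]`. -/
noncomputable def noiseSum (q : 𝒳 → Ω → ℝ) (x₀ : 𝒳) (φ : ℝ → ℝ≥0∞) (z : Σ k : ℕ, (Fin k → 𝒳))
    (u : ℕ → Ω) : ℝ≥0∞ :=
  ∑ i ∈ Finset.range z.1, φ (q (letter x₀ i z) (u i))

lemma wordSum_cycle_succ (X : ℕ → Ω → 𝒳) (T : ℕ → Ω → ℕ) (x₀ : 𝒳) (h : 𝒳 → ℝ≥0∞) (j : ℕ)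
    (ω : Ω) : wordSum x₀ h (cycle X T (j + 1) ω)
      = ∑ n ∈ Finset.Ico (T j ω + 1) (T (j + 1) ω + 1), h (X n ω) := by
  rw [Finset.sum_Ico_eq_sum_range, Nat.add_sub_add_right]
  refine Finset.sum_congr rfl fun i hi => ?_
  rw [letter_cycle (Finset.mem_range.1 hi)]
  rfl

variable [MeasurableSpace Ω] [MeasurableSpace 𝒳] {μ : Measure Ω} {X : ℕ → Ω → 𝒳} {T : ℕ → Ω → ℕ}
  {x₀ : 𝒳}

lemma measurable_wordSum {h : 𝒳 → ℝ≥0∞} (hh : Measurable h) : Measurable (wordSum x₀ h) :=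
  measurable_sum_range measurable_wordLength fun i => hh.comp (measurable_letter x₀ i)

lemma lintegral_occupation_one (hX : ∀ n, 1 ≤ n → Measurable (X n)) (hT : ∀ n, Measurable (T n))
    {h : 𝒳 → ℝ≥0∞} (hh : Measurable h) :
    ∫⁻ x, h x ∂(occupation μ X T) = ∫⁻ ω, wordSum x₀ h (cycle X T 1 ω) ∂μ := by
  have hS : ∀ i, MeasurableSet {ω | T 0 ω < i ∧ i ≤ T 1 ω} := fun i =>
    (measurableSet_lt (hT 0) measurable_const).inter (measurableSet_le measurable_const (hT 1))
  rw [occupation, lintegral_sum_measure]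
  have h1 : ∀ i, ∫⁻ x, h x ∂((μ.restrict {ω | T 0 ω < i ∧ i ≤ T 1 ω}).map (X i))
      = ∫⁻ ω, {ω | T 0 ω < i ∧ i ≤ T 1 ω}.indicator (fun ω => h (X i ω)) ω ∂μ := by
    intro i
    rcases Nat.eq_zero_or_pos i with rfl | hi
    · simp
    · rw [lintegral_map hh (hX i hi), lintegral_indicator (hS i)]
  simp only [h1]
  rw [← lintegral_tsum]
  · refine lintegral_congr fun ω => ?_
    rw [wordSum_cycle_succ, tsum_eq_sum (s := Finset.Ico (T 0 ω + 1) (T (0 + 1) ω + 1))]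
    · refine Finset.sum_congr rfl fun n hn => ?_
      rw [Finset.mem_Ico] at hn
      exact Set.indicator_of_mem (s := {ω | T 0 ω < n ∧ n ≤ T 1 ω}) (a := ω)
        (show T 0 ω < n ∧ n ≤ T 1 ω by simp only [zero_add] at hn; omega) _
    · intro n hn
      refine Set.indicator_of_notMem (fun hmem => hn ?_) _
      have : T 0 ω < n ∧ n ≤ T 1 ω := hmem
      rw [Finset.mem_Ico]
      simp only [zero_add]
      omega
  · intro i
    rcases Nat.eq_zero_or_pos i with rfl | hi
    · simp
    · exact ((hh.comp (hX i hi)).indicator (hS i)).aemeasurable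

/-- The occupation measure of the first cycle counts the letters of every later cycle. -/
lemma IsRegenerative.lintegral_occupation (hX : IsRegenerative μ X T) (x₀ : 𝒳) {h : 𝒳 → ℝ≥0∞}
    (hh : Measurable h) (j : ℕ) :
    ∫⁻ x, h x ∂(occupation μ X T) = ∫⁻ ω, wordSum x₀ h (cycle X T (j + 1) ω) ∂μ := by
  rw [lintegral_occupation_one (x₀ := x₀) hX.measurable_process hX.measurable_time hh]
  exact (((hX.identDistrib (j + 1) (by omega)).comp (measurable_wordSum hh)).lintegral_eq).symm

lemma IsRegenerative.occupation_univ (hX : IsRegenerative μ X T) (x₀ : 𝒳) :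
    occupation μ X T Set.univ = ∫⁻ ω, (cycleLength T 1 ω : ℝ≥0∞) ∂μ := by
  rw [← lintegral_one, hX.lintegral_occupation x₀ measurable_const 0]
  refine lintegral_congr fun ω => ?_
  simp [wordSum, cycle]

variable [IsProbabilityMeasure μ] {P : Kernel 𝒳 ℝ} {q : 𝒳 → Ω → ℝ}

lemma measurable_noiseSum (hq : Measurable fun p : 𝒳 × Ω => q p.1 p.2) {φ : ℝ → ℝ≥0∞}
    (hφ : Measurable φ) :
    Measurable fun p : (Σ k : ℕ, (Fin k → 𝒳)) × (ℕ → Ω) => noiseSum q x₀ φ p.1 p.2 := by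
  unfold noiseSum
  refine measurable_sum_range (measurable_wordLength.comp measurable_fst) fun i => ?_
  exact hφ.comp (hq.comp (((measurable_letter x₀ i).comp measurable_fst).prodMk
    ((measurable_pi_apply i).comp measurable_snd)))

lemma lintegral_noiseSum_word (hq : Measurable fun p : 𝒳 × Ω => q p.1 p.2)
    (hlaw : ∀ x, μ.map (q x) = P x) {φ : ℝ → ℝ≥0∞} (hφ : Measurable φ)
    (z : Σ k : ℕ, (Fin k → 𝒳)) :
    ∫⁻ u, noiseSum q x₀ φ z u ∂(Measure.infinitePi fun _ : ℕ => μ)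
      = wordSum x₀ (fun x => ∫⁻ t, φ t ∂(P x)) z := by
  have hqx : ∀ x, Measurable (q x) := fun x => hq.comp measurable_prodMk_left
  unfold noiseSum
  rw [lintegral_finsetSum]
  · refine Finset.sum_congr rfl fun i _ => ?_
    have h1 := Measure.infinitePi_map_eval (fun _ : ℕ => μ) i
    have h2 : ∫⁻ ω, φ (q (letter x₀ i z) ω) ∂((Measure.infinitePi fun _ : ℕ => μ).map fun u => u i)
        = ∫⁻ u, φ (q (letter x₀ i z) (u i)) ∂(Measure.infinitePi fun _ : ℕ => μ) :=
      lintegral_map (hφ.comp (hqx _)) (measurable_pi_apply i)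
    beta_reduce
    rw [← h2, ← hlaw, lintegral_map hφ (hqx _)]
    congr 1
  · exact fun i _ => hφ.comp ((hqx _).comp (measurable_pi_apply i))

lemma lintegral_noiseSum (hq : Measurable fun p : 𝒳 × Ω => q p.1 p.2)
    (hlaw : ∀ x, μ.map (q x) = P x) {φ : ℝ → ℝ≥0∞} (hφ : Measurable φ)
    {Z : Ω → Σ k : ℕ, (Fin k → 𝒳)} (hZ : Measurable Z) (j : ℕ) :
    ∫⁻ p, noiseSum q x₀ φ (Z p.1) (p.2 j) ∂(μ.prod (noiseLaw μ))
      = ∫⁻ ω, wordSum x₀ (fun x => ∫⁻ t, φ t ∂(P x)) (Z ω) ∂μ := by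
  have h1 := map_pair (μ := μ) Z hZ j
  have hm : Measurable fun p : Ω × (ℕ → ℕ → Ω) => (Z p.1, p.2 j) :=
    (hZ.comp measurable_fst).prodMk ((measurable_pi_apply j).comp measurable_snd)
  have h2 := lintegral_map (μ := μ.prod (noiseLaw μ)) (measurable_noiseSum (x₀ := x₀) hq hφ) hm
  rw [h1, lintegral_prod _ (measurable_noiseSum hq hφ).aemeasurable] at h2
  rw [← h2]
  simp only [lintegral_noiseSum_word hq hlaw hφ]
  exact lintegral_map (measurable_wordSum (hφ.lintegral_kernel)) hZ

omit [MeasurableSpace Ω] [MeasurableSpace 𝒳] in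
lemma ofReal_blockSum {φ : ℝ → ℝ} (hφ0 : ∀ t, 0 ≤ φ t) (z : Σ k : ℕ, (Fin k → 𝒳)) (u : ℕ → Ω) :
    ENNReal.ofReal (blockSum q x₀ φ z u) = noiseSum q x₀ (fun t => ENNReal.ofReal (φ t)) z u :=
  ENNReal.ofReal_sum_of_nonneg fun _ _ => hφ0 _

omit [MeasurableSpace Ω] [MeasurableSpace 𝒳] in
lemma blockSum_nonneg {φ : ℝ → ℝ} (hφ0 : ∀ t, 0 ≤ φ t) (z : Σ k : ℕ, (Fin k → 𝒳)) (u : ℕ → Ω) :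
    0 ≤ blockSum q x₀ φ z u := Finset.sum_nonneg fun _ _ => hφ0 _

omit [MeasurableSpace Ω] [MeasurableSpace 𝒳] in
lemma blockSum_le_blockSum {φ ψ : ℝ → ℝ} (h : ∀ t, φ t ≤ ψ t) (z : Σ k : ℕ, (Fin k → 𝒳))
    (u : ℕ → Ω) : blockSum q x₀ φ z u ≤ blockSum q x₀ ψ z u :=
  Finset.sum_le_sum fun _ _ => h _

omit [IsProbabilityMeasure μ] in
lemma measurable_blockSum_cycle (hX : IsRegenerative μ X T)
    (hq : Measurable fun p : 𝒳 × Ω => q p.1 p.2) {φ : ℝ → ℝ} (hφ : Measurable φ) (j : ℕ) :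
    Measurable fun p : Ω × (ℕ → ℕ → Ω) => blockSum q x₀ φ (cycle X T j p.1) (p.2 j) :=
  (measurable_blockSum hq x₀ hφ).comp (((measurable_cycle hX.measurable_process
    hX.measurable_time j).comp measurable_fst).prodMk
      ((measurable_pi_apply j).comp measurable_snd))

lemma lintegral_blockSum_cycle (hX : IsRegenerative μ X T)
    (hq : Measurable fun p : 𝒳 × Ω => q p.1 p.2) (hlaw : ∀ x, μ.map (q x) = P x) {φ : ℝ → ℝ}
    (hφ : Measurable φ) (hφ0 : ∀ t, 0 ≤ φ t) (j : ℕ) :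
    ∫⁻ p, ENNReal.ofReal (blockSum q x₀ φ (cycle X T (j + 1) p.1) (p.2 (j + 1)))
        ∂(μ.prod (noiseLaw μ))
      = ∫⁻ t, ENNReal.ofReal (φ t) ∂(P ∘ₘ occupation μ X T) := by
  simp only [ofReal_blockSum hφ0]
  rw [lintegral_noiseSum hq hlaw hφ.ennreal_ofReal
      (measurable_cycle hX.measurable_process hX.measurable_time (j + 1)) (j + 1),
    ← hX.lintegral_occupation x₀ hφ.ennreal_ofReal.lintegral_kernel j,
    Measure.lintegral_bind (by fun_prop) hφ.ennreal_ofReal.aemeasurable]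

lemma integrable_blockSum_cycle (hX : IsRegenerative μ X T)
    (hq : Measurable fun p : 𝒳 × Ω => q p.1 p.2) (hlaw : ∀ x, μ.map (q x) = P x) {φ : ℝ → ℝ}
    (hφ : Measurable φ) (hφ0 : ∀ t, 0 ≤ φ t) (hφi : Integrable φ (P ∘ₘ occupation μ X T)) (j : ℕ) :
    Integrable (fun p => blockSum q x₀ φ (cycle X T (j + 1) p.1) (p.2 (j + 1)))
      (μ.prod (noiseLaw μ)) := by
  refine ⟨(measurable_blockSum_cycle hX hq hφ (j + 1)).aestronglyMeasurable, ?_⟩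
  rw [hasFiniteIntegral_iff_ofReal (Eventually.of_forall fun p => blockSum_nonneg hφ0 _ _),
    lintegral_blockSum_cycle hX hq hlaw hφ hφ0 j]
  exact (hasFiniteIntegral_iff_ofReal (Eventually.of_forall hφ0)).1 hφi.2

lemma integral_blockSum_cycle_of_nonneg (hX : IsRegenerative μ X T)
    (hq : Measurable fun p : 𝒳 × Ω => q p.1 p.2) (hlaw : ∀ x, μ.map (q x) = P x) {φ : ℝ → ℝ}
    (hφ : Measurable φ) (hφ0 : ∀ t, 0 ≤ φ t) (j : ℕ) :
    ∫ p, blockSum q x₀ φ (cycle X T (j + 1) p.1) (p.2 (j + 1)) ∂(μ.prod (noiseLaw μ))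
      = ∫ t, φ t ∂(P ∘ₘ occupation μ X T) := by
  rw [integral_eq_lintegral_of_nonneg_ae (Eventually.of_forall fun p => blockSum_nonneg hφ0 _ _)
      (measurable_blockSum_cycle hX hq hφ (j + 1)).aestronglyMeasurable,
    integral_eq_lintegral_of_nonneg_ae (Eventually.of_forall hφ0) hφ.aestronglyMeasurable,
    lintegral_blockSum_cycle hX hq hlaw hφ hφ0 j]

omit [MeasurableSpace Ω] [MeasurableSpace 𝒳] in
lemma blockSum_id (z : Σ k : ℕ, (Fin k → 𝒳)) (u : ℕ → Ω) :
    blockSum q x₀ id z u = blockSum q x₀ (fun t => max t 0) z u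
      - blockSum q x₀ (fun t => max (-t) 0) z u := by
  rw [blockSum, blockSum, blockSum, ← Finset.sum_sub_distrib]
  refine Finset.sum_congr rfl fun i _ => ?_
  exact (max_zero_sub_max_neg_zero_eq_self _).symm

lemma integrable_blockSum_id (hX : IsRegenerative μ X T)
    (hq : Measurable fun p : 𝒳 × Ω => q p.1 p.2) (hlaw : ∀ x, μ.map (q x) = P x)
    (hi : Integrable (fun t => t) (P ∘ₘ occupation μ X T)) (j : ℕ) :
    Integrable (fun p => blockSum q x₀ id (cycle X T (j + 1) p.1) (p.2 (j + 1)))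
      (μ.prod (noiseLaw μ)) := by
  simp only [blockSum_id]
  exact (integrable_blockSum_cycle hX hq hlaw (by fun_prop) (fun t => le_max_right _ _)
    hi.pos_part j).sub (integrable_blockSum_cycle hX hq hlaw (by fun_prop)
    (fun t => le_max_right _ _) hi.neg_part j)

/-- The mean of a cycle sum is the mean of the increments under the occupation measure. -/
lemma integral_blockSum_id (hX : IsRegenerative μ X T)
    (hq : Measurable fun p : 𝒳 × Ω => q p.1 p.2) (hlaw : ∀ x, μ.map (q x) = P x)
    (hi : Integrable (fun t => t) (P ∘ₘ occupation μ X T)) (j : ℕ) :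
    ∫ p, blockSum q x₀ id (cycle X T (j + 1) p.1) (p.2 (j + 1)) ∂(μ.prod (noiseLaw μ))
      = ∫ t, t ∂(P ∘ₘ occupation μ X T) := by
  simp only [blockSum_id]
  rw [integral_sub (integrable_blockSum_cycle hX hq hlaw (by fun_prop) (fun t => le_max_right _ _)
    hi.pos_part j) (integrable_blockSum_cycle hX hq hlaw (by fun_prop)
    (fun t => le_max_right _ _) hi.neg_part j),
    integral_blockSum_cycle_of_nonneg hX hq hlaw (by fun_prop) (fun t => le_max_right _ _),
    integral_blockSum_cycle_of_nonneg hX hq hlaw (by fun_prop) (fun t => le_max_right _ _),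
    ← integral_sub hi.pos_part hi.neg_part]
  exact integral_congr_ae (Eventually.of_forall fun t => max_zero_sub_max_neg_zero_eq_self t)

end Occupation

/-! ### Sums of positive parts over a word -/

lemma positivePart_Ioi (κ : Measure ℝ) {t : ℝ} (ht : 0 ≤ t) :
    positivePart κ (Set.Ioi t) = κ (Set.Ioi t) := by
  rw [positivePart, Measure.map_apply (by fun_prop) measurableSet_Ioi]
  congr 1
  ext x
  simp [not_lt.2 ht]

instance (κ : Measure ℝ) [IsProbabilityMeasure κ] : IsProbabilityMeasure (positivePart κ) :=
  Measure.isProbabilityMeasure_map (by fun_prop)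

lemma intTail_positivePart (κ : Measure ℝ) {y : ℝ} (hy : 0 ≤ y) :
    intTail (positivePart κ) y = intTail κ y :=
  setLIntegral_congr_fun measurableSet_Ioi fun _ ht => positivePart_Ioi κ (hy.trans (le_of_lt ht))

lemma intTail_le_add (κ : Measure ℝ) [IsProbabilityMeasure κ] {y z : ℝ} (h : y ≤ z) :
    intTail κ y ≤ intTail κ z + ENNReal.ofReal (z - y) := by
  rw [intTail, ← Set.Ioc_union_Ioi_eq_Ioi h, add_comm]
  refine (lintegral_union_le _ _ _).trans ?_
  gcongr
  · calc ∫⁻ t in Set.Ioc y z, κ (Set.Ioi t) ≤ ∫⁻ _ in Set.Ioc y z, 1 :=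
        lintegral_mono fun t => prob_le_one
      _ = ENNReal.ofReal (z - y) := by simp
  · exact le_rfl

section WordLaw

variable {Ω 𝒳 : Type*} [MeasurableSpace Ω] [MeasurableSpace 𝒳] {μ : Measure Ω}
  [IsProbabilityMeasure μ] {P : Kernel 𝒳 ℝ} [IsMarkovKernel P] {q : 𝒳 → Ω → ℝ} {x₀ : 𝒳}

/-- The law of the sum of the positive parts of independent increments over a word. -/
noncomputable def wordLaw (P : Kernel 𝒳 ℝ) (x₀ : 𝒳) (z : Σ k : ℕ, (Fin k → 𝒳)) : Measure ℝ :=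
  convSeq (fun i => positivePart (P (letter x₀ i z))) z.1

omit [IsMarkovKernel P] in
lemma map_blockSum_posPart (hq : Measurable fun p : 𝒳 × Ω => q p.1 p.2)
    (hlaw : ∀ x, μ.map (q x) = P x) (z : Σ k : ℕ, (Fin k → 𝒳)) :
    (Measure.infinitePi fun _ : ℕ => μ).map (blockSum q x₀ (fun t => max t 0) z)
      = wordLaw P x₀ z := by
  have hqx : ∀ x, Measurable (q x) := fun x => hq.comp measurable_prodMk_left
  have hm : ∀ i, Measurable fun ω => max (q (letter x₀ i z) ω) 0 := fun i =>
    (hqx _).max measurable_const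
  have hind : iIndepFun (fun i (u : ℕ → Ω) => max (q (letter x₀ i z) (u i)) 0)
      (Measure.infinitePi fun _ : ℕ => μ) :=
    iIndepFun_infinitePi (X := fun i ω => max (q (letter x₀ i z) ω) 0) hm
  have h1 := map_sum_eq_convSeq (fun i => (hm i).comp (measurable_pi_apply i)) hind z.1
  have hlaws : (fun i => positivePart (P (letter x₀ i z))) = fun i =>
      (Measure.infinitePi fun _ : ℕ => μ).map (fun u => max (q (letter x₀ i z) (u i)) 0) := by
    funext i
    have h2 := Measure.infinitePi_map_eval (fun _ : ℕ => μ) i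
    have h3 : (Measure.infinitePi fun _ : ℕ => μ).map (fun u => max (q (letter x₀ i z) (u i)) 0)
        = ((Measure.infinitePi fun _ : ℕ => μ).map fun u => u i).map
          (fun ω => max (q (letter x₀ i z) ω) 0) := by
      rw [Measure.map_map (hm i) (measurable_pi_apply i)]
      rfl
    refine Eq.trans ?_ h3.symm
    rw [h2, positivePart, ← hlaw, Measure.map_map (by fun_prop) (hqx _)]
    rfl
  rw [wordLaw, hlaws]
  exact h1

variable {H θ : Measure ℝ} [IsProbabilityMeasure θ] {b A : ℝ≥0}
  (hθ : ∀ x, TailLE (positivePart (P x)) θ)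
include hθ

lemma wordLaw_le_convSeq (z : Σ k : ℕ, (Fin k → 𝒳)) :
    TailLE (wordLaw P x₀ z) (convSeq (fun _ => θ) z.1) :=
  TailLE.convSeq z.1 fun _ _ => hθ _

lemma wordLaw_Ioi_le (hS : SumBounds H θ b A) (z : Σ k : ℕ, (Fin k → 𝒳)) (y : ℝ) :
    wordLaw P x₀ z (Set.Ioi y) ≤ A * H (Set.Ioi (y - z.1 * b)) := by
  refine (wordLaw_le_convSeq hθ z y).trans ?_
  have := hS.tail z.1 (y - z.1 * b)
  rwa [sub_add_cancel] at this

/-- Above n b, with n the word length, this is the linear bound. Below it the tail of `H` on the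
right is 1, and the integrated tail is at most its value at n b, of order n A, plus the gap n b - y.
-/
lemma intTail_wordLaw_le [IsProbabilityMeasure H] (h0 : H (Set.Iio 0) = 0)
    (hS : SumBounds H θ b A) (z : Σ k : ℕ, (Fin k → 𝒳)) (y : ℝ) (hy : 0 ≤ y) :
    intTail (wordLaw P x₀ z) y ≤ (A + b : ℝ≥0) * (z.1 * H (Set.Ioi (y - z.1 * b))) := by
  refine ((wordLaw_le_convSeq hθ z).intTail y).trans ?_
  rcases le_or_gt (z.1 * (b : ℝ)) y with h | h
  · have := hS.intTail z.1 (y - z.1 * b) (by linarith)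
    rw [sub_add_cancel] at this
    refine this.trans ?_
    rw [mul_comm (z.1 : ℝ≥0∞), mul_assoc]
    gcongr
    exact le_self_add
  · rw [Ioi_of_neg h0 (by linarith)]
    have h1 := hS.intTail z.1 0 le_rfl
    rw [zero_add] at h1
    calc intTail (convSeq (fun _ => θ) z.1) y
        ≤ intTail (convSeq (fun _ => θ) z.1) (z.1 * b) + ENNReal.ofReal (z.1 * b - y) :=
          intTail_le_add _ h.le
      _ ≤ z.1 * A * 1 + ENNReal.ofReal (z.1 * b) := by
          gcongr
          · exact h1.trans (by gcongr; exact prob_le_one)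
          · linarith
      _ = (A + b : ℝ≥0) * (z.1 * 1) := by
          rw [ENNReal.ofReal_mul (by positivity), ENNReal.ofReal_natCast, ENNReal.ofReal_coe_nnreal]
          push_cast
          ring

/-- The sharp counterpart, for words of bounded length: the main term is exact letter by letter, and
the error depends on the word only through its length. -/
lemma intTail_wordLaw_le_sum (z : Σ k : ℕ, (Fin k → 𝒳)) (y : ℝ) (hy : 0 ≤ y) :
    intTail (wordLaw P x₀ z) y ≤ wordSum x₀ (fun x => intTail (P x) y) z
      + ∑ i ∈ Finset.range z.1, mixedTail (convSeq (fun _ => θ) i) θ y := by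
  refine (intTail_convSeq_le hy z.1 (m' := fun _ => θ) fun _ _ => hθ _).trans ?_
  gcongr
  refine Finset.sum_le_sum fun i _ => ?_
  rw [intTail_positivePart _ hy]

end WordLaw

/-! ### Size biasing -/

section SizeBias

variable {Ω : Type*} [MeasurableSpace Ω] {μ : Measure Ω}

lemma AsympLE.setLIntegral_Ioi {H F : Measure ℝ}
    (hFH : ∀ᶠ y in atTop, intTail F y = H (Set.Ioi y)) {f : ℝ → ℝ≥0∞} {k : ℝ≥0}
    (hf : AsympLE (fun y => F (Set.Ioi y)) f k) :
    AsympLE (fun y => H (Set.Ioi y)) (fun y => ∫⁻ t in Set.Ioi y, f t) k := by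
  intro ε hε
  filter_upwards [eventually_forall_ge_atTop.2 (hf ε hε), hFH] with y hy hyH
  rw [← hyH, intTail, ← lintegral_const_mul _ (measurable_Ioi F)]
  exact setLIntegral_mono_ae ((measurable_Ioi F).const_mul _).aemeasurable
    (Eventually.of_forall fun t ht => hy t (le_of_lt ht))

/-- The right-hand side is the mean excess of 2bN over y, and 2bN - y > bN where bN > y. -/
lemma mul_lintegral_le_lintegral_Ioi [SFinite μ] {N : Ω → ℕ} (hN : Measurable N) (b : ℝ≥0)
    (y : ℝ) : b * ∫⁻ ω in {ω | y < b * N ω}, (N ω : ℝ≥0∞) ∂μ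
      ≤ ∫⁻ t in Set.Ioi y, μ {ω | t < (2 * b : ℝ≥0) * N ω} := by
  have hm : Measurable fun ω => ((2 * b : ℝ≥0) : ℝ) * N ω :=
    measurable_const.mul (measurable_from_top.comp hN)
  have h1 : ∀ t : ℝ, μ {ω | t < (2 * b : ℝ≥0) * N ω}
      = (μ.map fun ω => ((2 * b : ℝ≥0) : ℝ) * N ω) (Set.Ioi t) := fun t => by
    rw [Measure.map_apply hm measurableSet_Ioi]; rfl
  simp only [h1]
  have hN' : Measurable fun ω => (N ω : ℝ≥0∞) := measurable_from_top.comp hN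
  rw [← intTail, intTail_eq, lintegral_map (by fun_prop) hm, ← lintegral_const_mul _ hN']
  refine (setLIntegral_mono_ae (g := fun ω => ENNReal.ofReal (((2 * b : ℝ≥0) : ℝ) * N ω - y))
    (by fun_prop) (Eventually.of_forall fun ω hω => ?_)).trans (setLIntegral_le_lintegral _ _)
  have hω' : y < b * N ω := hω
  rw [← ENNReal.ofReal_coe_nnreal, ← ENNReal.ofReal_natCast (N ω),
    ← ENNReal.ofReal_mul (by positivity)]
  refine ENNReal.ofReal_le_ofReal ?_
  push_cast
  linarith

/-- Size biasing turns `o(F̄)` into `o` of the integrated tail. -/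
lemma AsympLE.sizeBias [SFinite μ] {H F : Measure ℝ}
    (hFH : ∀ᶠ y in atTop, intTail F y = H (Set.Ioi y)) {N : Ω → ℕ} (hN : Measurable N)
    (htail : ∀ b : ℝ≥0, 0 < b →
      AsympLE (fun y => F (Set.Ioi y)) (fun y => μ {ω | y < b * N ω}) 0) {b : ℝ≥0} (hb : 0 < b) :
    AsympLE (fun y => H (Set.Ioi y)) (fun y => ∫⁻ ω in {ω | y < b * N ω}, (N ω : ℝ≥0∞) ∂μ) 0 := by
  have h1 := ((htail (2 * b) (by positivity)).setLIntegral_Ioi hFH).const_mul b⁻¹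
  rw [mul_zero] at h1
  refine h1.mono (Eventually.of_forall fun y => ?_)
  have h2 := mul_lintegral_le_lintegral_Ioi (μ := μ) hN b y
  have hb' : (b : ℝ≥0∞) ≠ 0 := by simpa using hb.ne'
  rw [ENNReal.coe_inv hb.ne']
  calc ∫⁻ ω in {ω | y < b * N ω}, (N ω : ℝ≥0∞) ∂μ
      = (b : ℝ≥0∞)⁻¹ * (b * ∫⁻ ω in {ω | y < b * N ω}, (N ω : ℝ≥0∞) ∂μ) := by
        rw [← mul_assoc, ENNReal.inv_mul_cancel hb' ENNReal.coe_ne_top, one_mul]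
    _ ≤ _ := by gcongr

end SizeBias

/-! ### Mixtures over random words -/

section Large

variable {Ω : Type*} [MeasurableSpace Ω] {μ : Measure Ω} {N : Ω → ℕ} {w : Ω → ℝ≥0∞}

lemma measurableSet_natCast_lt (hN : Measurable N) (n : ℕ) : MeasurableSet {ω | n < N ω} :=
  measurableSet_lt measurable_const hN

lemma tendsto_lintegral_large (hN : Measurable N) (hw : ∫⁻ ω, w ω ∂μ ≠ ∞) :
    Tendsto (fun n : ℕ => ∫⁻ ω in {ω | n < N ω}, w ω ∂μ) atTop (𝓝 0) := by
  have h1 := tendsto_measure_iInter_atTop (μ := μ.withDensity w) (s := fun n : ℕ => {ω | n < N ω})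
    (fun n => (measurableSet_natCast_lt hN n).nullMeasurableSet)
    (fun n m h ω hω => lt_of_le_of_lt h hω)
    ⟨0, by
      rw [withDensity_apply _ (measurableSet_natCast_lt hN 0)]
      exact ne_top_of_le_ne_top hw (setLIntegral_le_lintegral _ _)⟩
  have h2 : ⋂ n : ℕ, {ω | n < N ω} = ∅ := by
    ext ω
    simpa using ⟨N ω, le_rfl⟩
  rw [h2, measure_empty] at h1
  refine h1.congr fun n => ?_
  exact withDensity_apply _ (measurableSet_natCast_lt hN n)

lemma lintegral_split_large (hN : Measurable N) (n : ℕ) (f : Ω → ℝ≥0∞) :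
    ∫⁻ ω, f ω ∂μ = ∫⁻ ω in {ω | N ω ≤ n}, f ω ∂μ + ∫⁻ ω in {ω | n < N ω}, f ω ∂μ := by
  rw [← lintegral_add_compl f (measurableSet_natCast_lt hN n), add_comm]
  congr 3
  ext ω
  simp

/-- The integral is a convolution of `H` with the image under bN of the measure w dμ on {N > n}.
This image has tail o(H̄), so only its total mass survives in `conv_finite`. -/
lemma AsympLE.lintegral_large {H : Measure ℝ} [IsProbabilityMeasure H] (hH : IsSubexpTail H)
    (hN : Measurable N) (hw : Measurable w) (hwi : ∫⁻ ω, w ω ∂μ ≠ ∞) {b : ℝ≥0}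
    (htail : AsympLE (fun y => H (Set.Ioi y)) (fun y => ∫⁻ ω in {ω | y < b * N ω}, w ω ∂μ) 0)
    (n : ℕ) :
    AsympLE (fun y => H (Set.Ioi y))
      (fun y => ∫⁻ ω in {ω | n < N ω}, w ω * H (Set.Ioi (y - N ω * b)) ∂μ)
      (∫⁻ ω in {ω | n < N ω}, w ω ∂μ).toNNReal := by
  have hf : Measurable fun ω => (N ω : ℝ) * b :=
    (measurable_from_top.comp hN : Measurable fun ω => (N ω : ℝ)).mul_const _
  have hS := measurableSet_natCast_lt hN n
  set ν : Measure ℝ := ((μ.restrict {ω | n < N ω}).withDensity w).map fun ω => (N ω : ℝ) * b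
  have hν : ν Set.univ = ∫⁻ ω in {ω | n < N ω}, w ω ∂μ := by
    rw [Measure.map_apply hf MeasurableSet.univ, Set.preimage_univ,
      withDensity_apply _ MeasurableSet.univ, Measure.restrict_univ]
  have hfin : IsFiniteMeasure ν :=
    ⟨hν ▸ (setLIntegral_le_lintegral _ _).trans_lt (lt_top_iff_ne_top.2 hwi)⟩
  have hν0 : AsympLE (fun y => H (Set.Ioi y)) (fun y => ν (Set.Ioi y)) 0 := by
    refine htail.mono (Eventually.of_forall fun y => ?_)
    have hm : MeasurableSet {ω | y < b * N ω} := by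
      simp only [mul_comm (b : ℝ)]
      exact hf measurableSet_Ioi
    have hpre : (fun ω => (N ω : ℝ) * b) ⁻¹' Set.Ioi y = {ω | y < b * N ω} := by
      ext ω
      simp [mul_comm (b : ℝ)]
    rw [Measure.map_apply hf measurableSet_Ioi, hpre, withDensity_apply _ hm]
    exact lintegral_mono' (Measure.restrict_mono le_rfl Measure.restrict_le_self) le_rfl
  have h1 := hH.conv_finite hν0
  rw [zero_add, hν] at h1
  refine h1.mono (Eventually.of_forall fun y => le_of_eq ?_)
  have hm : Measurable fun ω => H (Set.Ioi (y - N ω * b)) := (measurable_Ioi_sub H y).comp hf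
  rw [lintegral_map (measurable_Ioi_sub H y) hf, lintegral_withDensity_eq_lintegral_mul _ hw hm]
  rfl

/-- The w-mass of {N > n} tends to 0, so large N adds an arbitrarily small constant, and sharp
asymptotics are needed only for bounded N. -/
lemma AsympLE.of_split {h : ℝ → ℝ≥0∞} {f : ℝ → Ω → ℝ≥0∞} {k : ℝ≥0} (a : ℝ≥0)
    (hN : Measurable N) (hwi : ∫⁻ ω, w ω ∂μ ≠ ∞)
    (hsmall : ∀ n : ℕ, AsympLE h (fun y => ∫⁻ ω in {ω | N ω ≤ n}, f y ω ∂μ) k)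
    (hlarge : ∀ n : ℕ, AsympLE h (fun y => ∫⁻ ω in {ω | n < N ω}, f y ω ∂μ)
      (a * (∫⁻ ω in {ω | n < N ω}, w ω ∂μ).toNNReal)) :
    AsympLE h (fun y => ∫⁻ ω, f y ω ∂μ) k := by
  refine AsympLE.of_forall_gt fun ε hε => ?_
  have h1 : Tendsto (fun n : ℕ => (∫⁻ ω in {ω | n < N ω}, w ω ∂μ).toNNReal) atTop (𝓝 0) :=
    (ENNReal.tendsto_toNNReal ENNReal.zero_ne_top).comp (tendsto_lintegral_large hN hwi)
  have h2 : Tendsto (fun n : ℕ => a * (∫⁻ ω in {ω | n < N ω}, w ω ∂μ).toNNReal) atTop (𝓝 0) := by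
    simpa using h1.const_mul a
  obtain ⟨n, hn⟩ := (h2.eventually (Iic_mem_nhds hε)).exists
  refine (((hsmall n).add (hlarge n)).weaken (add_le_add le_rfl hn)).mono
    (Eventually.of_forall fun y => ?_)
  rw [lintegral_split_large hN n]

end Large

/-! ### Tails of sums over random words. -/

section Mixture

variable {Ω 𝒳 : Type*} [MeasurableSpace Ω] [MeasurableSpace 𝒳] {μ : Measure Ω}
  [IsProbabilityMeasure μ] {P : Kernel 𝒳 ℝ} [IsMarkovKernel P] {q : 𝒳 → Ω → ℝ} {x₀ : 𝒳}

omit [IsMarkovKernel P] in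
lemma wordLaw_Ioi (hq : Measurable fun p : 𝒳 × Ω => q p.1 p.2) (hlaw : ∀ x, μ.map (q x) = P x)
    (z : Σ k : ℕ, (Fin k → 𝒳)) (t : ℝ) :
    wordLaw P x₀ z (Set.Ioi t)
      = Measure.infinitePi (fun _ : ℕ => μ) {u | t < blockSum q x₀ (fun t => max t 0) z u} := by
  rw [← map_blockSum_posPart hq hlaw, Measure.map_apply _ measurableSet_Ioi]
  · rfl
  · exact (measurable_blockSum hq x₀ (φ := fun t => max t 0) (by fun_prop)).comp measurable_prodMk_left

omit [IsMarkovKernel P] in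
lemma measurable_wordLaw_Ioi (hq : Measurable fun p : 𝒳 × Ω => q p.1 p.2)
    (hlaw : ∀ x, μ.map (q x) = P x) :
    Measurable fun p : (Σ k : ℕ, (Fin k → 𝒳)) × ℝ => wordLaw P x₀ p.1 (Set.Ioi p.2) := by
  simp only [wordLaw_Ioi hq hlaw]
  have hS : MeasurableSet {p : ((Σ k : ℕ, (Fin k → 𝒳)) × ℝ) × (ℕ → Ω) |
      p.1.2 < blockSum q x₀ (fun t => max t 0) p.1.1 p.2} :=
    measurableSet_lt (by fun_prop) ((measurable_blockSum hq x₀ (φ := fun t => max t 0) (by fun_prop)).comp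
      ((measurable_fst.comp measurable_fst).prodMk measurable_snd))
  exact measurable_measure_prodMk_left hS

variable {Z : Ω → Σ k : ℕ, (Fin k → 𝒳)}

omit [IsMarkovKernel P] in
lemma measure_blockSum_gt (hq : Measurable fun p : 𝒳 × Ω => q p.1 p.2)
    (hlaw : ∀ x, μ.map (q x) = P x) (hZ : Measurable Z) (j : ℕ) (t : ℝ) :
    (μ.prod (noiseLaw μ)) {p | t < blockSum q x₀ (fun t => max t 0) (Z p.1) (p.2 j)}
      = ∫⁻ ω, wordLaw P x₀ (Z ω) (Set.Ioi t) ∂μ := by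
  have hS : MeasurableSet {p : (Σ k : ℕ, (Fin k → 𝒳)) × (ℕ → Ω) |
      t < blockSum q x₀ (fun t => max t 0) p.1 p.2} :=
    measurableSet_lt measurable_const (measurable_blockSum hq x₀ (φ := fun t => max t 0) (by fun_prop))
  have h1 := congrArg (fun m => m {p : (Σ k : ℕ, (Fin k → 𝒳)) × (ℕ → Ω) |
      t < blockSum q x₀ (fun t => max t 0) p.1 p.2}) (map_pair (μ := μ) Z hZ j)
  have hm : Measurable fun p : Ω × (ℕ → ℕ → Ω) => (Z p.1, p.2 j) :=
    (hZ.comp measurable_fst).prodMk ((measurable_pi_apply j).comp measurable_snd)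
  rw [Measure.map_apply hm hS, Measure.prod_apply hS,
    lintegral_map (measurable_measure_prodMk_left hS) hZ] at h1
  refine h1.trans (lintegral_congr fun ω => ?_)
  rw [wordLaw_Ioi hq hlaw]
  rfl

omit [IsMarkovKernel P] in
lemma lintegral_Ioi_measure_blockSum (hq : Measurable fun p : 𝒳 × Ω => q p.1 p.2)
    (hlaw : ∀ x, μ.map (q x) = P x) (hZ : Measurable Z) (j : ℕ) (y : ℝ) :
    ∫⁻ t in Set.Ioi y, (μ.prod (noiseLaw μ))
        {p | t < blockSum q x₀ (fun t => max t 0) (Z p.1) (p.2 j)}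
      = ∫⁻ ω, intTail (wordLaw P x₀ (Z ω)) y ∂μ := by
  simp only [measure_blockSum_gt hq hlaw hZ]
  rw [lintegral_lintegral_swap]
  · rfl
  · exact ((measurable_wordLaw_Ioi (x₀ := x₀) hq hlaw).comp
      ((hZ.comp measurable_snd).prodMk measurable_fst)).aemeasurable

variable {H θ : Measure ℝ} [IsProbabilityMeasure H] [IsProbabilityMeasure θ] {b A : ℝ≥0}

/-- A word sum whose length has tail `o(H̄)` has tail `o(H̄)`. -/
lemma AsympLE.lintegral_wordLaw (hθ : ∀ x, TailLE (positivePart (P x)) θ) (hH : IsSubexpTail H)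
    (hS : SumBounds H θ b A) (hZ : Measurable Z)
    (htail : ∀ b : ℝ≥0, 0 < b →
      AsympLE (fun y => H (Set.Ioi y)) (fun y => μ {ω | y < b * (Z ω).1}) 0) :
    AsympLE (fun y => H (Set.Ioi y)) (fun y => ∫⁻ ω, wordLaw P x₀ (Z ω) (Set.Ioi y) ∂μ) 0 := by
  have hN : Measurable fun ω => (Z ω).1 := measurable_wordLength.comp hZ
  have h1i : ∫⁻ _, (1 : ℝ≥0∞) ∂μ ≠ ∞ := by simp
  refine AsympLE.of_split (N := fun ω => (Z ω).1) (w := fun _ => 1) A hN h1i (fun n => ?_)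
    fun n => ?_
  · have h1 := AsympLE.sum (Finset.range (n + 1)) fun k _ => hS.tail_zero k
    rw [Finset.sum_const_zero] at h1
    refine h1.mono (Eventually.of_forall fun y => ?_)
    refine (setLIntegral_mono_ae (g := fun _ => ∑ k ∈ Finset.range (n + 1),
      convSeq (fun _ => θ) k (Set.Ioi y)) (by fun_prop)
      (Eventually.of_forall fun ω hω => ?_)).trans ((setLIntegral_le_lintegral _ _).trans
        (by simp))
    exact (wordLaw_le_convSeq hθ (Z ω) y).trans (Finset.single_le_sum
      (f := fun k => convSeq (fun _ => θ) k (Set.Ioi y)) (fun _ _ => zero_le)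
      (Finset.mem_range.2 (Nat.lt_succ_of_le hω)))
  · have h0 : AsympLE (fun y => H (Set.Ioi y))
        (fun y => ∫⁻ _ in {ω | y < b * (Z ω).1}, 1 ∂μ) 0 := by
      simpa using htail b hS.pos
    refine ((AsympLE.lintegral_large hH hN measurable_const h1i h0 n).const_mul A).mono
      (Eventually.of_forall fun y => ?_)
    rw [← lintegral_const_mul' _ _ ENNReal.coe_ne_top]
    refine lintegral_mono fun ω => ?_
    simpa using wordLaw_Ioi_le hθ hS (Z ω) y

/-- The integrated tail of a word sum is asymptotically that of the sum of its letters. -/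
lemma AsympLE.lintegral_intTail_wordLaw (hθ : ∀ x, TailLE (positivePart (P x)) θ)
    (hH : IsSubexpTail H) (hS : SumBounds H θ b A) (hZ : Measurable Z)
    (hmean : ∫⁻ ω, ((Z ω).1 : ℝ≥0∞) ∂μ ≠ ∞)
    (htail : ∀ b : ℝ≥0, 0 < b → AsympLE (fun y => H (Set.Ioi y))
      (fun y => ∫⁻ ω in {ω | y < b * (Z ω).1}, ((Z ω).1 : ℝ≥0∞) ∂μ) 0) {C : ℝ≥0}
    (hC : AsympLE (fun y => H (Set.Ioi y))
      (fun y => ∫⁻ ω, wordSum x₀ (fun x => intTail (P x) y) (Z ω) ∂μ) C) :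
    AsympLE (fun y => H (Set.Ioi y)) (fun y => ∫⁻ ω, intTail (wordLaw P x₀ (Z ω)) y ∂μ) C := by
  have hN : Measurable fun ω => (Z ω).1 := measurable_wordLength.comp hZ
  refine AsympLE.of_split (N := fun ω => (Z ω).1) (w := fun ω => ((Z ω).1 : ℝ≥0∞)) (A + b) hN hmean
    (fun n => ?_) fun n => ?_
  -- Short words: the letters give C and finitely many mixed terms are negligible. Long words, in
  -- the second case, use the bound linear in the length, whence the weight `(Z ω).1`.
  · have h1 := AsympLE.sum (Finset.range (n + 1)) fun k _ => hS.mixed_zero k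
    rw [Finset.sum_const_zero] at h1
    have h2 := hC.add h1
    rw [add_zero] at h2
    refine h2.mono ?_
    filter_upwards [eventually_ge_atTop 0] with y hy
    refine (setLIntegral_mono' (g := fun ω => wordSum x₀ (fun x => intTail (P x) y) (Z ω)
      + ∑ k ∈ Finset.range (n + 1),
        ∑ i ∈ Finset.range k, mixedTail (convSeq (fun _ => θ) i) θ y)
      (hN measurableSet_Iic) (fun ω hω => ?_)).trans ((setLIntegral_le_lintegral _ _).trans ?_)
    · refine (intTail_wordLaw_le_sum hθ (Z ω) y hy).trans ?_
      gcongr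
      exact Finset.single_le_sum
        (f := fun k => ∑ i ∈ Finset.range k, mixedTail (convSeq (fun _ => θ) i) θ y)
        (fun _ _ => zero_le) (Finset.mem_range.2 (Nat.lt_succ_of_le hω))
    · rw [lintegral_add_right _ measurable_const]
      simp
  · refine ((AsympLE.lintegral_large hH hN (measurable_from_top.comp hN) hmean
      (htail b hS.pos) n).const_mul (A + b)).mono ?_
    filter_upwards [eventually_ge_atTop 0] with y hy
    rw [← lintegral_const_mul' _ _ ENNReal.coe_ne_top]
    exact lintegral_mono fun ω => intTail_wordLaw_le hθ hH.nonneg hS (Z ω) y hy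

end Mixture

/-! ### Tails averaged over a finite measure -/

section Average

variable {𝒳 : Type*} [MeasurableSpace 𝒳] {P : Kernel 𝒳 ℝ} {F : Measure ℝ} {c : 𝒳 → ℝ} {L : ℝ≥0}

/-- Dominated convergence: the ratios converge for each state and are bounded by `L`, integrable for
finite ρ. -/
lemma tendsto_comp_tail (ρ : Measure 𝒳) [IsFiniteMeasure ρ]
    (hc : ∀ x, Tendsto (fun y => P x (Set.Ioi y) / F (Set.Ioi y)) atTop
      (𝓝 (ENNReal.ofReal (c x)))) (hL : ∀ x y, 0 ≤ y → P x (Set.Ioi y) ≤ L * F (Set.Ioi y)) :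
    Tendsto (fun y => (P ∘ₘ ρ) (Set.Ioi y) / F (Set.Ioi y)) atTop
      (𝓝 (∫⁻ x, ENNReal.ofReal (c x) ∂ρ)) := by
  have h1 : ∀ y, (P ∘ₘ ρ) (Set.Ioi y) / F (Set.Ioi y)
      = ∫⁻ x, P x (Set.Ioi y) / F (Set.Ioi y) ∂ρ := fun y => by
    rw [Measure.bind_apply measurableSet_Ioi (by fun_prop), div_eq_mul_inv,
      ← lintegral_mul_const _ (P.measurable_coe measurableSet_Ioi)]
    rfl
  simp only [h1]
  refine tendsto_lintegral_filter_of_dominated_convergence (fun _ => (L : ℝ≥0∞)) ?_ ?_ ?_ ?_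
  · exact Eventually.of_forall fun y => (P.measurable_coe measurableSet_Ioi).div_const _
  · filter_upwards [eventually_ge_atTop 0] with y hy
    exact Eventually.of_forall fun x => ENNReal.div_le_of_le_mul (hL x y hy)
  · rw [lintegral_const]
    exact ENNReal.mul_ne_top ENNReal.coe_ne_top (measure_ne_top _ _)
  · exact Eventually.of_forall hc

lemma intTail_comp (ρ : Measure 𝒳) [SFinite ρ] [IsSFiniteKernel P] (y : ℝ) :
    ∫⁻ x, intTail (P x) y ∂ρ = intTail (P ∘ₘ ρ) y := by
  rw [intTail_eq, Measure.lintegral_bind (by fun_prop) (by fun_prop)]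
  exact lintegral_congr fun x => intTail_eq _ _

lemma measurable_intTail [IsSFiniteKernel P] (y : ℝ) : Measurable fun x => intTail (P x) y := by
  simp only [intTail_eq]
  exact Measurable.lintegral_kernel (by fun_prop)

lemma AsympLE.of_tendsto_div {f g : ℝ → ℝ≥0∞} {k : ℝ≥0}
    (h : Tendsto (fun y => f y / g y) atTop (𝓝 k)) (hg : ∀ y, g y ≠ 0) (hg' : ∀ y, g y ≠ ∞) :
    AsympLE g f k := by
  intro ε hε
  have h1 : (k : ℝ≥0∞) < ((k + ε : ℝ≥0) : ℝ≥0∞) := by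
    exact_mod_cast lt_add_of_pos_right k hε
  filter_upwards [h.eventually (gt_mem_nhds h1)] with y hy
  exact (ENNReal.div_le_iff (hg y) (hg' y)).1 hy.le

end Average

/-! ### Cycle sums and the upper bound -/

lemma indepFun_zero_succ {Ω α : Type*} [MeasurableSpace Ω] [mα : MeasurableSpace α]
    {μ : Measure Ω} {Q : ℕ → Ω → α} (hQm : ∀ n, Measurable (Q n)) (hQ : iIndepFun Q μ) :
    IndepFun (Q 0) (fun ω j => Q (j + 1) ω) μ := by
  have h1 := indep_iSup_of_disjoint (fun n => (hQm n).comap_le) ((iIndepFun_iff_iIndep _ _ _).1 hQ)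
    (S := {0}) (T := {n | 0 < n}) (by simp)
  rw [IndepFun_iff_Indep]
  refine indep_of_indep_of_le_left (indep_of_indep_of_le_right h1 ?_) ?_
  · rw [MeasurableSpace.pi, MeasurableSpace.comap_iSup]
    refine iSup_le fun j => ?_
    rw [MeasurableSpace.comap_comp]
    exact le_iSup₂_of_le (f := fun n (_ : n ∈ {n | 0 < n}) => mα.comap (Q n)) (j + 1)
      (Nat.succ_pos j) le_rfl
  · exact le_iSup₂_of_le (f := fun n (_ : n ∈ ({0} : Set ℕ)) => mα.comap (Q n)) 0 rfl le_rfl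

section CycleSums

variable {Ω 𝒳 : Type*} (X : ℕ → Ω → 𝒳) (T : ℕ → Ω → ℕ) (q : 𝒳 → Ω → ℝ) (x₀ : 𝒳)

/-- The sum of the increments, transformed by `φ`, in the initial cycle. -/
noncomputable def initialSum (φ : ℝ → ℝ) (p : Ω × (ℕ → ℕ → Ω)) : ℝ :=
  blockSum q x₀ φ (cycle X T 0 p.1) (p.2 0)

/-- The sum of the increments and the sum of their positive parts, in the `j + 1`-st cycle. -/
noncomputable def cycleSums (j : ℕ) (p : Ω × (ℕ → ℕ → Ω)) : ℝ × ℝ :=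
  (blockSum q x₀ id (cycle X T (j + 1) p.1) (p.2 (j + 1)),
    blockSum q x₀ (fun t => max t 0) (cycle X T (j + 1) p.1) (p.2 (j + 1)))

variable {X T q x₀}

lemma sum_increments_eq {ω : Ω} (hT : StrictMono fun n => T n ω) (u : ℕ → ℕ → Ω) (j p : ℕ)
    (hp : startTime (fun n => T n ω) j + p ≤ T j ω) :
    ∑ n ∈ Finset.range (startTime (fun n => T n ω) j + p), increments X T q x₀ ω u n
      = ∑ l ∈ Finset.range j, blockSum q x₀ id (cycle X T l ω) (u l)
        + ∑ i ∈ Finset.range p, q (letter x₀ i (cycle X T j ω)) (u j i) := by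
  have := sum_concat hT (fun j i => q (letter x₀ i (cycle X T j ω)) (u j i)) j p hp
  simp only [← cycleLength_eq] at this
  exact this

lemma sum_blockSum_succ (u : ℕ → ℕ → Ω) (ω : Ω) (j : ℕ) :
    ∑ l ∈ Finset.range (j + 1), blockSum q x₀ id (cycle X T l ω) (u l)
      = initialSum X T q x₀ id (ω, u) + ∑ l ∈ Finset.range j, (cycleSums X T q x₀ l (ω, u)).1 := by
  rw [Finset.sum_range_succ', add_comm]
  rfl

lemma sum_range_le_blockSum (z : Σ k : ℕ, (Fin k → 𝒳)) (u : ℕ → Ω) {p : ℕ} (hp : p ≤ z.1) :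
    ∑ i ∈ Finset.range p, q (letter x₀ i z) (u i) ≤ blockSum q x₀ (fun t => max t 0) z u :=
  (Finset.sum_le_sum fun _ _ => le_max_left _ _).trans
    (Finset.sum_le_sum_of_subset_of_nonneg (Finset.range_mono hp)
      fun _ _ _ => le_max_right _ _)

/-- The difference on the right is the sum of the negative parts over the word, which bounds the
depth of every partial sum. -/
lemma neg_sum_range_le_blockSum (z : Σ k : ℕ, (Fin k → 𝒳)) (u : ℕ → Ω) {p : ℕ} (hp : p ≤ z.1) :
    -∑ i ∈ Finset.range p, q (letter x₀ i z) (u i)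
      ≤ blockSum q x₀ (fun t => max t 0) z u - blockSum q x₀ id z u := by
  have h1 : blockSum q x₀ (fun t => max t 0) z u - blockSum q x₀ id z u
      = blockSum q x₀ (fun t => max (-t) 0) z u := by
    rw [blockSum_id]; ring
  rw [h1, ← Finset.sum_neg_distrib]
  exact (Finset.sum_le_sum fun _ _ => le_max_left _ _).trans
    (Finset.sum_le_sum_of_subset_of_nonneg (Finset.range_mono hp)
      fun _ _ _ => le_max_right _ _)

/-- The walk is dominated by the perturbed walk of its cycle sums. -/
lemma sum_increments_le {ω : Ω} (hT : StrictMono fun n => T n ω) (u : ℕ → ℕ → Ω) (n : ℕ) :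
    ∃ m, ∑ i ∈ Finset.range n, increments X T q x₀ ω u i
      ≤ initialSum X T q x₀ (fun t => max t 0) (ω, u)
        + perturbedSum m (fun j => cycleSums X T q x₀ j (ω, u)) := by
  have h0 : ∀ z (u : ℕ → Ω), 0 ≤ blockSum q x₀ (fun t => max t 0) z u :=
    blockSum_nonneg fun t => le_max_right _ _
  rcases Nat.eq_zero_or_pos n with rfl | hn
  · refine ⟨0, ?_⟩
    have h1 := h0 (cycle X T 0 ω) (u 0)
    have h2 := h0 (cycle X T 1 ω) (u 1)
    simp only [Finset.range_zero, Finset.sum_empty, perturbedSum, zero_add]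
    exact add_nonneg h1 h2
  · obtain ⟨i, hi, hle⟩ := exists_position hT hn
    set j := cycleIndex (fun n => T n ω) n
    rw [hi, add_assoc, sum_increments_eq hT u j (1 + i) (by omega)]
    have hp := sum_range_le_blockSum (q := q) (x₀ := x₀) (cycle X T j ω) (u j) (p := 1 + i)
      (by change 1 + i ≤ cycleLength T j ω; rw [cycleLength_eq]; omega)
    -- Inside the initial cycle index 0 works because V_0 ≥ 0. Inside cycle l + 1 the l finished
    -- regular cycles contribute their D and the current one at most V_l.
    rcases hj : j with _ | l
    · refine ⟨0, ?_⟩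
      rw [hj] at hp
      have h2 := h0 (cycle X T 1 ω) (u 1)
      simp only [Finset.range_zero, Finset.sum_empty, perturbedSum, zero_add]
      exact hp.trans (le_add_of_nonneg_right h2)
    · refine ⟨l, ?_⟩
      rw [hj] at hp
      rw [sum_blockSum_succ, perturbedSum, add_assoc]
      refine add_le_add (blockSum_le_blockSum (fun t => le_max_left _ _) _ _) ?_
      exact add_le_add le_rfl hp

/-- A lower bound for the walk inside the cycle `m + 1`. -/
lemma neg_sum_increments_le {ω : Ω} (hT : StrictMono fun n => T n ω) (u : ℕ → ℕ → Ω) {n m : ℕ}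
    (hm : cycleIndex (fun n => T n ω) (n + 1) = m + 1) :
    -∑ i ∈ Finset.range n, increments X T q x₀ ω u i
      ≤ -initialSum X T q x₀ id (ω, u)
        + perturbedSum m (fun j => (-(cycleSums X T q x₀ j (ω, u)).1,
          (cycleSums X T q x₀ j (ω, u)).2 - (cycleSums X T q x₀ j (ω, u)).1)) := by
  obtain ⟨i, hi, hle⟩ := exists_position hT (n := n + 1) (by omega)
  rw [hm] at hi hle
  have hn : n = startTime (fun n => T n ω) (m + 1) + i := by omega
  rw [hn, sum_increments_eq hT u (m + 1) i (by omega), sum_blockSum_succ]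
  have hp := neg_sum_range_le_blockSum (q := q) (x₀ := x₀) (cycle X T (m + 1) ω) (u (m + 1))
    (p := i) (by change i ≤ cycleLength T (m + 1) ω; rw [cycleLength_eq]; omega)
  simp only [perturbedSum, Finset.sum_neg_distrib]
  have h3 : (cycleSums X T q x₀ m (ω, u)).2 - (cycleSums X T q x₀ m (ω, u)).1
      = blockSum q x₀ (fun t => max t 0) (cycle X T (m + 1) ω) (u (m + 1))
        - blockSum q x₀ id (cycle X T (m + 1) ω) (u (m + 1)) := rfl
  rw [h3]
  linarith

variable [MeasurableSpace Ω] [MeasurableSpace 𝒳] {μ : Measure Ω}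

lemma measurable_initialSum (hX : IsRegenerative μ X T)
    (hq : Measurable fun p : 𝒳 × Ω => q p.1 p.2) {φ : ℝ → ℝ} (hφ : Measurable φ) :
    Measurable (initialSum X T q x₀ φ) := measurable_blockSum_cycle hX hq hφ 0

lemma measurable_cycleSums (hX : IsRegenerative μ X T)
    (hq : Measurable fun p : 𝒳 × Ω => q p.1 p.2) (j : ℕ) :
    Measurable (cycleSums X T q x₀ j) :=
  (measurable_blockSum_cycle hX hq measurable_id (j + 1)).prodMk
    (measurable_blockSum_cycle hX hq (by fun_prop) (j + 1))

lemma measurable_blockSum_pair (hq : Measurable fun p : 𝒳 × Ω => q p.1 p.2) :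
    Measurable fun p : (Σ k : ℕ, (Fin k → 𝒳)) × (ℕ → Ω) =>
      (blockSum q x₀ id p.1 p.2, blockSum q x₀ (fun t => max t 0) p.1 p.2) :=
  (measurable_blockSum hq x₀ measurable_id).prodMk
    (measurable_blockSum hq x₀ (φ := fun t => max t 0) (by fun_prop))

variable [IsProbabilityMeasure μ]

lemma iIndepFun_cycleSums (hX : IsRegenerative μ X T)
    (hq : Measurable fun p : 𝒳 × Ω => q p.1 p.2) :
    iIndepFun (cycleSums X T q x₀) (μ.prod (noiseLaw μ)) :=
  ((iIndepFun_pair (measurable_cycle hX.measurable_process hX.measurable_time)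
    hX.indep).precomp Nat.succ_injective).comp (fun _ p => (blockSum q x₀ id p.1 p.2,
      blockSum q x₀ (fun t => max t 0) p.1 p.2)) fun _ => measurable_blockSum_pair hq

lemma identDistrib_cycleSums (hX : IsRegenerative μ X T)
    (hq : Measurable fun p : 𝒳 × Ω => q p.1 p.2) (j : ℕ) :
    IdentDistrib (cycleSums X T q x₀ j) (cycleSums X T q x₀ 0) (μ.prod (noiseLaw μ))
      (μ.prod (noiseLaw μ)) := by
  have hZ := measurable_cycle hX.measurable_process hX.measurable_time
  have hm : ∀ j, Measurable fun p : Ω × (ℕ → ℕ → Ω) => (cycle X T j p.1, p.2 j) := fun j =>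
    ((hZ j).comp measurable_fst).prodMk ((measurable_pi_apply j).comp measurable_snd)
  have h1 : IdentDistrib (fun p : Ω × (ℕ → ℕ → Ω) => (cycle X T (j + 1) p.1, p.2 (j + 1)))
      (fun p => (cycle X T 1 p.1, p.2 1)) (μ.prod (noiseLaw μ)) (μ.prod (noiseLaw μ)) :=
    ⟨(hm _).aemeasurable, (hm _).aemeasurable, by
      rw [map_pair _ (hZ _), map_pair _ (hZ _), (hX.identDistrib (j + 1) (by omega)).map_eq]⟩
  exact h1.comp (measurable_blockSum_pair (x₀ := x₀) hq)

lemma indepFun_initialSum_cycleSums (hX : IsRegenerative μ X T)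
    (hq : Measurable fun p : 𝒳 × Ω => q p.1 p.2) {φ : ℝ → ℝ} (hφ : Measurable φ) :
    IndepFun (initialSum X T q x₀ φ) (fun p j => cycleSums X T q x₀ j p)
      (μ.prod (noiseLaw μ)) := by
  have hZ := measurable_cycle hX.measurable_process hX.measurable_time
  have hm : ∀ j, Measurable fun p : Ω × (ℕ → ℕ → Ω) => (cycle X T j p.1, p.2 j) := fun j =>
    ((hZ j).comp measurable_fst).prodMk ((measurable_pi_apply j).comp measurable_snd)
  have h1 := indepFun_zero_succ hm (iIndepFun_pair hZ hX.indep)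
  exact h1.comp (measurable_blockSum hq x₀ hφ) (measurable_pi_lambda _ fun j =>
    (measurable_blockSum_pair (x₀ := x₀) hq).comp (measurable_pi_apply j))

/-- The perturbed walk of cycle sums started from an independent asymptotically negligible
variable. -/
lemma AsympLE.initialSum_add_perturbedSum (hX : IsRegenerative μ X T)
    (hq : Measurable fun p : 𝒳 × Ω => q p.1 p.2) {H : Measure ℝ} [IsProbabilityMeasure H]
    (hH : IsSubexpTail H) {K : ℝ≥0}
    (h0 : AsympLE (fun y => H (Set.Ioi y))
      (fun y => (μ.prod (noiseLaw μ)) {p | y < initialSum X T q x₀ (fun t => max t 0) p}) 0)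
    (hK : AsympLE (fun y => H (Set.Ioi y)) (fun y => (μ.prod (noiseLaw μ))
      {p | ∃ n, y < perturbedSum n (fun j => cycleSums X T q x₀ j p)}) K) :
    AsympLE (fun y => H (Set.Ioi y)) (fun y => (μ.prod (noiseLaw μ))
      {p | ∃ n, y < initialSum X T q x₀ (fun t => max t 0) p
        + perturbedSum n (fun j => cycleSums X T q x₀ j p)}) K := by
  have hm0 : Measurable (initialSum X T q x₀ fun t => max t 0) :=
    measurable_initialSum hX hq (by fun_prop)
  have hmW : Measurable fun p j => cycleSums X T q x₀ j p :=
    measurable_seq (measurable_cycleSums hX hq)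
  set ν := (μ.prod (noiseLaw μ)).map (initialSum X T q x₀ fun t => max t 0)
  have hνp : IsProbabilityMeasure ν := Measure.isProbabilityMeasure_map hm0.aemeasurable
  have hν : AsympLE (fun y => H (Set.Ioi y)) (fun y => ν (Set.Ioi y)) 0 := by
    refine h0.mono (Eventually.of_forall fun y => ?_)
    rw [Measure.map_apply hm0 measurableSet_Ioi]
    exact le_rfl
  have h1 := AsympLE.lintegral_sub hH (fun y => prob_le_one) hK hν
  rw [measure_univ, ENNReal.toNNReal_one, zero_add, mul_one, add_zero] at h1
  refine h1.mono (Eventually.of_forall fun y => le_of_eq ?_)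
  have hE : MeasurableSet {p : ℝ × (ℕ → ℝ × ℝ) | ∃ n, y < p.1 + perturbedSum n p.2} := by
    rw [Set.ofPred_exists]
    exact MeasurableSet.iUnion fun n => measurableSet_lt measurable_const
      (measurable_fst.add ((measurable_perturbedSum n).comp measurable_snd))
  have h2 := measure_indepFun_eq_lintegral hm0 hmW
    (indepFun_initialSum_cycleSums hX hq (by fun_prop)) hE
  refine h2.trans ?_
  rw [lintegral_map _ hm0]
  · refine lintegral_congr fun p => ?_
    simp only [Set.mem_ofPred_eq, sub_lt_iff_lt_add']
  · have : Antitone fun z => (μ.prod (noiseLaw μ))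
        {p | ∃ n, z < perturbedSum n (fun j => cycleSums X T q x₀ j p)} := fun z z' hzz =>
      measure_mono fun p ⟨n, hn⟩ => ⟨n, hzz.trans_lt hn⟩
    exact this.measurable.comp (measurable_const.sub measurable_id)

lemma measure_passage_le (hX : IsRegenerative μ X T)
    (hq : Measurable fun p : 𝒳 × Ω => q p.1 p.2) (N : Ω → Set ℕ) (y : ℝ) :
    ∫⁻ ω, noiseLaw μ {u | increments X T q x₀ ω u ∈ firstPassage (N ω) y} ∂μ
      ≤ (μ.prod (noiseLaw μ)) {p | ∃ n, y < initialSum X T q x₀ (fun t => max t 0) p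
        + perturbedSum n (fun j => cycleSums X T q x₀ j p)} := by
  have hE : MeasurableSet {p | ∃ n, y < initialSum X T q x₀ (fun t => max t 0) p
        + perturbedSum n (fun j => cycleSums X T q x₀ j p)} := by
    rw [Set.ofPred_exists]
    exact MeasurableSet.iUnion fun n => measurableSet_lt measurable_const
      ((measurable_initialSum hX hq (by fun_prop)).add
        (measurable_perturbedSum_seq (measurable_cycleSums hX hq) n))
  rw [Measure.prod_apply hE]
  refine lintegral_mono_ae ?_
  filter_upwards [hX.strictMono] with ω hω
  refine measure_mono fun u ⟨n, _, hn, _⟩ => ?_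
  obtain ⟨m, hm⟩ := sum_increments_le (q := q) (x₀ := x₀) (X := X) hω u (n + 1)
  exact ⟨m, hn.trans_le hm⟩

end CycleSums

/-! ### The lower bound -/

/-- One big jump from a past below the level produces a first passage. -/
lemma mul_tsum_le_firstPassage (m : ℕ → Measure ℝ) [∀ n, IsProbabilityMeasure (m n)] {N : Set ℕ}
    {l : ℕ → ℝ} {y : ℝ} {G : Set (ℕ → ℝ)}
    (hG : ∀ s ∈ G, ∀ n ∈ N, (∀ k ≤ n, ∑ i ∈ Finset.range k, s i ≤ y) ∧
      -l n ≤ ∑ i ∈ Finset.range n, s i) :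
    (Measure.infinitePi m) G * ∑' n, N.indicator (fun n => m n (Set.Ioi (y + l n))) n
      ≤ (Measure.infinitePi m) (firstPassage N y) := by
  classical
  set κ := Measure.infinitePi m
  set past : ℕ → Set (ℕ → ℝ) := fun n => {s | (∀ k ≤ n, ∑ i ∈ Finset.range k, s i ≤ y) ∧
    -l n ≤ ∑ i ∈ Finset.range n, s i}
  have hsum : ∀ k, Measurable fun s : ℕ → ℝ => ∑ i ∈ Finset.range k, s i := fun k =>
    Finset.measurable_sum (Finset.range k) fun i _ => measurable_pi_apply i
  have hpast : ∀ n, MeasurableSet (past n) := fun n => by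
    have : past n = (⋂ k, ⋂ (_ : k ≤ n), {s | ∑ i ∈ Finset.range k, s i ≤ y}) ∩
        {s | -l n ≤ ∑ i ∈ Finset.range n, s i} := by
      ext s; simp [past]
    rw [this]
    exact (MeasurableSet.iInter fun k => MeasurableSet.iInter fun _ =>
      measurableSet_le (hsum k) measurable_const).inter
        (measurableSet_le measurable_const (hsum n))
  set jump : ℕ → Set (ℕ → ℝ) := fun n => {s | s n ∈ Set.Ioi (y + l n)}
  have hjump : ∀ n, MeasurableSet (jump n) := fun n => measurable_pi_apply n measurableSet_Ioi
  have hprod : ∀ n, κ (past n ∩ jump n) = κ (past n) * m n (Set.Ioi (y + l n)) := by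
    intro n
    have hind : iIndepFun (fun (i : ℕ) (s : ℕ → ℝ) => s i) κ :=
      iIndepFun_infinitePi (X := fun _ x => x) fun _ => measurable_id
    have h1 := hind.indepFun_finset (Finset.range n) {n} (by simp)
      fun i => measurable_pi_apply i
    set e : (Finset.range n → ℝ) → ℕ → ℝ := fun r i => if h : i ∈ Finset.range n then r ⟨i, h⟩ else 0
    have he : Measurable e := by
      refine measurable_pi_lambda _ fun i => ?_
      by_cases h : i ∈ Finset.range n
      · simp only [e, dif_pos h]
        exact measurable_pi_apply _
      · simp only [e, dif_neg h]
        exact measurable_const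
    have h2 := h1.measure_inter_preimage_eq_mul (e ⁻¹' past n)
      ((fun r => r ⟨n, Finset.mem_singleton_self n⟩) ⁻¹' Set.Ioi (y + l n)) (he (hpast n))
      (measurable_pi_apply _ measurableSet_Ioi)
    have h3 : (fun (s : ℕ → ℝ) (i : Finset.range n) => s i) ⁻¹' (e ⁻¹' past n) = past n := by
      ext s
      have hs : ∀ k ≤ n, ∑ i ∈ Finset.range k, e (fun i => s i) i = ∑ i ∈ Finset.range k, s i :=
        fun k hk => Finset.sum_congr rfl fun i hi => by
          have : i < n := (Finset.mem_range.1 hi).trans_le hk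
          simp [e, this]
      simp only [past, Set.mem_preimage, Set.mem_ofPred_eq, hs n le_rfl]
      exact and_congr_left fun _ => forall₂_congr fun k hk => by rw [hs k hk]
    rw [h3] at h2
    refine h2.trans ?_
    congr 1
    rw [← Measure.infinitePi_map_eval m n, Measure.map_apply (measurable_pi_apply n)
      measurableSet_Ioi]
    rfl
  -- A jump at a lifts the partial sum of length a + 1 above y, contrary to the past required at any
  -- later b.
  have hdisj : Pairwise (Function.onFun Disjoint fun n : N => past n ∩ jump n) := by
    intro a b hab
    wlog h : (a : ℕ) < b generalizing a b
    · exact (this hab.symm (lt_of_le_of_ne (not_lt.1 h) fun h' => hab (Subtype.ext h'.symm))).symm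
    refine Set.disjoint_left.2 fun s hs hs' => ?_
    have h1 := hs'.1.1 (a + 1) h
    have h2 := hs.1.2
    have h3 : y + l a < s a := hs.2
    rw [Finset.sum_range_succ] at h1
    linarith
  calc κ G * ∑' n, N.indicator (fun n => m n (Set.Ioi (y + l n))) n
      = ∑' n : N, κ G * m n (Set.Ioi (y + l n)) := by
        rw [← ENNReal.tsum_mul_left, tsum_subtype N fun n => κ G * m n (Set.Ioi (y + l n))]
        refine tsum_congr fun n => ?_
        by_cases hn : n ∈ N <;> simp [hn]
    _ ≤ ∑' n : N, κ (past n ∩ jump n) := by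
        refine ENNReal.tsum_le_tsum fun n => ?_
        rw [hprod]
        gcongr
        exact fun s hs => hG s hs n n.2
    _ = κ (⋃ n : N, past n ∩ jump n) :=
        (measure_iUnion hdisj fun n => (hpast n).inter (hjump n)).symm
    _ ≤ κ (firstPassage N y) := by
        refine measure_mono (Set.iUnion_subset fun n s hs => ⟨n, n.2, ?_, hs.1.1⟩)
        have h2 := hs.1.2
        have h3 : y + l n < s n := hs.2
        rw [Finset.sum_range_succ]
        linarith

/-! ### The corridor and the conditional lower bound given the modulating process. -/

section LowerBound

variable {Ω 𝒳 : Type*} {X : ℕ → Ω → 𝒳} {T : ℕ → Ω → ℕ} {q : 𝒳 → Ω → ℝ} {x₀ : 𝒳}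

/-- Pairs (cycle, position) are mapped injectively to times after `T 0 ω`. The index is lowered by
one because the initial cycle has number 0 and j counts regular cycles. -/
lemma tsum_wordSum_le {ω : Ω} (hT : StrictMono fun n => T n ω) (h : ℕ → 𝒳 → ℝ≥0∞) :
    ∑' j, wordSum x₀ (h j) (cycle X T (j + 1) ω)
      ≤ ∑' n, {n | T 0 ω ≤ n}.indicator
        (fun n => h (cycleIndex (fun n => T n ω) (n + 1) - 1) (X (n + 1) ω)) n := by
  set f : ℕ → ℝ≥0∞ := {n | T 0 ω ≤ n}.indicator
    (fun n => h (cycleIndex (fun n => T n ω) (n + 1) - 1) (X (n + 1) ω))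
  set φ : (Σ j : ℕ, Fin (cycleLength T (j + 1) ω)) → ℕ := fun σ => T σ.1 ω + σ.2
  have hind : ∀ σ, cycleIndex (fun n => T n ω) (φ σ + 1) = σ.1 + 1 := by
    intro σ
    have h1 := σ.2.2
    have h2 : cycleLength T (σ.1 + 1) ω = T (σ.1 + 1) ω - T σ.1 ω := rfl
    have h3 := cycleIndex_eq hT (j := σ.1 + 1) (i := σ.2) (by simp only [startTime]; omega)
    simp only [startTime] at h3
    rw [add_right_comm] at h3
    exact h3
  have hinj : Function.Injective φ := by
    rintro ⟨j, i⟩ ⟨j', i'⟩ hσ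
    have h1 := hind ⟨j, i⟩
    rw [hσ, hind ⟨j', i'⟩] at h1
    obtain rfl : j' = j := by simpa using h1
    have : (i : ℕ) = i' := by simpa [φ] using hσ
    rw [Fin.ext this]
  calc ∑' j, wordSum x₀ (h j) (cycle X T (j + 1) ω) = ∑' σ, f (φ σ) := by
        rw [ENNReal.tsum_sigma']
        refine tsum_congr fun j => ?_
        rw [tsum_fintype, wordSum]
        change ∑ i ∈ Finset.range (cycleLength T (j + 1) ω), _ = _
        rw [Finset.sum_range]
        refine Finset.sum_congr rfl fun i _ => ?_
        have hmem : φ ⟨j, i⟩ ∈ {n | T 0 ω ≤ n} :=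
          (hT.monotone (Nat.zero_le j)).trans (Nat.le_add_right _ _)
        have hf : f (φ ⟨j, i⟩) = h (cycleIndex (fun n => T n ω) (φ ⟨j, i⟩ + 1) - 1)
            (X (φ ⟨j, i⟩ + 1) ω) := Set.indicator_of_mem hmem _
        rw [hf, hind, letter_cycle i.2]
        simp only [startTime, φ, Nat.add_sub_cancel, add_right_comm]
    _ ≤ ∑' n, f n := ENNReal.tsum_comp_le_tsum_of_injective hinj f

/-- The array configurations for which the walk stays below `y` and above the line
`-K - m d'` until and inside the `m + 1`-st cycle. -/
def corridor (X : ℕ → Ω → 𝒳) (T : ℕ → Ω → ℕ) (q : 𝒳 → Ω → ℝ) (x₀ : 𝒳) (y K d' : ℝ) :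
    Set (Ω × (ℕ → ℕ → Ω)) :=
  {p | (∀ m, initialSum X T q x₀ (fun t => max t 0) p
      + perturbedSum m (fun j => cycleSums X T q x₀ j p) ≤ y) ∧
    ∀ m : ℕ, -initialSum X T q x₀ id p + perturbedSum m (fun j => (-(cycleSums X T q x₀ j p).1,
      (cycleSums X T q x₀ j p).2 - (cycleSums X T q x₀ j p).1)) - m * d' ≤ K}

variable [MeasurableSpace Ω] [MeasurableSpace 𝒳] {μ : Measure Ω} {P : Kernel 𝒳 ℝ}

lemma measurable_perturbedSum_neg (hX : IsRegenerative μ X T)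
    (hq : Measurable fun p : 𝒳 × Ω => q p.1 p.2) (m : ℕ) :
    Measurable fun p => perturbedSum m (fun j => (-(cycleSums X T q x₀ j p).1,
      (cycleSums X T q x₀ j p).2 - (cycleSums X T q x₀ j p).1)) :=
  measurable_perturbedSum_seq (fun j => (measurable_cycleSums hX hq j).fst.neg.prodMk
    ((measurable_cycleSums hX hq j).snd.sub (measurable_cycleSums hX hq j).fst)) m

lemma measurableSet_corridor (hX : IsRegenerative μ X T)
    (hq : Measurable fun p : 𝒳 × Ω => q p.1 p.2) (y K d' : ℝ) :
    MeasurableSet (corridor X T q x₀ y K d') := by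
  rw [corridor, Set.ofPred_and, Set.ofPred_forall, Set.ofPred_forall]
  refine (MeasurableSet.iInter fun m => measurableSet_le ((measurable_initialSum hX hq
    (by fun_prop)).add (measurable_perturbedSum_seq (measurable_cycleSums hX hq) m))
    measurable_const).inter (MeasurableSet.iInter fun m => measurableSet_le
    (((measurable_initialSum hX hq measurable_id).neg.add
      (measurable_perturbedSum_neg hX hq m)).sub_const _) measurable_const)

variable [IsProbabilityMeasure μ]

/-- Both walls come from the strong law. The D have mean -d < 0, so the dominating perturbed walk is
bounded above. The -D, perturbed by V - D, have mean d < d' and stay below a line of slope d'. Each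
wall gets δ/2. -/
lemma exists_corridor_compl_le (hX : IsRegenerative μ X T)
    (hq : Measurable fun p : 𝒳 × Ω => q p.1 p.2)
    (hD : Integrable (fun p => (cycleSums X T q x₀ 0 p).1) (μ.prod (noiseLaw μ)))
    (hV : Integrable (fun p => (cycleSums X T q x₀ 0 p).2) (μ.prod (noiseLaw μ))) {d d' : ℝ}
    (hd : 0 < d) (hdd : d < d')
    (hmean : ∫ p, (cycleSums X T q x₀ 0 p).1 ∂(μ.prod (noiseLaw μ)) = -d) {δ : ℝ≥0} (hδ : 0 < δ) :
    ∃ R : ℝ, 0 ≤ R ∧ ∀ y, R ≤ y →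
      (μ.prod (noiseLaw μ)) (corridor X T q x₀ y R d')ᶜ ≤ δ := by
  have hW := measurable_cycleSums (x₀ := x₀) hX hq
  have hind : Pairwise fun i j => IndepFun (cycleSums X T q x₀ i) (cycleSums X T q x₀ j)
      (μ.prod (noiseLaw μ)) := fun i j hij => (iIndepFun_cycleSums hX hq).indepFun hij
  have hid := identDistrib_cycleSums (x₀ := x₀) hX hq
  have hneg : Measurable fun w : ℝ × ℝ => -w.1 := measurable_fst.neg
  have hsub : Measurable fun w : ℝ × ℝ => w.2 - w.1 := measurable_snd.sub measurable_fst
  have h1 := ae_bddAbove_linear (U := fun j p => (cycleSums X T q x₀ j p).1)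
    (Y := fun j p => (cycleSums X T q x₀ j p).2)
    (fun i j hij => (hind hij).comp measurable_fst measurable_fst)
    (fun i j hij => (hind hij).comp measurable_snd measurable_snd)
    (fun j => (hid j).comp measurable_fst) (fun j => (hid j).comp measurable_snd) hD hV
    (c := 0) (by rw [hmean]; linarith)
  have h2 := ae_bddAbove_linear (U := fun j p => -(cycleSums X T q x₀ j p).1)
    (Y := fun j p => (cycleSums X T q x₀ j p).2 - (cycleSums X T q x₀ j p).1)
    (fun i j hij => (hind hij).comp hneg hneg) (fun i j hij => (hind hij).comp hsub hsub)
    (fun j => (hid j).comp hneg) (fun j => (hid j).comp hsub) hD.neg (hV.sub hD)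
    (c := d') (by rw [integral_neg, hmean]; linarith)
  obtain ⟨R1, hR1⟩ := exists_measure_le (δ := δ / 2)
    (f := fun m p => initialSum X T q x₀ (fun t => max t 0) p
      + perturbedSum m (fun j => cycleSums X T q x₀ j p))
    (fun m => (measurable_initialSum hX hq (by fun_prop)).add (measurable_perturbedSum_seq hW m))
    (by
      filter_upwards [h1] with p ⟨M, hM⟩
      refine ⟨initialSum X T q x₀ (fun t => max t 0) p + M, ?_⟩
      rintro _ ⟨m, rfl⟩
      have := hM ⟨m, rfl⟩
      simp only [mul_zero, sub_zero] at this
      exact add_le_add le_rfl this) (by positivity)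
  obtain ⟨R2, hR2⟩ := exists_measure_le (δ := δ / 2)
    (f := fun (m : ℕ) p => -initialSum X T q x₀ id p
      + perturbedSum m (fun j => (-(cycleSums X T q x₀ j p).1,
        (cycleSums X T q x₀ j p).2 - (cycleSums X T q x₀ j p).1)) - m * d')
    (fun m => ((measurable_initialSum hX hq measurable_id).neg.add
      (measurable_perturbedSum_neg hX hq m)).sub_const _)
    (by
      filter_upwards [h2] with p ⟨M, hM⟩
      refine ⟨-initialSum X T q x₀ id p + M, ?_⟩
      rintro _ ⟨m, rfl⟩
      have := hM ⟨m, rfl⟩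
      simp only [perturbedSum] at this ⊢
      linarith) (by positivity)
  refine ⟨max 0 (max R1 R2), le_max_left _ _, fun y hy => ?_⟩
  have hle := le_max_right (0 : ℝ) (max R1 R2)
  calc (μ.prod (noiseLaw μ)) (corridor X T q x₀ y (max 0 (max R1 R2)) d')ᶜ
      ≤ (μ.prod (noiseLaw μ)) _ + (μ.prod (noiseLaw μ)) _ := by
        refine (measure_mono fun p hp => ?_).trans (measure_union_le _ _)
        by_contra hcon
        simp only [Set.mem_union, Set.mem_ofPred_eq, not_or, not_exists, not_lt] at hcon
        exact hp hcon
    _ ≤ (δ / 2 : ℝ≥0) + (δ / 2 : ℝ≥0) :=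
        add_le_add (hR1 y ((le_max_left _ _).trans (hle.trans hy)))
          (hR2 _ ((le_max_right _ _).trans hle))
    _ = δ := by rw [← ENNReal.coe_add, add_halves]

lemma corridor_mul_tsum_le [IsMarkovKernel P] (hq : Measurable fun p : 𝒳 × Ω => q p.1 p.2)
    (hlaw : ∀ x, μ.map (q x) = P x) {ω : Ω} (hT : StrictMono fun n => T n ω) (B : Set 𝒳)
    (y K d' : ℝ) :
    noiseLaw μ (Prod.mk ω ⁻¹' corridor X T q x₀ y K d') * ∑' j : ℕ, wordSum x₀
        (B.indicator fun x => P x (Set.Ioi (y + K + j * d'))) (cycle X T (j + 1) ω)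
      ≤ noiseLaw μ {u | increments X T q x₀ ω u ∈ firstPassage {n | X (n + 1) ω ∈ B} y} := by
  have hm := measurable_increments (X := X) (T := T) (x₀ := x₀) hq ω
  set J : ℕ → ℕ := fun n => cycleIndex (fun n => T n ω) (n + 1) - 1
  set N : Set ℕ := {n | X (n + 1) ω ∈ B ∧ T 0 ω ≤ n}
  set l : ℕ → ℝ := fun n => K + J n * d'
  set G : Set (ℕ → ℝ) := {s | ∀ n ∈ N, (∀ k ≤ n, ∑ i ∈ Finset.range k, s i ≤ y) ∧
      -l n ≤ ∑ i ∈ Finset.range n, s i}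
  have h1 := mul_tsum_le_firstPassage (fun n => P (X (n + 1) ω)) (N := N) (l := l) (y := y)
    (G := G) fun s hs => hs
  rw [← map_increments (x₀ := x₀) hq hlaw hT,
    Measure.map_apply hm (measurableSet_firstPassage _ _)] at h1
  refine le_trans ?_ (h1.trans (measure_mono fun u ⟨n, hn, h⟩ => ⟨n, hn.1, h⟩))
  refine mul_le_mul' ?_ ?_
  -- Only an inequality is needed, so `G` need not be measurable.
  · refine (measure_mono fun u hu => ?_).trans (Measure.le_map_apply hm.aemeasurable G)
    intro n hn
    have hJ : cycleIndex (fun n => T n ω) (n + 1) = J n + 1 := by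
      obtain ⟨i, hi, hle⟩ := exists_position hT (n := n + 1) (by omega)
      have : cycleIndex (fun n => T n ω) (n + 1) ≠ 0 := fun h0 => by
        rw [h0] at hle
        have := hn.2
        omega
      simp only [J]
      omega
    refine ⟨fun k _ => ?_, ?_⟩
    · obtain ⟨m, hm'⟩ := sum_increments_le (q := q) (x₀ := x₀) (X := X) hT u k
      exact hm'.trans (hu.1 m)
    · have h2 := neg_sum_increments_le (q := q) (x₀ := x₀) (X := X) hT u hJ
      have h3 := hu.2 (J n)
      simp only [l]
      linarith
  · refine (tsum_wordSum_le hT fun j => B.indicator fun x => P x (Set.Ioi (y + K + j * d'))).trans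
      (le_of_eq (tsum_congr fun n => ?_))
    by_cases h1 : T 0 ω ≤ n <;> by_cases h2 : X (n + 1) ω ∈ B <;>
      simp [N, l, J, h1, h2, add_assoc]

end LowerBound

/-! ### Averaging the conditional lower bound over the modulating process. -/

section Integrate

variable {Ω 𝒳 : Type*} {X : ℕ → Ω → 𝒳} {T : ℕ → Ω → ℕ} {q : 𝒳 → Ω → ℝ} {x₀ : 𝒳}
  [MeasurableSpace Ω] [MeasurableSpace 𝒳] {μ : Measure Ω} [IsProbabilityMeasure μ]
  {P : Kernel 𝒳 ℝ}

omit [IsProbabilityMeasure μ] in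
lemma IsRegenerative.lintegral_large_eq (hX : IsRegenerative μ X T) (n j : ℕ) :
    ∫⁻ ω in {ω | n < cycleLength T (j + 1) ω}, (cycleLength T (j + 1) ω : ℝ≥0∞) ∂μ
      = ∫⁻ ω in {ω | n < cycleLength T 1 ω}, (cycleLength T 1 ω : ℝ≥0∞) ∂μ := by
  have hm := measurable_cycleLength hX.measurable_time
  have hf : Measurable fun z : Σ k : ℕ, (Fin k → 𝒳) =>
      {k : ℕ | n < k}.indicator (fun k => (k : ℝ≥0∞)) z.1 :=
    (measurable_from_top (f := {k : ℕ | n < k}.indicator fun k => (k : ℝ≥0∞))).comp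
      measurable_wordLength
  have h1 := ((hX.identDistrib (j + 1) (by omega)).comp hf).lintegral_eq
  rw [← lintegral_indicator (measurableSet_natCast_lt (hm (j + 1)) n),
    ← lintegral_indicator (measurableSet_natCast_lt (hm 1) n)]
  exact h1

/-- The corridor depends on the cycle lengths, so the expectation does not factor. Lengths up to n
cost n times the probability of leaving the corridor; longer ones have a small mean, the same for
all j. Hence the bound is uniform in j. -/
lemma exists_lintegral_corridor_compl_le (hX : IsRegenerative μ X T)
    (hq : Measurable fun p : 𝒳 × Ω => q p.1 p.2)
    (hτ : ∫⁻ ω, (cycleLength T 1 ω : ℝ≥0∞) ∂μ ≠ ∞)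
    (hD : Integrable (fun p => (cycleSums X T q x₀ 0 p).1) (μ.prod (noiseLaw μ)))
    (hV : Integrable (fun p => (cycleSums X T q x₀ 0 p).2) (μ.prod (noiseLaw μ))) {d d' : ℝ}
    (hd : 0 < d) (hdd : d < d')
    (hmean : ∫ p, (cycleSums X T q x₀ 0 p).1 ∂(μ.prod (noiseLaw μ)) = -d) {δ : ℝ≥0} (hδ : 0 < δ) :
    ∃ R : ℝ, 0 ≤ R ∧ ∀ y, R ≤ y → ∀ j,
      ∫⁻ ω, noiseLaw μ (Prod.mk ω ⁻¹' (corridor X T q x₀ y R d')ᶜ) * cycleLength T (j + 1) ω ∂μ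
        ≤ δ := by
  have hm := measurable_cycleLength hX.measurable_time
  have h1 := (tendsto_lintegral_large (hm 1) hτ).eventually
    (Iic_mem_nhds (show (0 : ℝ≥0∞) < (δ / 2 : ℝ≥0) by
      exact_mod_cast (by positivity : (0 : ℝ≥0) < δ / 2)))
  obtain ⟨n, hn⟩ := h1.exists
  obtain ⟨R, hR0, hR⟩ := exists_corridor_compl_le hX hq hD hV hd hdd hmean
    (δ := δ / 2 / (n + 1)) (by positivity)
  refine ⟨R, hR0, fun y hy j => ?_⟩
  have hG := (measurableSet_corridor (x₀ := x₀) hX hq y R d').compl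
  have hgm := measurable_measure_prodMk_left (ν := noiseLaw μ) hG
  have hS := measurableSet_natCast_lt (hm (j + 1)) n
  have hlen : Measurable fun ω => (cycleLength T (j + 1) ω : ℝ≥0∞) :=
    measurable_from_top.comp (hm (j + 1))
  calc ∫⁻ ω, noiseLaw μ (Prod.mk ω ⁻¹' (corridor X T q x₀ y R d')ᶜ) * cycleLength T (j + 1) ω ∂μ
      ≤ ∫⁻ ω, (n * noiseLaw μ (Prod.mk ω ⁻¹' (corridor X T q x₀ y R d')ᶜ)
          + {ω | n < cycleLength T (j + 1) ω}.indicator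
            (fun ω => (cycleLength T (j + 1) ω : ℝ≥0∞)) ω) ∂μ := by
        refine lintegral_mono fun ω => ?_
        by_cases h : n < cycleLength T (j + 1) ω
        · rw [Set.indicator_of_mem (by exact h)]
          refine le_add_left ?_
          calc _ ≤ 1 * (cycleLength T (j + 1) ω : ℝ≥0∞) := by gcongr; exact prob_le_one
            _ = _ := one_mul _
        · rw [mul_comm]
          refine le_add_right ?_
          gcongr
          exact not_lt.1 h
    _ = n * (μ.prod (noiseLaw μ)) (corridor X T q x₀ y R d')ᶜ
          + ∫⁻ ω in {ω | n < cycleLength T 1 ω}, (cycleLength T 1 ω : ℝ≥0∞) ∂μ := by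
        rw [lintegral_add_left (hgm.const_mul _), lintegral_const_mul _ hgm,
          ← Measure.prod_apply hG, lintegral_indicator hS, hX.lintegral_large_eq]
    _ ≤ n * ((δ / 2 / (n + 1) : ℝ≥0) : ℝ≥0∞) + (δ / 2 : ℝ≥0) := by
        gcongr
        exact hR y hy
    _ ≤ δ := by
        have : (n : ℝ≥0) * (δ / 2 / (n + 1)) + δ / 2 ≤ δ := by
          have h2 : (n : ℝ≥0) * (δ / 2 / (n + 1)) ≤ δ / 2 := by
            rw [mul_div_assoc', div_le_iff₀ (by positivity), mul_comm]
            gcongr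
            exact le_self_add
          calc _ ≤ δ / 2 + δ / 2 := by gcongr
            _ = δ := add_halves δ
        exact_mod_cast this

omit [IsProbabilityMeasure μ] in
lemma IsRegenerative.lintegral_wordSum_indicator (hX : IsRegenerative μ X T) (x₀ : 𝒳) {B : Set 𝒳}
    (hB : MeasurableSet B) (z : ℝ) (j : ℕ) :
    ∫⁻ ω, wordSum x₀ (B.indicator fun x => P x (Set.Ioi z)) (cycle X T (j + 1) ω) ∂μ
      = (P ∘ₘ (occupation μ X T).restrict B) (Set.Ioi z) := by
  rw [← hX.lintegral_occupation x₀ ((P.measurable_coe measurableSet_Ioi).indicator hB) j,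
    lintegral_indicator hB, Measure.bind_apply measurableSet_Ioi (by fun_prop)]

/-- Passage of the level by one big jump, summed over the cycles. -/
lemma exists_tsum_le_measure_passage [IsMarkovKernel P] (hX : IsRegenerative μ X T)
    (hq : Measurable fun p : 𝒳 × Ω => q p.1 p.2) (hlaw : ∀ x, μ.map (q x) = P x)
    (hτ : ∫⁻ ω, (cycleLength T 1 ω : ℝ≥0∞) ∂μ ≠ ∞)
    (hD : Integrable (fun p => (cycleSums X T q x₀ 0 p).1) (μ.prod (noiseLaw μ)))
    (hV : Integrable (fun p => (cycleSums X T q x₀ 0 p).2) (μ.prod (noiseLaw μ))) {d d' : ℝ}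
    (hd : 0 < d) (hdd : d < d')
    (hmean : ∫ p, (cycleSums X T q x₀ 0 p).1 ∂(μ.prod (noiseLaw μ)) = -d) {F : Measure ℝ} {L : ℝ≥0}
    (hL : ∀ x y, 0 ≤ y → P x (Set.Ioi y) ≤ L * F (Set.Ioi y)) {δ : ℝ≥0} (hδ : 0 < δ) :
    ∃ K : ℝ, 0 ≤ K ∧ ∀ y, K ≤ y → ∀ B, MeasurableSet B →
      ∑' j : ℕ, (P ∘ₘ (occupation μ X T).restrict B) (Set.Ioi (y + K + j * d'))
        ≤ ∫⁻ ω, noiseLaw μ {u | increments X T q x₀ ω u ∈ firstPassage {n | X (n + 1) ω ∈ B} y} ∂μ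
          + δ * ∑' j : ℕ, F (Set.Ioi (y + K + j * d')) := by
  obtain ⟨K, hK0, hK⟩ := exists_lintegral_corridor_compl_le hX hq hτ hD hV hd hdd hmean
    (δ := δ / (L + 1)) (by positivity)
  refine ⟨K, hK0, fun y hy B hB => ?_⟩
  have hcyc := measurable_cycle hX.measurable_process hX.measurable_time
  have hG := measurableSet_corridor (x₀ := x₀) hX hq y K d'
  set g : Ω → ℝ≥0∞ := fun ω => noiseLaw μ (Prod.mk ω ⁻¹' corridor X T q x₀ y K d') with hg
  set gc : Ω → ℝ≥0∞ := fun ω => noiseLaw μ (Prod.mk ω ⁻¹' (corridor X T q x₀ y K d')ᶜ) with hgc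
  have hgm : Measurable g := measurable_measure_prodMk_left hG
  have hgcm : Measurable gc := measurable_measure_prodMk_left hG.compl
  have hsum : ∀ ω, g ω + gc ω = 1 := fun ω => by
    have := prob_add_prob_compl (μ := noiseLaw μ) (measurable_prodMk_left (x := ω) hG)
    exact this
  set W : ℕ → Ω → ℝ≥0∞ := fun j ω => wordSum x₀
    (B.indicator fun x => P x (Set.Ioi (y + K + j * d'))) (cycle X T (j + 1) ω) with hW
  have hWm : ∀ j, Measurable (W j) := fun j =>
    (measurable_wordSum ((P.measurable_coe measurableSet_Ioi).indicator hB)).comp (hcyc (j + 1))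
  have hWle : ∀ (j : ℕ) ω, W j ω ≤ L * F (Set.Ioi (y + K + j * d')) * cycleLength T (j + 1) ω := by
    intro j ω
    have hd' : 0 < d' := hd.trans hdd
    have hz : 0 ≤ y + K + j * d' := by
      have : 0 ≤ (j : ℝ) * d' := by positivity
      linarith
    refine (Finset.sum_le_card_nsmul _ _ (L * F (Set.Ioi (y + K + j * d'))) fun i _ => ?_).trans
      (le_of_eq ?_)
    · exact (Set.indicator_le_self B (fun x => P x (Set.Ioi (y + K + j * d'))) _).trans
        (hL _ _ hz)
    · rw [Finset.card_range, nsmul_eq_mul, mul_comm]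
      rfl
  -- On the complement of the corridor the word sum is replaced by L F̄ times the cycle length; the
  -- factor `L` is absorbed by the choice δ / (L + 1).
  have hterm : ∀ j : ℕ, (P ∘ₘ (occupation μ X T).restrict B) (Set.Ioi (y + K + j * d'))
      ≤ ∫⁻ ω, g ω * W j ω ∂μ + δ * F (Set.Ioi (y + K + j * d')) := by
    intro j
    rw [← hX.lintegral_wordSum_indicator x₀ hB _ j]
    calc ∫⁻ ω, W j ω ∂μ = ∫⁻ ω, (g ω * W j ω + gc ω * W j ω) ∂μ :=
          lintegral_congr fun ω => by rw [← add_mul, hsum, one_mul]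
      _ = ∫⁻ ω, g ω * W j ω ∂μ + ∫⁻ ω, gc ω * W j ω ∂μ :=
          lintegral_add_left (hgm.mul (hWm j)) _
      _ ≤ ∫⁻ ω, g ω * W j ω ∂μ + δ * F (Set.Ioi (y + K + j * d')) := by
          gcongr
          have hlen : Measurable fun ω => (cycleLength T (j + 1) ω : ℝ≥0∞) :=
            measurable_from_top.comp (measurable_cycleLength hX.measurable_time (j + 1))
          calc ∫⁻ ω, gc ω * W j ω ∂μ
              ≤ ∫⁻ ω, L * F (Set.Ioi (y + K + j * d')) * (gc ω * cycleLength T (j + 1) ω) ∂μ := by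
                refine lintegral_mono fun ω => ?_
                calc gc ω * W j ω
                    ≤ gc ω * (L * F (Set.Ioi (y + K + j * d')) * cycleLength T (j + 1) ω) := by
                      gcongr; exact hWle j ω
                  _ = _ := by ring
            _ = L * F (Set.Ioi (y + K + j * d')) * ∫⁻ ω, gc ω * cycleLength T (j + 1) ω ∂μ :=
                lintegral_const_mul _ (hgcm.mul hlen)
            _ ≤ L * F (Set.Ioi (y + K + j * d')) * (δ / (L + 1) : ℝ≥0) := by
                gcongr
                exact hK y hy j
            _ = (L * (δ / (L + 1)) : ℝ≥0) * F (Set.Ioi (y + K + j * d')) := by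
                rw [ENNReal.coe_mul]; ring
            _ ≤ δ * F (Set.Ioi (y + K + j * d')) := by
                gcongr
                rw [mul_div_assoc', div_le_iff₀ (by positivity), mul_comm]
                gcongr
                exact le_self_add
  calc ∑' j : ℕ, (P ∘ₘ (occupation μ X T).restrict B) (Set.Ioi (y + K + j * d'))
      ≤ ∑' j : ℕ, (∫⁻ ω, g ω * W j ω ∂μ + δ * F (Set.Ioi (y + K + j * d'))) :=
        ENNReal.tsum_le_tsum hterm
    _ = ∫⁻ ω, g ω * ∑' j, W j ω ∂μ + δ * ∑' j : ℕ, F (Set.Ioi (y + K + j * d')) := by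
        have h1 : ∀ j, AEMeasurable (fun ω => g ω * W j ω) μ := fun j =>
          (hgm.mul (hWm j)).aemeasurable
        rw [ENNReal.tsum_add, ENNReal.tsum_mul_left, ← lintegral_tsum h1]
        simp only [ENNReal.tsum_mul_left]
    _ ≤ _ := by
        gcongr ?_ + _
        refine lintegral_mono_ae ?_
        filter_upwards [hX.strictMono] with ω hω
        exact corridor_mul_tsum_le hq hlaw hω B y K d'

end Integrate

/-! ### Asymptotics of the lower bound -/

/-- The sum d ∑ F̄(y + K + j d) lies between the integrated tails at y + K and at y + K - d;
long-tailedness of `H` controls both shifts. -/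
lemma eventually_le_of_tsum_le {H F : Measure ℝ} [IsProbabilityMeasure H] (hH : IsSubexpTail H)
    [IsProbabilityMeasure F] (hF : ∀ y, F (Set.Ioi y) ≠ 0)
    (hFH : ∀ᶠ y in atTop, intTail F y = H (Set.Ioi y))
    {p Ψ : ℝ → ℝ≥0∞} {C : ℝ≥0}
    (hΨ : Tendsto (fun y => Ψ y / F (Set.Ioi y)) atTop (𝓝 C)) {d : ℝ≥0} (hd : 0 < d)
    (hp : ∀ δ : ℝ≥0, 0 < δ → ∃ K : ℝ, 0 ≤ K ∧ ∀ y, K ≤ y →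
      ∑' j : ℕ, Ψ (y + K + j * d) ≤ p y + δ * ∑' j : ℕ, F (Set.Ioi (y + K + j * d)))
    {ε : ℝ≥0} (hε : 0 < ε) :
    ∀ᶠ y in atTop, C * H (Set.Ioi y) ≤ (1 + ε : ℝ≥0) * (d * p y + ε * H (Set.Ioi y)) := by
  -- An error ε/4 enters twice, here and in replacing Ψ by C F̄. Each multiplies d ∑ F̄, at most 2
  -- H̄(y), for a total of ε H̄(y).
  obtain ⟨K, hK0, hK⟩ := hp (ε / 4) (by positivity)
  have hlow : ∀ᶠ z in atTop, C * F (Set.Ioi z) ≤ Ψ z + (ε / 4 : ℝ≥0) * F (Set.Ioi z) := by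
    rcases eq_or_ne C 0 with rfl | hC
    · simp
    have hlt : (C : ℝ≥0∞) - (ε / 4 : ℝ≥0) < C :=
      ENNReal.sub_lt_self ENNReal.coe_ne_top (by simpa using hC)
        (by simpa using (by positivity : (0 : ℝ≥0) < ε / 4).ne')
    filter_upwards [hΨ.eventually (lt_mem_nhds hlt)] with z hz
    have h1 : (C : ℝ≥0∞) ≤ Ψ z / F (Set.Ioi z) + (ε / 4 : ℝ≥0) := tsub_le_iff_right.1 hz.le
    calc C * F (Set.Ioi z) ≤ (Ψ z / F (Set.Ioi z) + (ε / 4 : ℝ≥0)) * F (Set.Ioi z) := by gcongr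
      _ = _ := by rw [add_mul, ENNReal.div_mul_cancel (hF z) (measure_ne_top _ _)]
  have hlong := hH.long K ε hε
  have hshift := (tendsto_atTop_add_const_right atTop K tendsto_id).eventually hlong
  have hFK := (tendsto_atTop_add_const_right atTop K tendsto_id).eventually hFH
  have hFd := (tendsto_atTop_add_const_right atTop (K - d) tendsto_id).eventually hFH
  have hdlong := hH.long d 1 one_pos
  filter_upwards [hshift, hFK, hFd, hdlong, eventually_ge_atTop K,
    eventually_forall_ge_atTop.2 hlow] with y h1 h2 h3 h4 h5 h6
  simp only [id, add_sub_cancel_right] at h1 h2 h3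
  have hd' : (d : ℝ≥0∞) ≠ 0 := by simpa using hd.ne'
  have hsum : (d : ℝ≥0∞) * ∑' j : ℕ, F (Set.Ioi (y + K + j * d)) ≤ 2 * H (Set.Ioi y) := by
    have h7 := mul_tsum_le_lintegral (antitone_Ioi F) hd (y + (K - d))
    calc (d : ℝ≥0∞) * ∑' j : ℕ, F (Set.Ioi (y + K + j * d))
        = d * ∑' r : ℕ, F (Set.Ioi (y + (K - d) + (r + 1 : ℕ) * d)) := by
          congr 2
          ext j
          congr 2
          push_cast
          ring
      _ ≤ intTail F (y + (K - d)) := h7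
      _ = H (Set.Ioi (y + (K - d))) := h3
      _ ≤ H (Set.Ioi (y - d)) := measure_mono (Set.Ioi_subset_Ioi (by linarith))
      _ ≤ _ := h4.trans (by norm_num)
  have hmain : C * H (Set.Ioi (y + K)) ≤ d * p y + ε * H (Set.Ioi y) := by
    calc C * H (Set.Ioi (y + K)) = C * intTail F (y + K) := by rw [h2]
      _ ≤ C * (d * ∑' j : ℕ, F (Set.Ioi (y + K + j * d))) := by
          gcongr
          exact lintegral_le_mul_tsum (antitone_Ioi F) hd _
      _ = d * ∑' j : ℕ, C * F (Set.Ioi (y + K + j * d)) := by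
          rw [ENNReal.tsum_mul_left]; ring
      _ ≤ d * ∑' j : ℕ, (Ψ (y + K + j * d) + (ε / 4 : ℝ≥0) * F (Set.Ioi (y + K + j * d))) := by
          gcongr with j
          exact h6 _ (by have : 0 ≤ (j : ℝ) * d := by positivity
                         linarith)
      _ = d * (∑' j : ℕ, Ψ (y + K + j * d)
            + (ε / 4 : ℝ≥0) * ∑' j : ℕ, F (Set.Ioi (y + K + j * d))) := by
          rw [ENNReal.tsum_add, ENNReal.tsum_mul_left]
      _ ≤ d * (p y + (ε / 4 : ℝ≥0) * ∑' j : ℕ, F (Set.Ioi (y + K + j * d))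
            + (ε / 4 : ℝ≥0) * ∑' j : ℕ, F (Set.Ioi (y + K + j * d))) := by
          gcongr
          exact hK y h5
      _ = d * p y + (ε / 2 : ℝ≥0) * (d * ∑' j : ℕ, F (Set.Ioi (y + K + j * d))) := by
          have : ((ε / 2 : ℝ≥0) : ℝ≥0∞) = (ε / 4 : ℝ≥0) + (ε / 4 : ℝ≥0) := by
            rw [← ENNReal.coe_add]
            congr 1
            rw [← add_div, ← two_mul, mul_comm, mul_div_assoc, div_eq_mul_inv ε 2]
            congr 1
            norm_num
          rw [this]
          ring
      _ ≤ d * p y + (ε / 2 : ℝ≥0) * (2 * H (Set.Ioi y)) := by gcongr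
      _ = _ := by
          rw [← mul_assoc]
          congr 2
          rw [show (2 : ℝ≥0∞) = (2 : ℝ≥0) by rfl, ← ENNReal.coe_mul,
            div_mul_cancel₀ _ (by norm_num)]
  calc C * H (Set.Ioi y) ≤ C * ((1 + ε : ℝ≥0) * H (Set.Ioi (y + K))) := by gcongr
    _ = (1 + ε : ℝ≥0) * (C * H (Set.Ioi (y + K))) := by ring
    _ ≤ _ := by gcongr

/-! ### The integrated tail distribution -/

lemma ofReal_tail (κ : Measure ℝ) [IsFiniteMeasure κ] (y : ℝ) :
    ENNReal.ofReal (tail κ y) = κ (Set.Ioi y) := ofReal_measureReal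

section SecondTail

variable {F : Measure ℝ} [IsProbabilityMeasure F]

lemma intTail_zero_ne_top (hF : Integrable (fun t : ℝ => t) F) : intTail F 0 ≠ ∞ := by
  rw [intTail_eq]
  simp only [sub_zero]
  refine ne_top_of_le_ne_top hF.2.ne (lintegral_mono fun x => ?_)
  exact Real.ofReal_le_enorm x

lemma intTail_ne_top (hF : Integrable (fun t : ℝ => t) F) (y : ℝ) : intTail F y ≠ ∞ := by
  rcases le_total 0 y with h | h
  · exact ne_top_of_le_ne_top (intTail_zero_ne_top hF) (intTail_antitone F h)
  · exact ne_top_of_le_ne_top (ENNReal.add_ne_top.2 ⟨intTail_zero_ne_top hF, ENNReal.ofReal_ne_top⟩)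
      (intTail_le_add F h)

lemma setIntegral_tail (y : ℝ) : ∫ t in Set.Ioi y, tail F t = (intTail F y).toReal := by
  rw [integral_eq_lintegral_of_nonneg_ae (Eventually.of_forall fun t => tail_nonneg F t)
    (tail_antitone F).measurable.aestronglyMeasurable]
  simp only [ofReal_tail]
  rfl

lemma tendsto_intTail (hF : Integrable (fun t : ℝ => t) F) :
    Tendsto (intTail F) atTop (𝓝 0) := by
  have h1 : Tendsto (fun y => ∫⁻ x, ENNReal.ofReal (x - y) ∂F) atTop (𝓝 (∫⁻ _, 0 ∂F)) := by
    refine tendsto_lintegral_filter_of_dominated_convergence (fun x => ‖x‖ₑ) ?_ ?_ hF.2.ne ?_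
    · exact Eventually.of_forall fun y => by fun_prop
    · filter_upwards [eventually_ge_atTop 0] with y hy
      exact Eventually.of_forall fun x =>
        (ENNReal.ofReal_le_ofReal (by linarith)).trans (Real.ofReal_le_enorm x)
    · refine Eventually.of_forall fun x => tendsto_const_nhds.congr' ?_
      filter_upwards [eventually_ge_atTop x] with y hy
      exact (ENNReal.ofReal_of_nonpos (by linarith)).symm
  rw [lintegral_zero] at h1
  exact h1.congr fun y => (intTail_eq F y).symm

lemma secondTail_eq (y : ℝ) : secondTail F y = min 1 (intTail F y).toReal := by
  rw [secondTail, setIntegral_tail]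

lemma eventually_ofReal_secondTail (hF : Integrable (fun t : ℝ => t) F) :
    ∀ᶠ y in atTop, ENNReal.ofReal (secondTail F y) = intTail F y := by
  filter_upwards [(tendsto_intTail hF).eventually (ge_mem_nhds one_pos)] with y hy
  have hne := intTail_ne_top hF y
  rw [secondTail_eq, min_eq_right, ENNReal.ofReal_toReal hne]
  exact ENNReal.toReal_le_of_le_ofReal zero_le_one (by simpa using hy)

lemma tendsto_secondTail (hF : Integrable (fun t : ℝ => t) F) :
    Tendsto (secondTail F) atTop (𝓝 0) := by
  have h1 := (ENNReal.tendsto_toReal ENNReal.zero_ne_top).comp (tendsto_intTail hF)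
  have h2 := (tendsto_const_nhds (x := (1 : ℝ))).min h1
  simp only [ENNReal.toReal_zero, min_eq_right zero_le_one] at h2
  exact h2.congr fun y => (secondTail_eq y).symm

lemma secondTail_of_le_neg_one (h0 : F (Set.Iio 0) = 0) (hF : Integrable (fun t : ℝ => t) F)
    {y : ℝ} (hy : y ≤ -1) : secondTail F y = 1 := by
  rw [secondTail_eq, min_eq_left]
  have h1 : ENNReal.ofReal 1 ≤ intTail F y := by
    calc ENNReal.ofReal 1 ≤ ENNReal.ofReal (0 - y) := ENNReal.ofReal_le_ofReal (by linarith)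
      _ = ∫⁻ t in Set.Ioo y 0, F (Set.Ioi t) := by
          rw [setLIntegral_congr_fun (g := fun _ => 1) measurableSet_Ioo
            fun t ht => Ioi_of_neg h0 ht.2]
          simp
      _ ≤ intTail F y := lintegral_mono_set fun t ht => ht.1
  exact (ENNReal.ofReal_le_iff_le_toReal (intTail_ne_top hF y)).1 h1

lemma secondTailLaw_Ioi (hF : Integrable (fun t : ℝ => t) F) (y : ℝ) :
    secondTailLaw F (Set.Ioi y) = ENNReal.ofReal (secondTail F y) := by
  have h1 : Tendsto (secondTailCDF F) atTop (𝓝 1) := by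
    simpa [secondTailCDF] using (tendsto_secondTail hF).const_sub 1
  rw [secondTailLaw, StieltjesFunction.measure_Ioi _ h1]
  congr 1
  change 1 - (1 - secondTail F y) = _
  ring

lemma isProbabilityMeasure_secondTailLaw (h0 : F (Set.Iio 0) = 0)
    (hF : Integrable (fun t : ℝ => t) F) : IsProbabilityMeasure (secondTailLaw F) := by
  refine StieltjesFunction.isProbabilityMeasure _ ?_ ?_
  · refine tendsto_const_nhds.congr' ?_
    filter_upwards [eventually_le_atBot (-1)] with y hy
    change 0 = 1 - secondTail F y
    rw [secondTail_of_le_neg_one h0 hF hy, sub_self]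
  · simpa [secondTailCDF] using (tendsto_secondTail hF).const_sub 1

lemma positivePart_secondTailLaw_Ioi (hF : Integrable (fun t : ℝ => t) F) {y : ℝ} (hy : 0 ≤ y) :
    positivePart (secondTailLaw F) (Set.Ioi y) = ENNReal.ofReal (secondTail F y) := by
  rw [positivePart_Ioi _ hy, secondTailLaw_Ioi hF]

/-- Only the upper half of the limit 2 is retained; the arguments use no more. -/
lemma isSubexpTail_positivePart {κ : Measure ℝ} [IsProbabilityMeasure κ]
    (h : IsSubexponential κ) : IsSubexpTail (positivePart κ) := by
  have hpos : ∀ y, 0 < positivePart κ (Set.Ioi y) := fun y => by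
    have h1 : 0 < positivePart κ (Set.Ioi (max y 0)) := by
      rw [positivePart_Ioi _ (le_max_right _ _), ← ofReal_tail]
      exact ENNReal.ofReal_pos.2 (h.1 _)
    exact h1.trans_le (measure_mono (Set.Ioi_subset_Ioi (le_max_left _ _)))
  refine ⟨?_, hpos, fun ε hε => ?_⟩
  · rw [positivePart, Measure.map_apply (by fun_prop) measurableSet_Iio]
    have : (fun t : ℝ => max t 0) ⁻¹' Set.Iio 0 = ∅ := by
      ext t
      simp
    rw [this, measure_empty]
  · have hlt : (2 : ℝ) < 2 + ε := by simpa using hε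
    filter_upwards [h.2.eventually (gt_mem_nhds hlt)] with y hy
    have hp : 0 < tail (positivePart κ) y := ENNReal.toReal_pos (hpos y).ne' (measure_ne_top _ _)
    rw [div_lt_iff₀ hp] at hy
    rw [← ofReal_tail, ← ofReal_tail, ← ENNReal.ofReal_coe_nnreal,
      ← ENNReal.ofReal_mul (by positivity)]
    exact ENNReal.ofReal_le_ofReal (by push_cast; exact hy.le)

end SecondTail

/-! ### From little-o and ratios to extended nonnegative tails -/

lemma AsympLE.zero_of_isLittleO {f g : ℝ → ℝ} (hf : ∀ y, 0 ≤ f y) (hg : ∀ y, 0 ≤ g y)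
    (h : f =o[atTop] g) {f' g' : ℝ → ℝ≥0∞} (hf' : ∀ᶠ y in atTop, f' y = ENNReal.ofReal (f y))
    (hg' : ∀ᶠ y in atTop, g' y = ENNReal.ofReal (g y)) : AsympLE g' f' 0 := by
  intro ε hε
  filter_upwards [h.bound (show (0 : ℝ) < ε from hε), hf', hg'] with y hy h1 h2
  rw [Real.norm_of_nonneg (hf y), Real.norm_of_nonneg (hg y)] at hy
  rw [h1, h2, zero_add, ← ENNReal.ofReal_coe_nnreal, ← ENNReal.ofReal_mul (by positivity)]
  exact ENNReal.ofReal_le_ofReal hy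

/-- Ratios of two complementary parts converge if their sum has the right upper bound and each
has the right lower bound. -/
lemma tendsto_of_bounds {p p' pt h : ℝ → ℝ≥0∞} {C C' d : ℝ≥0} (hd : 0 < d)
    (hh0 : ∀ᶠ y in atTop, h y ≠ 0) (hh1 : ∀ᶠ y in atTop, h y ≠ ∞)
    (hadd : ∀ᶠ y in atTop, p y + p' y = pt y) (hup : AsympLE h pt ((C + C') / d))
    (hlow : ∀ ε : ℝ≥0, 0 < ε → ∀ᶠ y in atTop,
      C * h y ≤ (1 + ε : ℝ≥0) * ((d + ε : ℝ≥0) * p y + ε * h y))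
    (hlow' : ∀ ε : ℝ≥0, 0 < ε → ∀ᶠ y in atTop,
      C' * h y ≤ (1 + ε : ℝ≥0) * ((d + ε : ℝ≥0) * p' y + ε * h y)) :
    Tendsto (fun y => (p y).toReal / (h y).toReal) atTop (𝓝 (C / d)) := by
  have hd' : (0 : ℝ) < d := hd
  have hreal : ∀ ε : ℝ≥0, 0 < ε → ∀ᶠ y in atTop, ∃ r r' : ℝ,
      (p y).toReal / (h y).toReal = r ∧ r + r' ≤ (C + C') / d + ε ∧
      (C / (1 + ε) - ε) / (d + ε) ≤ r ∧ (C' / (1 + ε) - ε) / (d + ε) ≤ r' := by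
    intro ε hε
    have hε' : (0 : ℝ) < ε := hε
    filter_upwards [hh0, hh1, hadd, hup ε hε, hlow ε hε, hlow' ε hε] with y h0 h1 h2 h3 h4 h5
    have hpt : pt y ≠ ∞ := ne_top_of_le_ne_top (ENNReal.mul_ne_top ENNReal.coe_ne_top h1) h3
    have hp : p y ≠ ∞ := ne_top_of_le_ne_top hpt (h2 ▸ le_self_add)
    have hp' : p' y ≠ ∞ := ne_top_of_le_ne_top hpt (h2 ▸ le_add_self)
    lift p y to ℝ≥0 using hp with a ha
    lift p' y to ℝ≥0 using hp' with b hb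
    lift h y to ℝ≥0 using h1 with k hk
    rw [← h2] at h3
    have hk0 : (0 : ℝ) < k := by
      have : k ≠ 0 := by simpa using h0
      exact_mod_cast pos_iff_ne_zero.2 this
    have g3 : (a : ℝ) + b ≤ ((C + C') / d + ε) * k := by exact_mod_cast h3
    have g4 : (C : ℝ) * k ≤ (1 + ε) * ((d + ε) * a + ε * k) := by exact_mod_cast h4
    have g5 : (C' : ℝ) * k ≤ (1 + ε) * ((d + ε) * b + ε * k) := by exact_mod_cast h5
    refine ⟨a / k, b / k, rfl, ?_, ?_, ?_⟩
    · rw [← add_div, div_le_iff₀ hk0]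
      exact g3
    · rw [div_le_div_iff₀ (by positivity) hk0, sub_mul, sub_le_iff_le_add, div_mul_eq_mul_div,
        div_le_iff₀ (by positivity)]
      linarith
    · rw [div_le_div_iff₀ (by positivity) hk0, sub_mul, sub_le_iff_le_add, div_mul_eq_mul_div,
        div_le_iff₀ (by positivity)]
      linarith
  have hlim : ∀ C : ℝ≥0, Tendsto (fun ε : ℝ≥0 => ((C : ℝ) / (1 + ε) - ε) / (d + ε)) (𝓝[>] 0)
      (𝓝 (C / d)) := by
    intro C
    have : ContinuousAt (fun ε : ℝ≥0 => ((C : ℝ) / (1 + ε) - ε) / (d + ε)) 0 := by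
      refine ContinuousAt.div (ContinuousAt.sub (ContinuousAt.div (by fun_prop) (by fun_prop)
        (by simp)) (by fun_prop)) (by fun_prop) (by simpa using hd.ne')
    have h1 := this.tendsto
    simp only [NNReal.coe_zero, add_zero, div_one, sub_zero] at h1
    exact h1.mono_left nhdsWithin_le_nhds
  -- The upper bound for one part is the upper bound for the sum minus the lower bound for the other
  -- part.
  have hup' : Tendsto (fun ε : ℝ≥0 => ((C : ℝ) + C') / d + ε
      - ((C' : ℝ) / (1 + ε) - ε) / (d + ε)) (𝓝[>] 0) (𝓝 (C / d)) := by
    have h1 : Tendsto (fun ε : ℝ≥0 => ((C : ℝ) + C') / d + ε) (𝓝[>] 0) (𝓝 ((C + C') / d)) := by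
      have : ContinuousAt (fun ε : ℝ≥0 => ((C : ℝ) + C') / d + ε) 0 := by fun_prop
      have h2 := this.tendsto
      simp only [NNReal.coe_zero, add_zero] at h2
      exact h2.mono_left nhdsWithin_le_nhds
    have h3 := h1.sub (hlim C')
    have h4 : ((C : ℝ) + C') / d - C' / d = C / d := by ring
    rwa [h4] at h3
  refine tendsto_order.2 ⟨fun a ha => ?_, fun a ha => ?_⟩
  · obtain ⟨ε, h1, h2⟩ := (((hlim C).eventually (lt_mem_nhds ha)).and
      self_mem_nhdsWithin).exists
    filter_upwards [hreal ε h2] with y ⟨r, r', e1, e2, e3, e4⟩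
    rw [e1]
    exact h1.trans_le e3
  · obtain ⟨ε, h1, h2⟩ := ((hup'.eventually (gt_mem_nhds ha)).and
      self_mem_nhdsWithin).exists
    filter_upwards [hreal ε h2] with y ⟨r, r', e1, e2, e3, e4⟩
    rw [e1]
    linarith

/-! ### Regenerative modulation -/

section Main

variable {Ω 𝒳 : Type*} [MeasurableSpace Ω] [MeasurableSpace 𝒳] {μ : Measure Ω}
  [IsProbabilityMeasure μ] {X : ℕ → Ω → 𝒳} {T : ℕ → Ω → ℕ} {P : Kernel 𝒳 ℝ} [IsMarkovKernel P]
  {q : 𝒳 → Ω → ℝ} {x₀ : 𝒳}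

omit [IsProbabilityMeasure μ] in
lemma lintegral_cycleLength_ne_top {j : ℕ}
    (hτ : Integrable (fun ω => (cycleLength T j ω : ℝ)) μ) :
    ∫⁻ ω, (cycleLength T j ω : ℝ≥0∞) ∂μ ≠ ∞ := by
  have h1 := hτ.2.ne
  simpa [← ofReal_norm] using h1

lemma one_le_lintegral_cycleLength (hX : IsRegenerative μ X T) :
    1 ≤ ∫⁻ ω, (cycleLength T 1 ω : ℝ≥0∞) ∂μ := by
  calc (1 : ℝ≥0∞) = ∫⁻ _, 1 ∂μ := by simp
    _ ≤ _ := by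
      refine lintegral_mono_ae ?_
      filter_upwards [hX.strictMono] with ω hω
      have h1 : T 0 ω < T 1 ω := hω one_pos
      have h2 : 1 ≤ cycleLength T 1 ω := by change 1 ≤ T 1 ω - T 0 ω; omega
      exact_mod_cast h2

omit [IsProbabilityMeasure μ] [IsMarkovKernel P] in
lemma integrable_comp_of_integrable {ρ : Measure 𝒳} (hP : ∀ x, Integrable (fun t : ℝ => t) (P x))
    (h : Integrable (fun x => ∫ t, |t| ∂(P x)) ρ) : Integrable (fun t : ℝ => t) (P ∘ₘ ρ) :=
  (Measure.integrable_comp_iff (by fun_prop)).2 ⟨Eventually.of_forall hP, h⟩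

omit [IsMarkovKernel P] in
lemma integral_comp_eq {ρ : Measure 𝒳} (h : Integrable (fun t : ℝ => t) (P ∘ₘ ρ)) :
    ∫ t, t ∂(P ∘ₘ ρ) = ∫ x, ∫ t, t ∂(P x) ∂ρ := by
  rw [Measure.comp_eq_comp_const_apply] at h ⊢
  rw [Kernel.integral_comp h]
  simp

/-- The upper bound: the tail of the maximum. -/
lemma AsympLE.measure_passage (hX : IsRegenerative μ X T)
    (hq : Measurable fun p : 𝒳 × Ω => q p.1 p.2) (hlaw : ∀ x, μ.map (q x) = P x)
    (hτ : ∫⁻ ω, (cycleLength T 1 ω : ℝ≥0∞) ∂μ ≠ ∞)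
    (hi : Integrable (fun t => t) (P ∘ₘ occupation μ X T)) {d : ℝ≥0} (hd : 0 < d)
    (hmean : ∫ t, t ∂(P ∘ₘ occupation μ X T) = -d)
    {H F : Measure ℝ} [IsProbabilityMeasure H] [IsProbabilityMeasure F] (hH : IsSubexpTail H)
    (hF : ∀ y, F (Set.Ioi y) ≠ 0) (hF0 : intTail F 0 ≠ ∞)
    (hFH : ∀ᶠ y in atTop, intTail F y = H (Set.Ioi y)) {c : 𝒳 → ℝ} {L C : ℝ≥0}
    (hc : ∀ x, Tendsto (fun y => P x (Set.Ioi y) / F (Set.Ioi y)) atTop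
      (𝓝 (ENNReal.ofReal (c x)))) (hL : ∀ x y, 0 ≤ y → P x (Set.Ioi y) ≤ L * F (Set.Ioi y))
    (hC : C = ∫⁻ x, ENNReal.ofReal (c x) ∂(occupation μ X T))
    (hτ0 : ∀ b : ℝ≥0, 0 < b →
      AsympLE (fun y => H (Set.Ioi y)) (fun y => μ {ω | y < b * cycleLength T 0 ω}) 0)
    (hτ1 : ∀ b : ℝ≥0, 0 < b →
      AsympLE (fun y => F (Set.Ioi y)) (fun y => μ {ω | y < b * cycleLength T 1 ω}) 0)
    (x₀ : 𝒳) (N : Ω → Set ℕ) :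
    AsympLE (fun y => H (Set.Ioi y)) (fun y =>
      ∫⁻ ω, noiseLaw μ {u | increments X T q x₀ ω u ∈ firstPassage (N ω) y} ∂μ) (C / d) := by
  have hcyc := measurable_cycle hX.measurable_process hX.measurable_time
  obtain ⟨θ, hθp, hθ, b, A, hS⟩ := exists_sumBounds hH hFH hF0 L
  have hPθ : ∀ x, TailLE (positivePart (P x)) θ := fun x => hθ _ inferInstance fun y hy => by
    rw [positivePart_Ioi _ hy]
    exact hL x y hy
  have hfin : IsFiniteMeasure (occupation μ X T) :=
    ⟨by rw [hX.occupation_univ x₀]; exact lt_top_iff_ne_top.2 hτ⟩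
  have hR : AsympLE (fun y => F (Set.Ioi y))
      (fun y => (P ∘ₘ occupation μ X T) (Set.Ioi y)) C :=
    AsympLE.of_tendsto_div (hC ▸ tendsto_comp_tail (occupation μ X T) hc hL) hF
      fun y => measure_ne_top _ _
  have hwords : AsympLE (fun y => H (Set.Ioi y))
      (fun y => ∫⁻ ω, wordSum x₀ (fun x => intTail (P x) y) (cycle X T 1 ω) ∂μ) C := by
    refine (hR.setLIntegral_Ioi hFH).mono (Eventually.of_forall fun y => le_of_eq ?_)
    rw [← hX.lintegral_occupation x₀ (measurable_intTail y) 0, intTail_comp]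
    rfl
  -- The integrated tail of V is that of a word sum. Size biasing turns the assumption on τ relative
  -- to F̄ into the length-weighted tail condition relative to H̄.
  have hK : AsympLE (fun y => H (Set.Ioi y)) (fun y => ∫⁻ t in Set.Ioi y,
      (μ.prod (noiseLaw μ)) {p | t < (cycleSums X T q x₀ 0 p).2}) C := by
    refine (AsympLE.lintegral_intTail_wordLaw (x₀ := x₀) hPθ hH hS (hcyc 1) hτ
      (fun b hb => AsympLE.sizeBias hFH (measurable_cycleLength hX.measurable_time 1) hτ1 hb)
      hwords).mono (Eventually.of_forall fun y => le_of_eq ?_)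
    exact lintegral_Ioi_measure_blockSum hq hlaw (hcyc 1) 1 y
  have h0 : AsympLE (fun y => H (Set.Ioi y))
      (fun y => (μ.prod (noiseLaw μ)) {p | y < initialSum X T q x₀ (fun t => max t 0) p}) 0 := by
    refine (AsympLE.lintegral_wordLaw (x₀ := x₀) hPθ hH hS (hcyc 0) hτ0).mono
      (Eventually.of_forall fun y => le_of_eq ?_)
    exact measure_blockSum_gt hq hlaw (hcyc 0) 0 y
  have hmax := maximum_bound (measurable_cycleSums (x₀ := x₀) hX hq) hH
    (iIndepFun_cycleSums hX hq) (identDistrib_cycleSums hX hq)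
    (fun j p => blockSum_le_blockSum (fun t => le_max_left _ _) _ _)
    (fun j p => blockSum_nonneg (φ := fun t => max t 0) (fun t => le_max_right _ _) _ _)
    (integrable_blockSum_id hX hq hlaw hi 0)
    (integrable_blockSum_cycle hX hq hlaw (by fun_prop) (fun t => le_max_right _ _) hi.pos_part 0)
    hd ((integral_blockSum_id hX hq hlaw hi 0).trans hmean) hK
  exact (AsympLE.initialSum_add_perturbedSum hX hq hH h0 hmax).mono
    (Eventually.of_forall fun y => measure_passage_le hX hq N y)

/-- The lower bound for passage from a given set of states. -/
lemma eventually_le_measure_passage (hX : IsRegenerative μ X T)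
    (hq : Measurable fun p : 𝒳 × Ω => q p.1 p.2) (hlaw : ∀ x, μ.map (q x) = P x)
    (hτ : ∫⁻ ω, (cycleLength T 1 ω : ℝ≥0∞) ∂μ ≠ ∞)
    (hi : Integrable (fun t => t) (P ∘ₘ occupation μ X T)) {d : ℝ≥0} (hd : 0 < d)
    (hmean : ∫ t, t ∂(P ∘ₘ occupation μ X T) = -d)
    {H F : Measure ℝ} [IsProbabilityMeasure H] [IsProbabilityMeasure F] (hH : IsSubexpTail H)
    (hF : ∀ y, F (Set.Ioi y) ≠ 0)
    (hFH : ∀ᶠ y in atTop, intTail F y = H (Set.Ioi y)) {c : 𝒳 → ℝ} {L C : ℝ≥0}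
    (hc : ∀ x, Tendsto (fun y => P x (Set.Ioi y) / F (Set.Ioi y)) atTop
      (𝓝 (ENNReal.ofReal (c x)))) (hL : ∀ x y, 0 ≤ y → P x (Set.Ioi y) ≤ L * F (Set.Ioi y))
    {B : Set 𝒳} (hB : MeasurableSet B)
    (hC : C = ∫⁻ x in B, ENNReal.ofReal (c x) ∂(occupation μ X T)) (x₀ : 𝒳)
    {ε : ℝ≥0} (hε : 0 < ε) :
    ∀ᶠ y in atTop, C * H (Set.Ioi y) ≤ (1 + ε : ℝ≥0) * ((d + ε : ℝ≥0) *
      ∫⁻ ω, noiseLaw μ {u | increments X T q x₀ ω u ∈ firstPassage {n | X (n + 1) ω ∈ B} y} ∂μ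
        + ε * H (Set.Ioi y)) := by
  have hfin : IsFiniteMeasure (occupation μ X T) :=
    ⟨by rw [hX.occupation_univ x₀]; exact lt_top_iff_ne_top.2 hτ⟩
  -- The corridor must descend strictly faster than the drift, hence the step d + ε.
  refine eventually_le_of_tsum_le hH hF hFH
    (hC ▸ tendsto_comp_tail ((occupation μ X T).restrict B) hc hL) (d := d + ε) (by positivity)
    (fun δ hδ => ?_) hε
  obtain ⟨K, hK0, hK⟩ := exists_tsum_le_measure_passage (x₀ := x₀) hX hq hlaw hτ
    (integrable_blockSum_id hX hq hlaw hi 0)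
    (integrable_blockSum_cycle hX hq hlaw (by fun_prop) (fun t => le_max_right _ _) hi.pos_part 0)
    (d := d) (d' := (d + ε : ℝ≥0)) hd (by exact_mod_cast lt_add_of_pos_right d hε)
    ((integral_blockSum_id hX hq hlaw hi 0).trans hmean) hL hδ
  exact ⟨K, hK0, fun y hy => hK y hy B hB⟩

omit [IsProbabilityMeasure μ] [IsMarkovKernel P] in
lemma measurableSet_passage {ξ : ℕ → 𝒳 → Ω → ℝ} (hX : IsRegenerative μ X T)
    (hξ : IsModulatedFamily μ X P ξ) {y : ℝ} (hy : 0 ≤ y) {B : Set 𝒳} (hB : MeasurableSet B) :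
    MeasurableSet {ω | (y : EReal) < walkSup X ξ ω ∧ X (passageTime X ξ y ω) ω ∈ B} := by
  simp only [passage_event_iff hy]
  refine measurableSet_firstPassage_of (N := fun ω => {n | X (n + 1) ω ∈ B})
    (fun n => hX.measurable_process (n + 1) (by omega) hB) (fun n => ?_) y
  exact (hξ.measurable (n := n + 1) (by omega)).comp
    ((hX.measurable_process (n + 1) (by omega)).prodMk measurable_id)

omit [IsProbabilityMeasure μ] [IsMarkovKernel P] in
lemma measure_passage_add_compl {ξ : ℕ → 𝒳 → Ω → ℝ} (hX : IsRegenerative μ X T)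
    (hξ : IsModulatedFamily μ X P ξ) {y : ℝ} (hy : 0 ≤ y) {B : Set 𝒳} (hB : MeasurableSet B) :
    μ {ω | (y : EReal) < walkSup X ξ ω ∧ X (passageTime X ξ y ω) ω ∈ B}
        + μ {ω | (y : EReal) < walkSup X ξ ω ∧ X (passageTime X ξ y ω) ω ∈ Bᶜ}
      = μ {ω | (y : EReal) < walkSup X ξ ω ∧ X (passageTime X ξ y ω) ω ∈ Set.univ} := by
  rw [← measure_union _ (measurableSet_passage hX hξ hy hB.compl)]
  · congr 1
    ext ω
    simp only [Set.mem_union, Set.mem_ofPred_eq, Set.mem_compl_iff, Set.mem_univ]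
    tauto
  · exact Set.disjoint_left.2 fun ω h h' => h'.2 h.2

end Main

end ModulatedWalk

theorem theorem3 {Ω 𝒳 : Type*} [MeasurableSpace Ω] [MeasurableSpace 𝒳]
    (μ : Measure Ω) [IsProbabilityMeasure μ]
    -- the modulating process `X`, regenerative with regeneration times `T`, and `𝐄 τ < ∞`
    (X : ℕ → Ω → 𝒳) (T : ℕ → Ω → ℕ) (hX : IsRegenerative μ X T)
    (hτ : Integrable (fun ω => (cycleLength T 1 ω : ℝ)) μ)
    -- the transition function `P` with distributions `F_x` of finite mean, and the increments
    (P : Kernel 𝒳 ℝ) [IsMarkovKernel P] (hP : ∀ x, Integrable (fun t : ℝ => t) (P x))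
    (ξ : ℕ → 𝒳 → Ω → ℝ) (hξ : IsModulatedFamily μ X P ξ)
    -- the reference distribution `F` on `ℝ₊`, of finite mean
    (F : Measure ℝ) [IsProbabilityMeasure F] (hF_supp : F (Set.Iio 0) = 0)
    (hF_mean : Integrable (fun t : ℝ => t) F)
    -- `F̄_x(y) ∼ c(x) F̄(y)` for all `x`, and `sup_x sup_{y ≥ 0} F̄_x(y) / F̄(y) ≤ L < ∞`
    (c : 𝒳 → ℝ) (hc_meas : Measurable c) (hc_nonneg : ∀ x, 0 ≤ c x)
    (h_tail : ∀ x, Tendsto (fun y => tail (P x) y / tail F y) atTop (𝓝 (c x)))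
    (h_comp : ∃ L : ℝ, ∀ x, ∀ y, 0 ≤ y → tail (P x) y ≤ L * tail F y)
    -- the drift under `π` is `-a < 0`
    (h_abs : Integrable (fun x => ∫ t, |t| ∂(P x)) (regenLaw μ X T))
    (a : ℝ) (ha : 0 < a) (h_drift : ∫ x, (∫ t, t ∂(P x)) ∂(regenLaw μ X T) = -a)
    -- `Fˢ` is subexponential
    (h_sub : IsSubexponential (secondTailLaw F))
    -- `𝐏(bτ_0 > y) = o(F̄ˢ(y))` and `𝐏(bτ > y) = o(F̄(y))` for all `b > 0`
    (h_tau0 : ∀ b : ℝ, 0 < b →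
      (fun y : ℝ => μ.real {ω | y < b * (cycleLength T 0 ω : ℝ)}) =o[atTop] secondTail F)
    (h_tau : ∀ b : ℝ, 0 < b →
      (fun y : ℝ => μ.real {ω | y < b * (cycleLength T 1 ω : ℝ)}) =o[atTop] tail F) :
    ∀ B : Set 𝒳, MeasurableSet B →
      Tendsto (fun y : ℝ =>
          μ.real {ω | (y : EReal) < walkSup X ξ ω ∧ X (passageTime X ξ y ω) ω ∈ B} /
            secondTail F y)
        atTop (𝓝 ((∫ x in B, c x ∂(regenLaw μ X T)) / a)) := by
  obtain ⟨L', hL'⟩ := h_comp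
  obtain ⟨ω₀⟩ : Nonempty Ω := μ.nonempty_of_neZero
  set x₀ : 𝒳 := X 0 ω₀
  have hq := hξ.measurable le_rfl
  have hlaw := hξ.law 1 le_rfl
  have hs0 : ∀ y, 0 ≤ secondTail F y := fun y =>
    le_min zero_le_one (integral_nonneg fun t => tail_nonneg F t)
  have hHp := isProbabilityMeasure_secondTailLaw hF_supp hF_mean
  set H := positivePart (secondTailLaw F)
  have hH : IsSubexpTail H := isSubexpTail_positivePart h_sub
  have hHs : ∀ y, 0 ≤ y → H (Set.Ioi y) = ENNReal.ofReal (secondTail F y) := fun y hy =>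
    positivePart_secondTailLaw_Ioi hF_mean hy
  have hFH : ∀ᶠ y in atTop, intTail F y = H (Set.Ioi y) := by
    filter_upwards [eventually_ofReal_secondTail hF_mean, eventually_ge_atTop 0] with y h1 h2
    rw [hHs y h2, h1]
  -- If F̄ vanished somewhere, the integrated tail would vanish further out, contrary to the
  -- positivity of the tail of `H`.
  have hF : ∀ y, F (Set.Ioi y) ≠ 0 := by
    intro y hy
    obtain ⟨z, hz, hyz⟩ := (hFH.and (eventually_ge_atTop y)).exists
    have h0 : intTail F z = 0 := by
      rw [intTail, setLIntegral_congr_fun (g := fun _ => 0) measurableSet_Ioi fun t ht =>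
        measure_mono_null (Set.Ioi_subset_Ioi (hyz.trans (le_of_lt ht))) hy]
      simp
    exact (hH.pos z).ne' (hz ▸ h0)
  have hFt : ∀ y, 0 < tail F y := fun y => ENNReal.toReal_pos (hF y) (measure_ne_top _ _)
  have hc : ∀ x, Tendsto (fun y => P x (Set.Ioi y) / F (Set.Ioi y)) atTop
      (𝓝 (ENNReal.ofReal (c x))) := fun x =>
    (ENNReal.tendsto_ofReal (h_tail x)).congr fun y => by
      rw [ENNReal.ofReal_div_of_pos (hFt y), ofReal_tail, ofReal_tail]
  have hL : ∀ x y, 0 ≤ y → P x (Set.Ioi y) ≤ L'.toNNReal * F (Set.Ioi y) := fun x y hy => by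
    rw [← ofReal_tail, ← ofReal_tail, ← ENNReal.ofReal_coe_nnreal,
      ← ENNReal.ofReal_mul (by positivity)]
    refine ENNReal.ofReal_le_ofReal ((hL' x y hy).trans ?_)
    exact mul_le_mul_of_nonneg_right (Real.le_coe_toNNReal L') (hFt y).le
  have hτ' := lintegral_cycleLength_ne_top hτ
  obtain ⟨m, hm⟩ := exists_coe_of_ne_top hτ'
  have hm0 : 0 < m := by
    have := one_le_lintegral_cycleLength hX
    rw [← hm] at this
    exact zero_lt_one.trans_le (by exact_mod_cast this)
  have hm0' : (m : ℝ≥0∞) ≠ 0 := by simpa using hm0.ne'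
  have hreg : regenLaw μ X T = (m : ℝ≥0∞)⁻¹ • occupation μ X T := by rw [regenLaw, ← hm]
  have hinv0 : (m : ℝ≥0∞)⁻¹ ≠ 0 := ENNReal.inv_ne_zero.2 ENNReal.coe_ne_top
  have hinv1 : (m : ℝ≥0∞)⁻¹ ≠ ∞ := ENNReal.inv_ne_top.2 hm0'
  have hinvr : ((m : ℝ≥0∞)⁻¹).toReal = (m : ℝ)⁻¹ := by simp
  rw [hreg, integrable_smul_measure hinv0 hinv1] at h_abs
  rw [hreg, integral_smul_measure, hinvr, smul_eq_mul] at h_drift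
  have hi := integrable_comp_of_integrable hP h_abs
  have hmr : (0 : ℝ) < m := hm0
  -- Here m = Eτ: the occupation measure is m π, so a cycle sum has mean -a m.
  have hd : 0 < a.toNNReal * m := mul_pos (Real.toNNReal_pos.2 ha) hm0
  have hdr : ((a.toNNReal * m : ℝ≥0) : ℝ) = a * m := by
    rw [NNReal.coe_mul, Real.coe_toNNReal a ha.le]
  have hmean : ∫ t, t ∂(P ∘ₘ occupation μ X T) = -((a.toNNReal * m : ℝ≥0) : ℝ) := by
    rw [integral_comp_eq hi, hdr]
    field_simp at h_drift
    linarith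
  have hfin : IsFiniteMeasure (occupation μ X T) :=
    ⟨by rw [hX.occupation_univ x₀]; exact lt_top_iff_ne_top.2 hτ'⟩
  have hcL : ∀ x, ENNReal.ofReal (c x) ≤ L'.toNNReal := fun x => by
    refine le_of_tendsto (hc x) ?_
    filter_upwards [eventually_ge_atTop 0] with y hy
    exact ENNReal.div_le_of_le_mul (hL x y hy)
  have hcfin : ∀ D : Set 𝒳, ∫⁻ x in D, ENNReal.ofReal (c x) ∂(occupation μ X T) ≠ ∞ := by
    intro D
    refine ne_top_of_le_ne_top ?_ (lintegral_mono hcL)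
    rw [lintegral_const]
    exact ENNReal.mul_ne_top ENNReal.coe_ne_top (measure_ne_top _ _)
  have hτ0 : ∀ b : ℝ≥0, 0 < b →
      AsympLE (fun y => H (Set.Ioi y)) (fun y => μ {ω | y < b * cycleLength T 0 ω}) 0 :=
    fun b hb => AsympLE.zero_of_isLittleO (fun _ => measureReal_nonneg)
      hs0 (h_tau0 b hb)
      (Eventually.of_forall fun y => (ofReal_measureReal).symm)
      ((eventually_ge_atTop 0).mono hHs)
  have hτ1 : ∀ b : ℝ≥0, 0 < b →
      AsympLE (fun y => F (Set.Ioi y)) (fun y => μ {ω | y < b * cycleLength T 1 ω}) 0 :=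
    fun b hb => AsympLE.zero_of_isLittleO (fun _ => measureReal_nonneg) (tail_nonneg F)
      (h_tau b hb) (Eventually.of_forall fun y => (ofReal_measureReal).symm)
      (Eventually.of_forall fun y => (ofReal_tail F y).symm)
  intro B hB
  obtain ⟨C, hC⟩ := exists_coe_of_ne_top (hcfin B)
  obtain ⟨C', hC'⟩ := exists_coe_of_ne_top (hcfin Bᶜ)
  have hCC : ((C + C' : ℝ≥0) : ℝ≥0∞) = ∫⁻ x, ENNReal.ofReal (c x) ∂(occupation μ X T) := by
    rw [ENNReal.coe_add, hC, hC', lintegral_add_compl _ hB]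
  have hpass : ∀ D, MeasurableSet D → ∀ᶠ y : ℝ in atTop,
      μ {ω | (y : EReal) < walkSup X ξ ω ∧ X (passageTime X ξ y ω) ω ∈ D}
        = ∫⁻ ω, noiseLaw μ {u | increments X T (ξ 1) x₀ ω u
          ∈ firstPassage {n | X (n + 1) ω ∈ D} y} ∂μ := fun D hD => by
    filter_upwards [eventually_ge_atTop 0] with y hy
    exact measure_passage_eq_lintegral hX hξ x₀ hy hD
  have hlow : ∀ (D : Set 𝒳) (E : ℝ≥0), MeasurableSet D →
      (E : ℝ≥0∞) = ∫⁻ x in D, ENNReal.ofReal (c x) ∂(occupation μ X T) → ∀ ε : ℝ≥0, 0 < ε →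
      ∀ᶠ y : ℝ in atTop, E * H (Set.Ioi y) ≤ (1 + ε : ℝ≥0) * ((a.toNNReal * m + ε : ℝ≥0) *
        μ {ω | (y : EReal) < walkSup X ξ ω ∧ X (passageTime X ξ y ω) ω ∈ D}
          + ε * H (Set.Ioi y)) := fun D E hD hE ε hε => by
    filter_upwards [hpass D hD, eventually_le_measure_passage hX hq hlaw hτ' hi hd hmean hH hF hFH
      hc hL hD hE x₀ hε] with y h1 h2
    rw [h1]
    exact h2
  have hup : AsympLE (fun y => H (Set.Ioi y)) (fun y : ℝ => μ {ω | (y : EReal) < walkSup X ξ ω ∧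
      X (passageTime X ξ y ω) ω ∈ Set.univ}) ((C + C') / (a.toNNReal * m)) :=
    (AsympLE.measure_passage hX hq hlaw hτ' hi hd hmean hH hF (intTail_zero_ne_top hF_mean) hFH hc
      hL hCC hτ0 hτ1 x₀ fun ω => {n | X (n + 1) ω ∈ Set.univ}).mono
      ((hpass Set.univ MeasurableSet.univ).mono fun y hy => hy.le)
  have hlim := tendsto_of_bounds hd (Eventually.of_forall fun y => (hH.pos y).ne')
    (Eventually.of_forall fun y => measure_ne_top _ _)
    ((eventually_ge_atTop 0).mono fun y hy => measure_passage_add_compl hX hξ hy hB)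
    hup (hlow B C hB hC) (hlow Bᶜ C' hB.compl hC')
  -- The factor Eτ cancels between the occupation measure and the drift per cycle.
  have hval : (∫ x in B, c x ∂(regenLaw μ X T)) / a = (C : ℝ) / (a.toNNReal * m : ℝ≥0) := by
    rw [hreg, Measure.restrict_smul, integral_smul_measure, hinvr,
      integral_eq_lintegral_of_nonneg_ae (Eventually.of_forall hc_nonneg)
        hc_meas.aestronglyMeasurable, ← hC, hdr, ENNReal.coe_toReal, smul_eq_mul]
    field_simp
  rw [hval]
  refine hlim.congr' ?_
  filter_upwards [eventually_ge_atTop 0] with y hy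
  rw [hHs y hy, ENNReal.toReal_ofReal (hs0 y)]
  rfl
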